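/- Fix an infinite set $D$ of data values. A database schema $\sigma$ is a finite set of relation names, each with an arity. An instance over $\sigma$ is a finite set of facts $R(a_1,\dots,a_r)$ with $R\in\sigma$ of arity $r$ and $a_i\in D$. A conjunctive query with negation and inequalities over $\sigma$ is an expression $$T(\bar x)\leftarrow R_1(\bar y_1),\dots,R_m(\bar y_m),\ \lnot S_1(\bar z_1),\dots,\lnot S_n(\bar z_n),\ \beta_1,\dots,\beta_p,$$ where the $R_i(\bar y_i)$ and $S_j(\bar z_j)$ are atoms over $\sigma$ with variables as arguments, $T\notin\sigma$, each $\beta_l$ is an inequality $s\neq s'$ between distinct variables occurring in the $\bar y_i$ or $\bar z_j$, and every variable of $\bar x$ and of every $\bar z_j$ occurs in some $\bar y_i$. Its result on an instance $I$ is the set of facts $T(V(\bar x))$, where $V$ maps variables to $D$ such that $V(s)\neq V(s')$ for every inequality $s\neq s'$ of the query, all facts $R_i(V(\bar y_i))$ are in $I$, and no fact $S_j(V(\bar z_j))$ is in $I$. A union of conjunctive queries with negation and inequalities ($\mathrm{UCQ}^{\lnot,\neq}$) over $\sigma$ is a finite nonempty union of such queries with the same head relation name $T$; its result on $I$ is the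 union of the results of its disjuncts. For two such queries over the same schema $\sigma$, $Q_1\subseteq Q_2$ means that $Q_1(I)\subseteq Q_2(I)$ for every instance $I$ over $\sigma$. Queries are given to algorithms as strings over a finite alphabet, in which relation names and variables are written as binary strings. Then: 1. The problem to decide, given two $\mathrm{UCQ}^{\lnot,\neq}$s $Q_1,Q_2$ over a common schema, whether $Q_1\subseteq Q_2$, is in $\mathrm{coNEXPTIME}$. 2. For every $k\in\mathbb N$, the problem to decide, given two $\mathrm{UCQ}^{\lnot,\neq}$s $Q_1,Q_2$ over a common schema whose relations all have arity at most $k$, whether $Q_1\subseteq Q_2$, is in $\Pi_2^p$. -/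

import Mathlib

/-! ## Complexity classes

The deterministic machine model is Mathlib's multi-stack Turing machine `Turing.FinTM2`, with its
notion `Turing.TM2ComputableInPolyTime` of polynomial-time computability. -/

namespace Complexity

/-- A nondeterministic multi-stack Turing machine: a machine with two programs `m` and `m'`, either
of which may be used in each step, and an accepting label. -/
structure NTM extends Turing.FinTM2 where
  /-- the alternative program -/
  m' : Λ → Turing.TM2.Stmt Γ Λ σ
  /-- the accepting label -/
  accept : Λ

namespace NTM

/-- One step of a nondeterministic machine. -/
def Step (M : NTM) (c c' : M.toFinTM2.Cfg) : Prop :=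
  c' ∈ Turing.TM2.step M.m c ∨ c' ∈ Turing.TM2.step M.m' c

/-- `M.ReachesIn n c c'`: some run of exactly `n` steps leads from `c` to `c'`. -/
def ReachesIn (M : NTM) : ℕ → M.toFinTM2.Cfg → M.toFinTM2.Cfg → Prop
  | 0, c, c' => c = c'
  | n + 1, c, c' => ∃ d, M.Step c d ∧ M.ReachesIn n d c'

/-- `M` has an accepting run of at most `t` steps on the input `x`. -/
def AcceptsWithin (M : NTM) (x : List (M.Γ M.k₀)) (t : ℕ) : Prop :=
  ∃ n ≤ t, ∃ c : M.toFinTM2.Cfg,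
    M.ReachesIn n (Turing.initList M.toFinTM2 x) c ∧ c.l = some M.accept

end NTM

/-- `L ∈ NEXPTIME`: some nondeterministic machine has, for some polynomial `p`, an accepting run of
at most `2 ^ p(|x|)` steps on exactly those inputs `x` that belong to `L`. -/
def NEXPTIME {α : Type} (L : Set (List α)) : Prop :=
  ∃ (M : NTM) (e : M.Γ M.k₀ ≃ α) (p : Polynomial ℕ),
    ∀ x : List α, x ∈ L ↔ M.AcceptsWithin (x.map e.symm) (2 ^ p.eval x.length)

/-- `L ∈ coNEXPTIME`. -/
def CoNEXPTIME {α : Type} (L : Set (List α)) : Prop :=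
  NEXPTIME Lᶜ

/-- The string `x # u # v`. -/
def encodeTriple {α : Type} (t : List α × List Bool × List Bool) : List (Option (α ⊕ Bool)) :=
  t.1.map (fun a => some (Sum.inl a)) ++ none ::
    (t.2.1.map (fun b => some (Sum.inr b)) ++ none :: t.2.2.map (fun b => some (Sum.inr b)))

/-- `L ∈ Π₂ᵖ`: there are a polynomial `p` and a relation `R`, decidable in polynomial time, such
that `x ∈ L` iff for all `u` with `|u| ≤ p(|x|)` there is a `v` with `|v| ≤ p(|x|)` and
`R (x, u, v)`. -/
def Pi2P {α : Type} (L : Set (List α)) : Prop :=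
  ∃ (p : Polynomial ℕ) (R : List α × List Bool × List Bool → Bool),
    Nonempty (Turing.TM2ComputableInPolyTime encodeTriple Computability.encodeBool R) ∧
    ∀ x : List α, x ∈ L ↔
      ∀ u : List Bool, u.length ≤ p.eval x.length →
        ∃ v : List Bool, v.length ≤ p.eval x.length ∧ R (x, u, v) = true

end Complexity

/-! ## Unions of conjunctive queries with negation and inequalities -/

namespace UCQNeg

/-- Relation names and variables are strings over `{0, 1}`. -/
abbrev Name := List Bool

/-- A database schema: a finite set of relation names, where every relation name has an arity
(also those outside the schema, which serve as output relations). -/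
structure Schema where
  rels : Finset Name
  ar : Name → ℕ

/-- `R(x₁, …, x_k)` with entries from `X`: an atom if `X` is the set of variables, a fact if `X` is
the set of data values. -/
structure Atom (X : Type*) where
  rel : Name
  args : List X

namespace Atom

/-- The atom or fact is over the schema `S`. -/
def Over {X : Type*} (S : Schema) (A : Atom X) : Prop :=
  A.rel ∈ S.rels ∧ A.args.length = S.ar A.rel

/-- The fact `V(A)`. -/
def map {X Y : Type*} (V : X → Y) (A : Atom X) : Atom Y :=
  ⟨A.rel, A.args.map V⟩

end Atom

/-- The expression
`head ← pos₁, …, pos_m, ¬ neg₁, …, ¬ neg_n, ineqs₁, …, ineqs_p`,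
where `(s, s')` in `ineqs` stands for `s ≠ s'`. -/
structure CQ where
  head : Atom Name
  pos : List (Atom Name)
  neg : List (Atom Name)
  ineqs : List (Name × Name)

namespace CQ

/-- `x` occurs in a positive atom. -/
def PosVar (q : CQ) (x : Name) : Prop := ∃ A ∈ q.pos, x ∈ A.args

/-- `x` occurs in a negated atom. -/
def NegVar (q : CQ) (x : Name) : Prop := ∃ A ∈ q.neg, x ∈ A.args

/-- `q` is a conjunctive query with (safe) negation and inequalities over the input schema `S`. -/
structure WF (S : Schema) (q : CQ) : Prop where
  pos_over : ∀ A ∈ q.pos, A.Over S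
  neg_over : ∀ A ∈ q.neg, A.Over S
  ineqs_ne : ∀ b ∈ q.ineqs, b.1 ≠ b.2
  ineqs_vars : ∀ b ∈ q.ineqs, (q.PosVar b.1 ∨ q.NegVar b.1) ∧ (q.PosVar b.2 ∨ q.NegVar b.2)
  head_rel : q.head.rel ∉ S.rels
  head_ar : q.head.args.length = S.ar q.head.rel
  head_safe : ∀ x ∈ q.head.args, q.PosVar x
  neg_safe : ∀ x, q.NegVar x → q.PosVar x

/-- `V` is a valuation for `q`, i.e. consistent. (Its values outside the variables of `q` play no
role.) -/
def Consistent {D : Type*} (q : CQ) (V : Name → D) : Prop :=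
  (∀ A ∈ q.pos, ∀ B ∈ q.neg, A.map V ≠ B.map V) ∧ ∀ b ∈ q.ineqs, V b.1 ≠ V b.2

/-- The valuation `V` satisfies `q` on the instance `I`. -/
def Satisfies {D : Type*} (q : CQ) (I : Finset (Atom D)) (V : Name → D) : Prop :=
  q.Consistent V ∧ (∀ A ∈ q.pos, A.map V ∈ I) ∧ ∀ A ∈ q.neg, A.map V ∉ I

/-- The result `q(I)`. -/
def result {D : Type*} (q : CQ) (I : Finset (Atom D)) : Set (Atom D) :=
  {f | ∃ V : Name → D, q.Satisfies I V ∧ f = q.head.map V}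

end CQ

/-- The disjuncts of a union of conjunctive queries with negation and inequalities. -/
abbrev UCQ := List CQ

namespace UCQ

/-- `Q` is a union of conjunctive queries with negation and inequalities over the input schema
`S`. -/
structure WF (S : Schema) (Q : UCQ) : Prop where
  ne_nil : Q ≠ []
  disjuncts : ∀ q ∈ Q, CQ.WF S q
  head_rel : ∀ q ∈ Q, ∀ q' ∈ Q, q.head.rel = q'.head.rel

/-- The result `Q(I)`. -/
def result {D : Type*} (Q : UCQ) (I : Finset (Atom D)) : Set (Atom D) :=
  {f | ∃ q ∈ Q, f ∈ CQ.result q I}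

/-- `Q₁ ⊆ Q₂`: on every instance over the schema `S`, with data values from `D`, the result of `Q₁`
is contained in the result of `Q₂`. -/
def Contained (D : Type*) (S : Schema) (Q₁ Q₂ : UCQ) : Prop :=
  ∀ I : Finset (Atom D), (∀ f ∈ I, f.Over S) → result Q₁ I ⊆ result Q₂ I

end UCQ

/-! ## Queries as strings -/

/-- The alphabet in which queries are written. -/
inductive Letter
  | bit (b : Bool)
  | endName
  | endAtom
  | endAtoms
  | endCQ
  | endUCQ

def encodeName (w : Name) : List Letter :=
  w.map Letter.bit ++ [Letter.endName]

def encodeAtom (A : Atom Name) : List Letter :=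
  encodeName A.rel ++ A.args.flatMap encodeName ++ [Letter.endAtom]

def encodeCQ (q : CQ) : List Letter :=
  encodeAtom q.head ++
    (q.pos.flatMap encodeAtom ++ [Letter.endAtoms]) ++
    (q.neg.flatMap encodeAtom ++ [Letter.endAtoms]) ++
    (q.ineqs.flatMap (fun b => encodeName b.1 ++ encodeName b.2) ++ [Letter.endCQ])

def encodeUCQ (Q : UCQ) : List Letter :=
  Q.flatMap encodeCQ ++ [Letter.endUCQ]

/-- The containment problem, as a language: the encodings of the pairs `(Q₁, Q₂)` of unions of
conjunctive queries with negation and inequalities over a common schema such that `Q₁ ⊆ Q₂`. -/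
def Containment (D : Type*) : Set (List Letter) :=
  {x | ∃ (S : Schema) (Q₁ Q₂ : UCQ), UCQ.WF S Q₁ ∧ UCQ.WF S Q₂ ∧
    x = encodeUCQ Q₁ ++ encodeUCQ Q₂ ∧ UCQ.Contained D S Q₁ Q₂}

/-- The containment problem for queries over schemas all of whose relations have arity at most
`k`. -/
def BoundedContainment (D : Type*) (k : ℕ) : Set (List Letter) :=
  {x | ∃ (S : Schema) (Q₁ Q₂ : UCQ), (∀ R ∈ S.rels, S.ar R ≤ k) ∧
    UCQ.WF S Q₁ ∧ UCQ.WF S Q₂ ∧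
    x = encodeUCQ Q₁ ++ encodeUCQ Q₂ ∧ UCQ.Contained D S Q₁ Q₂}

end UCQNeg

/-! Suppose that an instance `J` and a valuation `V` of a disjunct `q` of `Q₁` witness that `Q₁` is
not contained in `Q₂`. Choose for every value of `V` on the variables of `q` one variable with that
value, and let `I` consist of all facts over these representatives, with relations from the bodies
of the queries, whose image under `V` lies in `J`. On the representatives `V` is injective, and `I`
is a copy of an induced part of `J`. Hence `q` still yields its fact on `I`. If `Q₂` yielded it too,
composing with `V` would yield the original fact on `J`: by safety all values of a valuation come
from `I`, so negated atoms are reflected and inequalities are kept. For input length `n` and arities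
at most `k` this leaves at most `n` values and `n * (n + 1) ^ k` facts (`exists_counterexample`,
`exists_certificate`). Conversely, names embed into the infinite set `D`, so containment over `D`
applies to instances whose values are names (`exists_sat_of_contained`).

For fixed `k` the bound is polynomial. Containment then says that for every short description of an
instance and a valuation yielding a fact for `Q₁` there is a short valuation yielding it for `Q₂`,
which is a `Π₂ᵖ` statement (`mem_boundedContainment_iff`).

In general only `k = n` is available, and the instance has exponential size. A certificate of
non-containment adds to it a list of assignments of values to the variables of `Q₂`, none of which
yields the fact. That no relevant assignment is missing is a local condition: a nonempty list closed
under changing one variable to one value agrees somewhere with every assignment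
(`exists_agree_of_closedB`). So the check is polynomial in the length of input and certificate.

The rest serves the machine model. Structured stack programs are compiled to machines
(`Run.iter_code`), with `computableInPolyTime_of_run` and `nexptime_of_run` as the two interfaces to
the complexity classes. The functions computed by programs in polynomial time form a class `PT` that
contains the finite transducers and is closed under composition, pairing, case distinction and
mapping over lists (`PT.flatMap_segs`); both checks are assembled from these. -/

/-! ## Stack programs -/

namespace StackProg

open Function Turing

/-- Structured programs that manipulate stacks indexed by `ℕ`. -/
inductive Prog (A : Type) : Type
  | skip : Prog A
  | push (k : ℕ) (a : A) : Prog A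
  | seq (P Q : Prog A) : Prog A
  /-- pop from stack `k` and branch on the result -/
  | case (k : ℕ) (P : Option A → Prog A) : Prog A
  /-- while stack `k` is nonempty, pop a symbol `a` and run `P a` -/
  | loop (k : ℕ) (P : A → Prog A) : Prog A

/-- The contents of the stacks. -/
abbrev Store (A : Type) := ℕ → List A

variable {A : Type}

/-- `Run P S S' t`: the program `P` turns the store `S` into `S'` in `t` steps. -/
inductive Run : Prog A → Store A → Store A → ℕ → Prop
  | skip (S : Store A) : Run .skip S S 1
  | push (k : ℕ) (a : A) (S : Store A) : Run (.push k a) S (update S k (a :: S k)) 1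
  | seq {P Q : Prog A} {S S' S'' : Store A} {t t' : ℕ} :
      Run P S S' t → Run Q S' S'' t' → Run (.seq P Q) S S'' (t + t')
  | case {k : ℕ} {P : Option A → Prog A} {S S' : Store A} {t : ℕ} :
      Run (P (S k).head?) (update S k (S k).tail) S' t → Run (.case k P) S S' (t + 1)
  | loop_nil {k : ℕ} {P : A → Prog A} {S : Store A} : S k = [] → Run (.loop k P) S S 1
  | loop_cons {k : ℕ} {P : A → Prog A} {S S' S'' : Store A} {a : A} {l : List A} {t t' : ℕ} :
      S k = a :: l → Run (P a) (update S k l) S' t → Run (.loop k P) S' S'' t' →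
        Run (.loop k P) S S'' (t + t' + 1)

/-! ### Renumbering the stacks -/

namespace Prog

/-- The program that works on the stacks from `n` on. -/
def shift (n : ℕ) : Prog A → Prog A
  | skip => skip
  | push k a => push (n + k) a
  | seq P Q => seq (P.shift n) (Q.shift n)
  | case k P => case (n + k) fun o => (P o).shift n
  | loop k P => loop (n + k) fun a => (P a).shift n

/-- A strict upper bound on the stacks used by a program. -/
def bound [Fintype A] : Prog A → ℕ
  | skip => 0
  | push k _ => k + 1
  | seq P Q => max P.bound Q.bound
  | case k P => max (k + 1) (Finset.univ.sup fun o => (P o).bound)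
  | loop k P => max (k + 1) (Finset.univ.sup fun a => (P a).bound)

end Prog

/-- The store with the first `n` stacks from `T`, followed by the stacks of `S`. -/
def frame (n : ℕ) (T S : Store A) : Store A := fun i => if i < n then T i else S (i - n)

@[simp] theorem frame_add (n : ℕ) (T S : Store A) (k : ℕ) : frame n T S (n + k) = S k := by
  simp [frame]

theorem update_frame (n : ℕ) (T S : Store A) (k : ℕ) (x : List A) :
    update (frame n T S) (n + k) x = frame n T (update S k x) := by
  funext i
  by_cases h : i = n + k
  · subst h; simp
  · rw [update_of_ne h]
    unfold frame
    split_ifs with hi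
    · rfl
    · rw [update_of_ne (by omega)]

/-- A shifted program never touches the first `n` stacks, so it can serve as a subroutine while
these keep data that is needed later. -/
theorem Run.shift (n : ℕ) (T : Store A) {P : Prog A} {S S' : Store A} {t : ℕ}
    (h : Run P S S' t) : Run (P.shift n) (frame n T S) (frame n T S') t := by
  induction h with
  | skip S => exact .skip _
  | push k a S =>
    rw [← update_frame]
    simpa [Prog.shift] using Run.push (n + k) a (frame n T S)
  | seq _ _ ih ih' => exact .seq ih ih'
  | case _ ih =>
    refine Run.case ?_
    simpa [update_frame] using ih
  | loop_nil h => exact .loop_nil (by simpa using h)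
  | loop_cons h _ _ ih ih' =>
    refine Run.loop_cons (by simpa using h) ?_ ih'
    simpa [update_frame] using ih

/-! ### Compilation to multi-stack machines -/

/-- The stacks of a machine: an input stack, an output stack and `N` work stacks. -/
abbrev Idx (N : ℕ) := Option (Option (Fin N))

/-- The alphabets of the stacks. -/
@[reducible] def Alph (α β A : Type) {N : ℕ} : Idx N → Type
  | none => α
  | some none => β
  | some (some _) => A

/-- The `i`-th work stack. -/
@[reducible] def work (N : ℕ) [NeZero N] (i : ℕ) : Idx N := some (some (Fin.ofNat N i))

variable {α β : Type} {N : ℕ}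

/-- The stack contents of a machine. -/
def tapes (x : List α) (y : List β) (S : Store A) : ∀ k : Idx N, List (Alph α β A k)
  | none => x
  | some none => y
  | some (some j) => S j

section

variable [NeZero N]

/-- `work` reduces its index modulo `N`; the hypothesis `i < N` excludes a clash of stacks. -/
theorem tapes_work (x : List α) (y : List β) (S : Store A) {i : ℕ} (h : i < N) :
    tapes x y S (work N i) = S i := by
  simp only [tapes, Fin.ofNat, Nat.mod_eq_of_lt h]

theorem update_tapes_work (x : List α) (y : List β) (S : Store A) {i : ℕ} (h : i < N)
    (z : List A) :
    update (tapes x y S) (work N i) z = tapes x y (update S i z) := by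
  funext k
  match k with
  | none => rw [update_of_ne (by simp [work])]; rfl
  | some none => rw [update_of_ne (by simp [work])]; rfl
  | some (some j) =>
    by_cases hj : (j : ℕ) = i
    · have : some (some j) = work N i := by
        simp [work, Fin.ext_iff, Fin.ofNat, Nat.mod_eq_of_lt h, hj]
      cases this
      rw [update_self]
      simp [tapes, Nat.mod_eq_of_lt h]
    · rw [update_of_ne]
      · simp [tapes, update_of_ne hj]
      · simp [work, Fin.ext_iff, Fin.ofNat, Nat.mod_eq_of_lt h, hj]

theorem update_tapes_input (x x' : List α) (y : List β) (S : Store A) :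
    update (tapes (N := N) x y S) none x' = tapes x' y S := by
  funext k
  match k with
  | none => rfl
  | some none => rfl
  | some (some j) => rfl

theorem update_tapes_output (x : List α) (y y' : List β) (S : Store A) :
    update (tapes (N := N) x y S) (some none) y' = tapes x y' S := by
  funext k
  match k with
  | none => rfl
  | some none => rfl
  | some (some j) => rfl

end

namespace Prog

/-- The control points of a program. -/
@[reducible] def Lab : Prog A → Type
  | skip => Unit
  | push _ _ => Unit
  | seq P Q => P.Lab ⊕ Q.Lab
  | case _ P => Option (Σ o, (P o).Lab)
  | loop _ P => Option (Σ a, (P a).Lab)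

noncomputable instance fintypeLab [Fintype A] : ∀ P : Prog A, Fintype P.Lab
  | skip => inferInstanceAs (Fintype Unit)
  | push _ _ => inferInstanceAs (Fintype Unit)
  | seq P Q =>
    have := P.fintypeLab
    have := Q.fintypeLab
    inferInstanceAs (Fintype (P.Lab ⊕ Q.Lab))
  | case _ P =>
    have := fun o => (P o).fintypeLab
    inferInstanceAs (Fintype (Option (Σ o, (P o).Lab)))
  | loop _ P =>
    have := fun a => (P a).fintypeLab
    inferInstanceAs (Fintype (Option (Σ a, (P a).Lab)))

/-- The control point at which a program starts. -/
def entry : ∀ P : Prog A, P.Lab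
  | skip => ()
  | push _ _ => ()
  | seq P _ => Sum.inl P.entry
  | case _ _ => (none : Option _)
  | loop _ _ => (none : Option _)

/-- The machine code of a program, with labels embedded by `emb`, which continues at `exit`. -/
def code [NeZero N] {Λ : Type} : ∀ (P : Prog A) (_ : P.Lab → Λ) (_ : Λ),
    P.Lab → TM2.Stmt (Alph α β A (N := N)) Λ (Option α × Option A)
  | skip, _, exit, _ => .goto fun _ => exit
  | push k a, _, exit, _ => .push (work N k) (fun _ => a) (.goto fun _ => exit)
  | seq P Q, emb, exit, l =>
    match l with
    | Sum.inl l => P.code (fun l => emb (Sum.inl l)) (emb (Sum.inr Q.entry)) l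
    | Sum.inr l => Q.code (fun l => emb (Sum.inr l)) exit l
  | case k P, emb, exit, l =>
    match l with
    | none => .pop (work N k) (fun s o => (s.1, o)) (.goto fun s => emb (some ⟨s.2, (P s.2).entry⟩))
    | some ⟨o, l⟩ => (P o).code (fun l => emb (some ⟨o, l⟩)) exit l
  | loop k P, emb, exit, l =>
    match l with
    | none => .pop (work N k) (fun s o => (s.1, o)) (.goto fun s =>
        match s.2 with
        | none => exit
        | some a => emb (some ⟨a, (P a).entry⟩))
    | some ⟨a, l⟩ => (P a).code (fun l => emb (some ⟨a, l⟩)) (emb none) l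

end Prog

/-- `Iter R n c c'`: a path of `n` steps of `R` leads from `c` to `c'`. -/
def Iter {C : Type*} (R : C → C → Prop) : ℕ → C → C → Prop
  | 0, c, c' => c = c'
  | n + 1, c, c' => ∃ d, R c d ∧ Iter R n d c'

theorem Iter.trans {C : Type*} {R : C → C → Prop} {m n : ℕ} {c d e : C} (h : Iter R m c d)
    (h' : Iter R n d e) : Iter R (m + n) c e := by
  induction m generalizing c with
  | zero => cases h; simpa using h'
  | succ m ih =>
    obtain ⟨b, hb, h⟩ := h
    rw [Nat.succ_add]
    exact ⟨b, hb, ih h⟩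

theorem Iter.single {C : Type*} {R : C → C → Prop} {c d : C} (h : R c d) : Iter R 1 c d :=
  ⟨d, h, rfl⟩

theorem Iter.mono {C : Type*} {R R' : C → C → Prop} (hR : ∀ c d, R c d → R' c d) {n : ℕ} {c d : C}
    (h : Iter R n c d) : Iter R' n c d := by
  induction n generalizing c with
  | zero => exact h
  | succ n ih => obtain ⟨b, hb, h⟩ := h; exact ⟨b, hR _ _ hb, ih h⟩

/-- A machine that contains the code of a program executes the runs of that program. -/
theorem Run.iter_code [Fintype A] [NeZero N] {Λ : Type} {P : Prog A} {S S' : Store A} {t : ℕ}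
    (h : Run P S S' t) (hN : P.bound ≤ N) (emb : P.Lab → Λ) (exit : Λ)
    (R : TM2.Cfg (Alph α β A (N := N)) Λ (Option α × Option A) →
      TM2.Cfg (Alph α β A (N := N)) Λ (Option α × Option A) → Prop)
    (hR : ∀ l v T, R ⟨some (emb l), v, T⟩ (TM2.stepAux (P.code emb exit l) v T))
    (x : List α) (y : List β) (v : Option α × Option A) :
    ∃ o, Iter R t ⟨some (emb P.entry), v, tapes x y S⟩ ⟨some exit, (v.1, o), tapes x y S'⟩ := by
  -- Both must vary: the first half of a sequence exits to the entry of the second, and every pop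
  -- overwrites the second register, whose final value is therefore only claimed to exist.
  induction h generalizing v exit with
  | skip S => exact ⟨v.2, .single (hR () v _)⟩
  | push k a S =>
    refine ⟨v.2, ?_⟩
    have h := hR () v (tapes x y S)
    have hk : k < N := hN
    simp only [Prog.code, TM2.stepAux] at h
    rw [tapes_work x y S hk] at h
    erw [update_tapes_work x y S hk] at h
    exact .single h
  | seq _ _ ih ih' =>
    have hP := (le_max_left _ _).trans hN
    have hQ := (le_max_right _ _).trans hN
    obtain ⟨o, ho⟩ := ih hP (fun l => emb (Sum.inl l)) (emb (Sum.inr (Prog.entry _)))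
      (fun l => hR (Sum.inl l)) v
    obtain ⟨o', ho'⟩ := ih' hQ (fun l => emb (Sum.inr l)) exit (fun l => hR (Sum.inr l)) (v.1, o)
    exact ⟨o', ho.trans ho'⟩
  | @case k P S S' t _ ih =>
    have hk : k < N := (le_max_left _ _).trans hN
    have hP : (P (S k).head?).bound ≤ N := by
      refine le_trans ?_ ((le_max_right _ _).trans hN)
      exact Finset.le_sup (f := fun o => (P o).bound) (Finset.mem_univ _)
    have h := hR none v (tapes x y S)
    simp only [Prog.code, TM2.stepAux] at h
    rw [tapes_work x y S hk] at h
    erw [update_tapes_work x y S hk] at h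
    obtain ⟨o, ho⟩ := ih hP (fun l => emb (some ⟨_, l⟩)) exit (fun l => hR (some ⟨_, l⟩))
      (v.1, (S k).head?)
    rw [Nat.add_comm]
    exact ⟨o, (Iter.single h).trans ho⟩
  | @loop_nil k P S hS =>
    have hk : k < N := (le_max_left _ _).trans hN
    have h := hR none v (tapes x y S)
    simp only [Prog.code, TM2.stepAux] at h
    rw [tapes_work x y S hk] at h
    erw [update_tapes_work x y S hk] at h
    rw [show (S k).tail = S k by rw [hS]; rfl, update_eq_self,
      show (S k).head? = none by rw [hS]; rfl] at h
    exact ⟨none, .single h⟩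
  | @loop_cons k P S S' S'' a l t t' hS _ _ ih ih' =>
    have hk : k < N := (le_max_left _ _).trans hN
    have hP : (P a).bound ≤ N := by
      refine le_trans ?_ ((le_max_right _ _).trans hN)
      exact Finset.le_sup (f := fun o => (P o).bound) (Finset.mem_univ _)
    have h := hR none v (tapes x y S)
    simp only [Prog.code, TM2.stepAux] at h
    rw [tapes_work x y S hk] at h
    erw [update_tapes_work x y S hk] at h
    rw [show (S k).tail = l by rw [hS]; rfl, show (S k).head? = some a by rw [hS]; rfl] at h
    -- The body exits to the loop header `emb none`, where the hypothesis for the remaining rounds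
    -- applies.
    obtain ⟨o, ho⟩ := ih hP (fun l => emb (some ⟨a, l⟩)) (emb none) (fun l => hR (some ⟨a, l⟩))
      (v.1, some a)
    obtain ⟨o', ho'⟩ := ih' hN emb exit hR (v.1, o)
    rw [show t + t' + 1 = 1 + t + t' by ring]
    exact ⟨o', ((Iter.single h).trans ho).trans ho'⟩

end StackProg

/-! ### Programs as polynomial-time deciders -/

namespace StackProg

open Function Turing

variable {A : Type}

/-- The store with the stacks listed in `l`, followed by empty ones. -/
def st (l : List (List A)) : Store A := fun i => l.getD i []

variable [Fintype A]

/-! ### Deterministic machines -/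

/-- The form in which `TM2OutputsInTime` records a run: the partial step function iterated on
`Option`. -/
theorem Iter.bind_iterate {C : Type*} {f : C → Option C} {n : ℕ} {c d : C}
    (h : Iter (fun c d => f c = some d) n c d) : (flip bind f)^[n] (some c) = some d := by
  induction n generalizing c with
  | zero => cases h; rfl
  | succ n ih =>
    obtain ⟨b, hb, h⟩ := h
    rw [iterate_succ_apply, ← ih h]
    congr 1

section

variable {α : Type} [Fintype α] (emb : α → A) (a₀ : A) (P : Prog A)

/-- The statement that moves one symbol of the input to work stack `0`. -/
def readStmt {β Λ : Type} {N : ℕ} [NeZero N] (read next : Λ) :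
    TM2.Stmt (Alph α β A (N := N)) Λ (Option α × Option A) :=
  .pop none (fun s o => (o, s.2)) <|
    .branch (fun s => s.1.isSome)
      (.push (work N 0) (fun s => (s.1.map emb).getD a₀) (.goto fun _ => read))
      (.goto fun _ => next)

/-- Symbols are popped from the input and pushed onto the work stack, so the word arrives reversed;
hence `(x.map emb).reverse` in the specifications below. The last of the `x.length + 1` steps
notices the end of the input. The default `a₀` is never pushed. -/
theorem iter_read {β Λ : Type} {N : ℕ} [NeZero N] (read next : Λ)
    (R : TM2.Cfg (Alph α β A (N := N)) Λ (Option α × Option A) →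
      TM2.Cfg (Alph α β A (N := N)) Λ (Option α × Option A) → Prop)
    (hR : ∀ v T, R ⟨some read, v, T⟩ (TM2.stepAux (readStmt emb a₀ read next) v T))
    (x : List α) (y : List β) (l : List A) (v : Option α × Option A) :
    Iter R (x.length + 1) ⟨some read, v, tapes x y (st [l])⟩
      ⟨some next, (none, v.2), tapes [] y (st [(x.map emb).reverse ++ l])⟩ := by
  induction x generalizing l v with
  | nil =>
    have h := hR v (tapes [] y (st [l]))
    simp only [readStmt, TM2.stepAux] at h
    erw [update_tapes_input] at h
    exact .single h
  | cons a x ih =>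
    have h := hR v (tapes (a :: x) y (st [l]))
    simp only [readStmt, TM2.stepAux] at h
    erw [update_tapes_input] at h
    rw [tapes_work _ _ _ (NeZero.pos N)] at h
    erw [update_tapes_work _ _ _ (NeZero.pos N)] at h
    have hl : update (st [l]) 0 (emb a :: st [l] 0) = st [emb a :: l] := by
      funext i; cases i <;> simp [st]
    refine ⟨_, h, ?_⟩
    have := ih (emb a :: l) (some a, v.2)
    rw [← hl] at this
    simpa [tapes] using this

/-- The machine that reads its input, runs the program `P`, and outputs whether work stack `0` is
nonempty. -/
noncomputable def machine : FinTM2 where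
  K := Idx (P.bound + 1)
  k₀ := none
  k₁ := some none
  Γ := Alph α Bool A
  Λ := P.Lab ⊕ Bool
  main := Sum.inr false
  σ := Option α × Option A
  initialState := (none, none)
  Γk₀Fin := inferInstanceAs (Fintype α)
  m l :=
    match l with
    | Sum.inl l => P.code Sum.inl (Sum.inr true) l
    | Sum.inr false => readStmt emb a₀ (Sum.inr false) (Sum.inl P.entry)
    | Sum.inr true => .pop (work _ 0) (fun s o => (s.1, o)) <|
        .push (some none) (fun s => s.2.isSome) <| .load (fun _ => (none, none)) .halt

theorem machine_outputs {x : List α} {b : Bool} {t : ℕ}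
    (h : Run P (st [(x.map emb).reverse]) (st [if b then [a₀] else []]) t) :
    Nonempty (TM2OutputsInTime (machine emb a₀ P) x (some [b]) (x.length + t + 2)) := by
  let R : (machine emb a₀ P).Cfg → (machine emb a₀ P).Cfg → Prop :=
    fun c d => (machine emb a₀ P).step c = some d
  have hi : initList (machine emb a₀ P) x = ⟨some (Sum.inr false), (none, none),
      tapes x [] (st [[]])⟩ := by
    simp only [initList, machine]
    congr 1
    funext k
    match k with
    | none => rfl
    | some none => rfl
    | some (some j) => simp [tapes, st, List.getD_eq_getElem?_getD]
  have h1 := iter_read (N := P.bound + 1) (β := Bool) (Λ := P.Lab ⊕ Bool) emb a₀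
    (Sum.inr false) (Sum.inl P.entry) R (fun v T => rfl) x [] [] (none, none)
  obtain ⟨o, h2⟩ := h.iter_code (N := P.bound + 1) (Nat.le_succ _) (Λ := P.Lab ⊕ Bool) Sum.inl
    (Sum.inr true) R (fun l v T => rfl) [] [] (none, none)
  -- `haltList` demands empty stacks apart from the output and the initial register: the pop removes
  -- the only symbol of the answer, and the load resets the register.
  have h3 : R ⟨some (Sum.inr true), (none, o), tapes [] [] (st [if b then [a₀] else []])⟩
      (haltList (machine emb a₀ P) [b]) := by
    have e : TM2.stepAux ((machine emb a₀ P).m (Sum.inr true)) (none, o)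
        (tapes [] [] (st [if b then [a₀] else []])) = haltList (machine emb a₀ P) [b] := by
      simp only [machine, TM2.stepAux]
      rw [tapes_work _ _ _ (NeZero.pos _)]
      erw [update_tapes_work _ _ _ (NeZero.pos _)]
      erw [update_tapes_output]
      simp only [haltList]
      congr 1
      funext k
      match k with
      | none => rfl
      | some none => cases b <;> rfl
      | some (some j) =>
        by_cases hj : (j : ℕ) = 0
        · cases b <;> simp [tapes, hj, st]
        · cases b <;> simp [tapes, st, hj, List.getD_eq_getElem?_getD]
    exact congrArg some e
  rw [List.append_nil] at h1
  have := (h1.trans h2).trans (.single h3)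
  rw [show x.length + 1 + t + 1 = x.length + t + 2 by ring] at this
  refine ⟨⟨⟨x.length + t + 2, ?_⟩, le_rfl⟩⟩
  rw [hi]
  exact this.bind_iterate

/-- A predicate decided by a program in polynomial time is decided by a machine in polynomial
time. -/
theorem computableInPolyTime_of_run {τ : Type} {ea : τ → List α} {f : τ → Bool}
    (p : Polynomial ℕ)
    (h : ∀ w, ∃ t ≤ p.eval (ea w).length,
      Run P (st [((ea w).map emb).reverse]) (st [if f w then [a₀] else []]) t) :
    Nonempty (TM2ComputableInPolyTime ea Computability.encodeBool f) := by
  refine ⟨⟨⟨machine emb a₀ P, Equiv.refl _, Equiv.refl _⟩, p + Polynomial.X + 2, fun w => ?_⟩⟩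
  refine Classical.choice ?_
  obtain ⟨t, ht, hr⟩ := h w
  obtain ⟨s⟩ := machine_outputs emb a₀ P hr
  have e1 : List.map (Equiv.refl α).invFun (ea w) = ea w := List.map_id _
  refine ⟨⟨⟨s.steps, ?_⟩, s.steps_le_m.trans ?_⟩⟩
  · have := s.evals_in_steps
    erw [e1]
    exact this
  · simp only [Polynomial.eval_add, Polynomial.eval_X, Polynomial.eval_ofNat]
    omega

end

end StackProg

/-! ### Guessing certificates of exponential length -/

namespace StackProg

open Function Turing Complexity

/-! ### Exponential bounds -/

/-- The function is bounded by `2 ^ r(n)` for some polynomial `r`. -/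
def ExpBounded (e : ℕ → ℕ) : Prop := ∃ r : Polynomial ℕ, ∀ n, e n ≤ 2 ^ r.eval n

namespace ExpBounded

variable {e e' : ℕ → ℕ}

theorem const (c : ℕ) : ExpBounded fun _ => c :=
  ⟨Polynomial.C c, fun n => by simpa using Nat.lt_two_pow_self.le⟩

theorem id : ExpBounded fun n => n :=
  ⟨Polynomial.X, fun n => by simpa using Nat.lt_two_pow_self.le⟩

theorem mul (h : ExpBounded e) (h' : ExpBounded e') : ExpBounded fun n => e n * e' n :=
  let ⟨r, hr⟩ := h
  let ⟨r', hr'⟩ := h'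
  ⟨r + r', fun n => by
    simpa [pow_add] using Nat.mul_le_mul (hr n) (hr' n)⟩

theorem add (h : ExpBounded e) (h' : ExpBounded e') : ExpBounded fun n => e n + e' n :=
  let ⟨r, hr⟩ := h
  let ⟨r', hr'⟩ := h'
  -- Each summand is at most `2 ^ (r + r')`; the extra `1` in the exponent doubles this.
  ⟨r + r' + 1, fun n => by
    have h1 : 2 ^ r.eval n ≤ 2 ^ (r.eval n + r'.eval n) := Nat.pow_le_pow_right (by simp) (by simp)
    have h2 : 2 ^ r'.eval n ≤ 2 ^ (r.eval n + r'.eval n) := Nat.pow_le_pow_right (by simp) (by simp)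
    have h3 := hr n
    have h4 := hr' n
    simp only [Polynomial.eval_add, Polynomial.eval_one, pow_succ]
    omega⟩

theorem pow (h : ExpBounded e) (q : Polynomial ℕ) : ExpBounded fun n => e n ^ q.eval n :=
  let ⟨r, hr⟩ := h
  ⟨r * q, fun n => by
    simpa [pow_mul] using Nat.pow_le_pow_left (hr n) (q.eval n)⟩

theorem polynomial (h : ExpBounded e) (p : Polynomial ℕ) : ExpBounded fun n => p.eval (e n) := by
  induction p using Polynomial.induction_on' with
  | add p q hp hq => simpa using hp.add hq
  | monomial k c =>
    simpa [Polynomial.eval_monomial] using (const c).mul (h.pow (Polynomial.C k))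

end ExpBounded

/-! ### Nondeterministic machines -/

section

variable {A : Type} [Fintype A] {α : Type} [Fintype α] (emb : α → A) (bit : Bool → A) (a₀ : A)
  (P : Prog A)

/-- The machine that reads its input, writes some bits onto work stack `1`, runs the program `P`,
and accepts if then work stack `0` is nonempty. -/
noncomputable def guessMachine : NTM where
  K := Idx (P.bound + 2)
  k₀ := none
  k₁ := some none
  Γ := Alph α Unit A
  Λ := P.Lab ⊕ Fin 6
  main := Sum.inr 0
  σ := Option α × Option A
  initialState := (none, none)
  Γk₀Fin := inferInstanceAs (Fintype α)
  -- Label `0` reads the input; `1` chooses between running `P` and guessing one more bit; `2`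
  -- writes that bit, false in `m` and true in `m'`; `3` tests stack `0`; `4` accepts and `5`
  -- rejects, both by looping forever.
  m l :=
    match l with
    | Sum.inl l => P.code Sum.inl (Sum.inr 3) l
    | Sum.inr 0 => readStmt emb a₀ (Sum.inr 0) (Sum.inr 1)
    | Sum.inr 1 => .goto fun _ => Sum.inl P.entry
    | Sum.inr 2 => .push (work _ 1) (fun _ => bit false) (.goto fun _ => Sum.inr 1)
    | Sum.inr 3 => .pop (work _ 0) (fun s o => (s.1, o)) <|
        .goto fun s => if s.2.isSome then Sum.inr 4 else Sum.inr 5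
    | Sum.inr 4 => .goto fun _ => Sum.inr 4
    | Sum.inr 5 => .goto fun _ => Sum.inr 5
  m' l :=
    match l with
    | Sum.inl l => P.code Sum.inl (Sum.inr 3) l
    | Sum.inr 0 => readStmt emb a₀ (Sum.inr 0) (Sum.inr 1)
    | Sum.inr 1 => .goto fun _ => Sum.inr 2
    | Sum.inr 2 => .push (work _ 1) (fun _ => bit true) (.goto fun _ => Sum.inr 1)
    | Sum.inr 3 => .pop (work _ 0) (fun s o => (s.1, o)) <|
        .goto fun s => if s.2.isSome then Sum.inr 4 else Sum.inr 5
    | Sum.inr 4 => .goto fun _ => Sum.inr 4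
    | Sum.inr 5 => .goto fun _ => Sum.inr 5
  accept := Sum.inr 4

/-- `d` is the only successor of `c`. -/
def OnlyStep (M : NTM) (c d : M.toFinTM2.Cfg) : Prop := ∀ e, M.Step c e ↔ e = d

theorem reachesIn_iff_iter (M : NTM) (n : ℕ) (c d : M.toFinTM2.Cfg) :
    M.ReachesIn n c d ↔ Iter M.Step n c d := by
  induction n generalizing c with
  | zero => rfl
  | succ n ih => simp only [NTM.ReachesIn, Iter, ih]

theorem onlyStep_of_eq (M : NTM) {l : M.Λ} (h : M.m l = M.m' l) (v : M.σ)
    (T : ∀ k, List (M.Γ k)) : OnlyStep M ⟨some l, v, T⟩ (TM2.stepAux (M.m l) v T) := by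
  intro e
  constructor
  · rintro (he | he)
    · exact (Option.some.inj he).symm
    · rw [h]
      exact (Option.some.inj he).symm
  · rintro rfl
    exact Or.inl rfl

theorem absorbing {M : NTM} {l : M.Λ}
    (h : ∀ (v : M.σ) (T : ∀ k, List (M.Γ k)) (d : M.toFinTM2.Cfg),
      M.Step ⟨some l, v, T⟩ d → d.l = some l)
    {n : ℕ} {c d : M.toFinTM2.Cfg} (hr : Iter M.Step n c d) (hc : c.l = some l) :
    d.l = some l := by
  induction n generalizing c with
  | zero => cases hr; exact hc
  | succ n ih =>
    obtain ⟨b, hb, hr⟩ := hr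
    obtain ⟨l', v, T⟩ := c
    cases hc
    exact ih hr (h _ _ _ hb)

/-- Any run follows the deterministic one as long as both last. So one of them continues the other,
and the absorbing label at which the shorter one ends persists. Thus reaching the rejecting label
excludes acceptance by a run of any length. -/
theorem Iter.label_eq_of_onlyStep {M : NTM} {l l' : M.Λ}
    (h : ∀ (v : M.σ) (T : ∀ k, List (M.Γ k)) (d : M.toFinTM2.Cfg),
      M.Step ⟨some l, v, T⟩ d → d.l = some l)
    (h' : ∀ (v : M.σ) (T : ∀ k, List (M.Γ k)) (d : M.toFinTM2.Cfg),
      M.Step ⟨some l', v, T⟩ d → d.l = some l')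
    {n n' : ℕ} {c d d' : M.toFinTM2.Cfg} (hr : Iter (OnlyStep M) n c d) (hd : d.l = some l)
    (hr' : Iter M.Step n' c d') (hd' : d'.l = some l') : l = l' := by
  induction n generalizing c n' with
  | zero =>
    cases hr
    have := absorbing h hr' hd
    rw [this] at hd'
    exact Option.some.inj hd'
  | succ n ih =>
    obtain ⟨b, hb, hr⟩ := hr
    cases n' with
    | zero =>
      cases hr'
      have hs : Iter M.Step (n + 1) _ d :=
        ⟨b, (hb b).2 rfl, hr.mono fun c d h => (h d).2 rfl⟩
      have := absorbing h' hs hd'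
      rw [this] at hd
      exact (Option.some.inj hd).symm
    | succ n' =>
      obtain ⟨b', hb', hr'⟩ := hr'
      obtain rfl := (hb b').1 hb'
      exact ih hr hr'

variable {emb bit a₀ P}

theorem guessMachine_initList (x : List α) :
    initList (guessMachine emb bit a₀ P).toFinTM2 x = ⟨some (Sum.inr 0), (none, none),
      tapes x [] (st [[]])⟩ := by
  simp only [initList, guessMachine]
  congr 1
  funext k
  match k with
  | none => rfl
  | some none => rfl
  | some (some j) => simp [tapes, st, List.getD_eq_getElem?_getD]

/-- The configuration in which the machine is about to run its program. -/
def guessed (x : List α) (y : List Bool) (v : Option α × Option A) (l : P.Lab ⊕ Fin 6) :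
    (guessMachine emb bit a₀ P).toFinTM2.Cfg :=
  ⟨some l, v, tapes [] [] (st [(x.map emb).reverse, y.map bit])⟩

theorem guessMachine_read (x : List α) :
    Iter (OnlyStep (guessMachine emb bit a₀ P)) (x.length + 1)
      (initList (guessMachine emb bit a₀ P).toFinTM2 x) (guessed x [] (none, none) (Sum.inr 1)) := by
  rw [guessMachine_initList]
  have := iter_read (N := P.bound + 2) (β := Unit) (Λ := P.Lab ⊕ Fin 6) emb a₀
    (Sum.inr 0) (Sum.inr 1) (OnlyStep (guessMachine emb bit a₀ P))
    (fun v T => onlyStep_of_eq (guessMachine emb bit a₀ P) (l := Sum.inr 0) rfl v T) x [] [] (none, none)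
  have e : st [(x.map emb).reverse ++ []] = st [(x.map emb).reverse, ([] : List Bool).map bit] := by
    funext i
    rcases i with _ | _ | i <;> simp [st]
  rw [e] at this
  exact this

theorem guessMachine_main {x : List α} {y : List Bool} {b : Bool} {t : ℕ}
    (h : Run P (st [(x.map emb).reverse, y.map bit]) (st [if b then [a₀] else []]) t) :
    ∃ c, Iter (OnlyStep (guessMachine emb bit a₀ P)) (t + 1)
      (guessed x y (none, none) (Sum.inl P.entry)) c ∧
      c.l = some (if b then Sum.inr 4 else Sum.inr 5) := by
  obtain ⟨o, h⟩ := h.iter_code (N := P.bound + 2) (by omega) (Λ := P.Lab ⊕ Fin 6) Sum.inl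
    (Sum.inr 3) (OnlyStep (guessMachine emb bit a₀ P)) 
    (fun l v T => onlyStep_of_eq (guessMachine emb bit a₀ P) (l := Sum.inl l) rfl v T) [] [] (none, none)
  refine ⟨_, h.trans 
    (.single (onlyStep_of_eq (guessMachine emb bit a₀ P) (l := Sum.inr 3) rfl _ _)), ?_⟩
  simp only [guessMachine, TM2.stepAux]
  rw [tapes_work _ _ _ (by omega)]
  cases b <;> simp [st]

theorem step_guessed_iff (x : List α) (y : List Bool) (v : Option α × Option A)
    (c : (guessMachine emb bit a₀ P).toFinTM2.Cfg) :
    (guessMachine emb bit a₀ P).Step (guessed x y v (Sum.inr 2)) c ↔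
      ∃ b, c = guessed x (b :: y) v (Sum.inr 1) := by
  have e (b : Bool) : update (tapes (α := α) (β := Unit) [] []
      (st [(x.map emb).reverse, y.map bit])) (work (P.bound + 2) 1) (bit b :: y.map bit) =
      tapes [] [] (st [(x.map emb).reverse, (b :: y).map bit]) := by
    rw [update_tapes_work _ _ _ (by omega)]
    congr 1
    funext i
    rcases i with _ | _ | i <;> simp [st]
  have e' : tapes (α := α) (β := Unit) [] [] (st [(x.map emb).reverse, y.map bit])
      (work (P.bound + 2) 1) = y.map bit := by
    rw [tapes_work _ _ _ (by omega)]; simp [st]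
  have h : TM2.step (guessMachine emb bit a₀ P).m (guessed x y v (Sum.inr 2)) =
      some (guessed x (false :: y) v (Sum.inr 1)) := by
    simp only [guessMachine, guessed, TM2.step, TM2.stepAux]
    rw [e']
    erw [e]
    rfl
  have h' : TM2.step (guessMachine emb bit a₀ P).m' (guessed x y v (Sum.inr 2)) =
      some (guessed x (true :: y) v (Sum.inr 1)) := by
    simp only [guessMachine, guessed, TM2.step, TM2.stepAux]
    rw [e']
    erw [e]
    rfl
  constructor
  · rintro (hc | hc)
    · exact ⟨false, (Option.some.inj (h.symm.trans hc)).symm⟩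
    · exact ⟨true, (Option.some.inj (h'.symm.trans hc)).symm⟩
  · rintro ⟨_ | _, rfl⟩
    · exact Or.inl h
    · exact Or.inr h'

theorem step_guess_iff (x : List α) (y : List Bool) (v : Option α × Option A)
    (c : (guessMachine emb bit a₀ P).toFinTM2.Cfg) :
    (guessMachine emb bit a₀ P).Step (guessed x y v (Sum.inr 1)) c ↔
      c = guessed x y v (Sum.inl P.entry) ∨ c = guessed x y v (Sum.inr 2) := by
  constructor
  · rintro (hc | hc)
    · exact Or.inl (Option.some.inj hc).symm
    · exact Or.inr (Option.some.inj hc).symm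
  · rintro (rfl | rfl)
    · exact Or.inl rfl
    · exact Or.inr rfl

/-- Each bit costs two steps, from label `1` to `2` and back. Bits are pushed, so `y` is built from
its last bit on. -/
theorem guessMachine_guess (x : List α) (y : List Bool) :
    Iter (guessMachine emb bit a₀ P).Step (2 * y.length)
      (guessed x [] (none, none) (Sum.inr 1)) (guessed x y (none, none) (Sum.inr 1)) := by
  induction y with
  | nil => rfl
  | cons b y ih =>
    exact ih.trans ⟨_, (step_guess_iff _ _ _ _).2 (Or.inr rfl), .single
      ((step_guessed_iff _ _ _ _).2 ⟨b, rfl⟩)⟩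

/-- An accepting run must pass from label `1` to the program with some guessed `y`. From there the
machine is deterministic, and it would end in label `5` if `f x y` were false. No bound on the
length of the run is needed. -/
theorem guessMachine_sound {f : List α → List Bool → Bool}
    (hf : ∀ x y, ∃ t, Run P (st [(x.map emb).reverse, y.map bit])
      (st [if f x y then [a₀] else []]) t)
    {x : List α} {n : ℕ} {c : (guessMachine emb bit a₀ P).toFinTM2.Cfg}
    (h : Iter (guessMachine emb bit a₀ P).Step n
      (initList (guessMachine emb bit a₀ P).toFinTM2 x) c) (hc : c.l = some (Sum.inr 4)) :
    ∃ y, f x y = true := by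
  have habs (i : Fin 6) (hi : i = 4 ∨ i = 5) (v : (guessMachine emb bit a₀ P).σ)
      (T : ∀ k, List ((guessMachine emb bit a₀ P).Γ k))
      (d : (guessMachine emb bit a₀ P).toFinTM2.Cfg)
      (h : (guessMachine emb bit a₀ P).Step ⟨some (Sum.inr i), v, T⟩ d) :
      d.l = some (Sum.inr i) := by
    rcases hi with rfl | rfl <;> rcases h with h | h <;> rw [← Option.some.inj h] <;> rfl
  have hne (i : Fin 6) (hi : i ≠ 4)
      (hc : (some (Sum.inr i) : Option (P.Lab ⊕ Fin 6)) = some (Sum.inr 4)) : False :=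
    hi (Sum.inr.inj (Option.some.inj hc))
  have hguess (n : ℕ) (y : List Bool) (c : (guessMachine emb bit a₀ P).toFinTM2.Cfg)
      (hc : c.l = some (Sum.inr 4)) (h : Iter (guessMachine emb bit a₀ P).Step n
      (guessed x y (none, none) (Sum.inr 1)) c) : ∃ y, f x y = true := by
    -- Strong induction, because one more guessed bit consumes two steps.
    induction n using Nat.strong_induction_on generalizing y with
    | _ n ih =>
      rcases n with _ | n
      · cases h
        exact (hne 1 (by decide) hc).elim
      · obtain ⟨d, hd, h⟩ := h
        rcases (step_guess_iff _ _ _ _).1 hd with rfl | rfl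
        · obtain ⟨t, ht⟩ := hf x y
          obtain ⟨e, he, hl⟩ := guessMachine_main ht
          refine ⟨y, ?_⟩
          by_contra hf
          rw [if_neg hf] at hl
          have := he.label_eq_of_onlyStep (habs 5 (.inr rfl)) (habs 4 (.inl rfl)) hl h hc
          exact hne 5 (by decide) (congrArg some this)
        · rcases n with _ | n
          · cases h
            exact (hne 2 (by decide) hc).elim
          · obtain ⟨d, hd, h⟩ := h
            obtain ⟨b, rfl⟩ := (step_guessed_iff _ _ _ _).1 hd
            exact ih n (by omega) _ h
  -- Strips a deterministic prefix from an accepting run. Should the run end inside the prefix, then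
  -- label `4`, being absorbing, is also the label at the end of the prefix.
  have hread : ∀ (m n : ℕ) (d e : (guessMachine emb bit a₀ P).toFinTM2.Cfg),
      Iter (OnlyStep (guessMachine emb bit a₀ P)) m d e →
      Iter (guessMachine emb bit a₀ P).Step n d c →
      ∃ n' c', Iter (guessMachine emb bit a₀ P).Step n' e c' ∧ c'.l = some (Sum.inr 4) := by
    intro m
    induction m with
    | zero => rintro n d _ rfl h; exact ⟨n, c, h, hc⟩
    | succ m ih =>
      rintro n d e ⟨d', hd', h⟩ h'
      rcases n with _ | n
      · cases h'
        have hs : Iter (guessMachine emb bit a₀ P).Step (m + 1) _ e :=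
          ⟨d', (hd' d').2 rfl, h.mono fun c d h => (h d).2 rfl⟩
        exact ⟨0, e, rfl, absorbing (habs 4 (.inl rfl)) hs hc⟩
      · obtain ⟨d'', hd'', h'⟩ := h'
        obtain rfl := (hd' d'').1 hd''
        exact ih n _ _ h h'
  obtain ⟨n', c', h, hc'⟩ := hread _ _ _ _ (guessMachine_read x) h
  exact hguess n' [] c' hc' h

/-- A language with certificates of exponential length that are checked by a program in polynomial
time belongs to `NEXPTIME`. -/
theorem nexptime_of_run {L : Set (List α)} {f : List α → List Bool → Bool} {e : ℕ → ℕ}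
    (he : ExpBounded e) (p : Polynomial ℕ) (hp : Monotone fun n => p.eval n)
    (hf : ∀ x y, ∃ t ≤ p.eval (x.length + y.length),
      Run P (st [(x.map emb).reverse, y.map bit]) (st [if f x y then [a₀] else []]) t)
    (sound : ∀ x y, f x y = true → x ∈ L)
    (complete : ∀ x ∈ L, ∃ y, y.length ≤ e x.length ∧ f x y = true) : NEXPTIME L := by
  -- Total time for input length `n`: `n + 1` steps to read, `2 * e n` to guess, one to start the
  -- program, at most `p (n + e n)` for its run, and one for the final test.
  obtain ⟨r, hr⟩ := (((ExpBounded.id.add he).polynomial p).add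
    ((ExpBounded.id.add (((ExpBounded.const 2).mul he))).add (.const 3)))
  refine ⟨guessMachine emb bit a₀ P, Equiv.refl _, r, fun x => ?_⟩
  have e1 : List.map (Equiv.refl α).symm x = x := List.map_id _
  erw [e1]
  constructor
  · intro hx
    obtain ⟨y, hy, hxy⟩ := complete x hx
    obtain ⟨t, ht, hrun⟩ := hf x y
    obtain ⟨c, hc, hl⟩ := guessMachine_main hrun
    rw [hxy] at hl
    refine ⟨_, ?_, c, (reachesIn_iff_iter _ _ _ _).2
      ((((guessMachine_read x).mono fun c d h => (h d).2 rfl).trans (guessMachine_guess x y)).trans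
        ((Iter.single ((step_guess_iff _ _ _ _).2 (Or.inl rfl))).trans
          (hc.mono fun c d h => (h d).2 rfl))), hl⟩
    refine le_trans ?_ (hr x.length)
    have := ht.trans (hp (show x.length + y.length ≤ x.length + e x.length by omega))
    dsimp only at this ⊢
    omega
  · rintro ⟨n, -, c, hc, hl⟩
    obtain ⟨y, hy⟩ := guessMachine_sound (fun x y => (hf x y).imp fun t h => h.2)
      ((reachesIn_iff_iter _ _ _ _).1 hc) hl
    exact sound x y hy

end

end StackProg

/-! ### Basic stack manipulations with step bounds -/

namespace StackProg

open Function

variable {A : Type}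

/-! ### Runs on lists of stacks -/

@[simp] theorem st_apply (l : List (List A)) (i : ℕ) : st l i = l.getD i [] := rfl

/-- Replace the `k`-th stack of a list of stacks. -/
def setAt : List (List A) → ℕ → List A → List (List A)
  | [], 0, x => [x]
  | [], k + 1, x => [] :: setAt [] k x
  | _ :: l, 0, x => x :: l
  | y :: l, k + 1, x => y :: setAt l k x

theorem update_st (l : List (List A)) (k : ℕ) (x : List A) :
    update (st l) k x = st (setAt l k x) := by
  funext i
  induction k generalizing l i with
  | zero => cases l <;> cases i <;> simp [setAt]
  | succ k ih =>
    cases l with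
    | nil =>
      cases i with
      | zero => simp [setAt]
      | succ i => simpa [setAt, update_apply] using ih [] i
    | cons y l =>
      cases i with
      | zero => simp [setAt]
      | succ i => simpa [setAt, update_apply] using ih l i

theorem frame_st (e l : List (List A)) : frame e.length (st e) (st l) = st (e ++ l) := by
  funext i
  simp only [frame, st_apply]
  split_ifs with h
  · rw [List.getD_append _ _ _ _ h]
  · rw [List.getD_append_right _ _ _ _ (by omega)]

/-- A store determines its list of stacks only up to trailing empty ones; this identity introduces
and forgets scratch stacks. -/
theorem st_append_nil (l : List (List A)) (n : ℕ) : st (l ++ List.replicate n []) = st l := by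
  funext i
  simp only [st_apply]
  by_cases h : i < l.length
  · rw [List.getD_append _ _ _ _ h]
  · rw [List.getD_append_right _ _ _ _ (by omega), List.getD_eq_default l _ (by omega)]
    grind

/-- `P` turns `S` into `S'` in at most `b` steps. -/
def RunLe (P : Prog A) (S S' : Store A) (b : ℕ) : Prop := ∃ t ≤ b, Run P S S' t

namespace RunLe

variable {P Q : Prog A} {S S' S'' : Store A} {b b' k : ℕ}

theorem mono (h : RunLe P S S' b) (hb : b ≤ b') : RunLe P S S' b' :=
  let ⟨t, ht, hr⟩ := h
  ⟨t, ht.trans hb, hr⟩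

theorem congr (h : RunLe P S S' b) (hS : S' = S'') (hb : b ≤ b') : RunLe P S S'' b' :=
  hS ▸ h.mono hb

theorem skip : RunLe .skip S S 1 := ⟨1, le_rfl, .skip S⟩

theorem push {a : A} (h : update S k (a :: S k) = S') : RunLe (.push k a) S S' 1 :=
  ⟨1, le_rfl, h ▸ .push k a S⟩

theorem seq (h : RunLe P S S' b) (h' : RunLe Q S' S'' b') : RunLe (.seq P Q) S S'' (b + b') :=
  let ⟨t, ht, hr⟩ := h
  let ⟨t', ht', hr'⟩ := h'
  ⟨t + t', by omega, .seq hr hr'⟩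

theorem case {P : Option A → Prog A}
    (h : RunLe (P (S k).head?) (update S k (S k).tail) S' b) : RunLe (.case k P) S S' (b + 1) :=
  let ⟨t, ht, hr⟩ := h
  ⟨t + 1, by omega, .case hr⟩

theorem loop_nil {P : A → Prog A} (h : S k = []) : RunLe (.loop k P) S S 1 :=
  ⟨1, le_rfl, .loop_nil h⟩

theorem loop_cons {P : A → Prog A} {a : A} {l : List A} (hS : S k = a :: l)
    (h : RunLe (P a) (update S k l) S' b) (h' : RunLe (.loop k P) S' S'' b') :
    RunLe (.loop k P) S S'' (b + b' + 1) :=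
  let ⟨t, ht, hr⟩ := h
  let ⟨t', ht', hr'⟩ := h'
  ⟨t + t' + 1, by omega, .loop_cons hS hr hr'⟩

theorem shift {l l' : List (List A)} (e : List (List A)) (h : RunLe P (st l) (st l') b) {n : ℕ}
    (hn : e.length = n) : RunLe (P.shift n) (st (e ++ l)) (st (e ++ l')) b := by
  obtain ⟨t, ht, hr⟩ := h
  subst hn
  refine ⟨t, ht, ?_⟩
  rw [← frame_st, ← frame_st]
  exact hr.shift _ _

end RunLe

/-- Empty stack `k`. -/
def clear (k : ℕ) : Prog A := .loop k fun _ => .skip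

theorem runLe_clear (k : ℕ) (S : Store A) :
    RunLe (clear k) S (update S k []) (2 * (S k).length + 1) := by
  generalize hl : S k = l
  induction l generalizing S with
  | nil =>
    rw [show update S k [] = S by rw [← hl, update_eq_self]]
    exact .loop_nil hl
  | cons a l ih =>
    have := ih (update S k l) (by simp)
    rw [update_idem] at this
    exact (RunLe.loop_cons hl .skip this).mono (by simp; omega)

/-- Move the contents of stack `j` to stack `k`, in reverse order. -/
def move (j k : ℕ) : Prog A := .loop j fun a => .push k a

theorem runLe_move {j k : ℕ} (hjk : j ≠ k) (S : Store A) :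
    RunLe (move j k) S (update (update S j []) k ((S j).reverse ++ S k))
      (2 * (S j).length + 1) := by
  generalize hl : S j = l
  induction l generalizing S with
  | nil =>
    rw [show update S j [] = S by rw [← hl, update_eq_self]]
    simp only [List.reverse_nil, List.nil_append, update_eq_self]
    exact .loop_nil hl
  | cons a l ih =>
    have h1 : RunLe (.push k a) (update S j l) (update (update S j l) k (a :: S k)) 1 :=
      .push (by rw [update_of_ne hjk.symm])
    refine (RunLe.loop_cons hl h1 (ih _ (by simp [hjk]))).congr ?_ (by simp; omega)
    funext i
    by_cases hi : i = k
    · subst hi; simp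
    · by_cases hi' : i = j
      · subst hi'; simp [hi]
      · simp [hi, hi']

/-- Move the contents of stack `k` to stacks `i` and `j`, in reverse order. -/
def fork (k i j : ℕ) : Prog A := .loop k fun a => .seq (.push i a) (.push j a)

theorem runLe_fork {i j k : ℕ} (hik : i ≠ k) (hjk : j ≠ k) (hij : i ≠ j) (S : Store A) :
    RunLe (fork k i j) S (update (update (update S k []) i ((S k).reverse ++ S i)) j
      ((S k).reverse ++ S j)) (3 * (S k).length + 1) := by
  generalize hl : S k = l
  induction l generalizing S with
  | nil =>
    rw [show update S k [] = S by rw [← hl, update_eq_self]]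
    simp only [List.reverse_nil, List.nil_append, update_eq_self]
    exact .loop_nil hl
  | cons a l ih =>
    have h1 : RunLe (.seq (.push i a) (.push j a)) (update S k l)
        (update (update (update S k l) i (a :: S i)) j (a :: S j)) (1 + 1) :=
      .seq (.push rfl) (.push (by simp [hij.symm, hjk, hik]))
    refine (RunLe.loop_cons hl h1 (ih _ (by simp [hik.symm, hjk.symm]))).congr ?_ (by simp; omega)
    funext n
    by_cases hi : n = k
    · subst hi; simp [hik.symm, hjk.symm]
    · by_cases hi' : n = i
      · subst hi'; simp [hij]
      · by_cases hj : n = j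
        · subst hj; simp
        · simp [hi, hi', hj]

/-- Copy stack `j` to the empty stack `n`, using the empty stack `n + 1`. -/
def copy (j n : ℕ) : Prog A := .seq (move j (n + 1)) (fork (n + 1) j n)

/-- The move reverses the string and the fork reverses it back, so both copies have the original
order. The costs are `2 * x.length + 1` and `3 * x.length + 1`. -/
theorem runLe_copy {l : List (List A)} {j n : ℕ} {x : List A} (h : j < l.length)
    (hx : l.getD j [] = x) (hn : l.length = n) :
    RunLe (copy j n) (st l) (st (l ++ [x])) (5 * x.length + 2) := by
  subst hn
  have hxj : st l j = x := hx
  have h0 : ∀ i, l.length ≤ i → st l i = [] := fun i hi => List.getD_eq_default _ _ hi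
  refine ((runLe_move (by omega) _).seq (runLe_fork (by omega) (by omega) (by omega) _)).congr ?_
    (b' := 5 * x.length + 2) ?_
  · funext i
    by_cases hi : i = l.length
    · subst hi
      simp only [update_self, hxj, h0 _ (Nat.le_succ _), List.append_nil, List.reverse_reverse]
      rw [update_of_ne (by omega), update_of_ne (by omega), h0 _ le_rfl]
      simp
    · by_cases hi' : i = l.length + 1
      · subst hi'
        rw [update_of_ne (by omega), update_of_ne (by omega), update_self]
        simp
      · by_cases hj : i = j
        · subst hj
          rw [update_of_ne (by omega), update_self, update_self, update_of_ne (by omega),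
            update_self, hxj, h0 _ (Nat.le_succ _), st_apply, List.getD_append _ _ _ _ h, hx]
          simp
        · rw [update_of_ne hi, update_of_ne hj, update_of_ne hi', update_of_ne hi',
            update_of_ne hj, st_apply, st_apply]
          by_cases hl : i < l.length
          · rw [List.getD_append _ _ _ _ hl]
          · rw [List.getD_eq_default _ _ (by omega), List.getD_eq_default _ _ (by simp; omega)]
  · rw [update_self, hxj, h0 _ (Nat.le_succ _)]
    simp
    omega

/-- The total length of the stacks. -/
def total (l : List (List A)) : ℕ := (l.map List.length).sum

@[simp] theorem total_nil : total ([] : List (List A)) = 0 := rfl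

@[simp] theorem total_cons (x : List A) (l : List (List A)) :
    total (x :: l) = x.length + total l := by simp [total]

@[simp] theorem total_append (l l' : List (List A)) : total (l ++ l') = total l + total l' := by
  simp [total]

/-- Copy the first `m` of `n` stacks to the stacks from `n` on. -/
def copyAll (n : ℕ) : ℕ → Prog A
  | 0 => .skip
  | m + 1 => .seq (copyAll n m) (copy m (n + m))

theorem runLe_copyAll (g r : List (List A)) {m n : ℕ} (hm : g.length = m)
    (hn : (g ++ r).length = n) :
    RunLe (copyAll n m) (st (g ++ r)) (st (g ++ r ++ g)) (5 * total g + 2 * m + 1) := by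
  suffices h : ∀ k ≤ m, RunLe (copyAll n k) (st (g ++ r)) (st (g ++ r ++ g.take k))
      (5 * total (g.take k) + 2 * k + 1) by
    simpa [← hm] using h m le_rfl
  intro k hk
  induction k with
  | zero => simpa [copyAll] using RunLe.skip.mono (by omega)
  | succ k ih =>
    have hkg : k < g.length := by omega
    have hlen : (g ++ r ++ g.take k).length = n + k := by
      rw [List.length_append, hn, List.length_take_of_le hkg.le]
    have hget : (g ++ r ++ g.take k).getD k [] = g[k] := by
      rw [List.append_assoc, List.getD_append _ _ _ _ hkg, List.getD_eq_getElem _ _ hkg]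
    have h := runLe_copy (by rw [List.length_append, List.length_append]; omega) hget hlen
    rw [List.append_assoc _ _ [g[k]], List.take_concat_get' g k hkg] at h
    refine ((ih (by omega)).seq h).mono ?_
    have htot : total (g.take (k + 1)) = total (g.take k) + g[k].length := by
      rw [← List.take_concat_get' g k hkg, total_append]
      simp
    omega

/-- Empty the first `n` stacks. -/
def clearAll : ℕ → Prog A
  | 0 => .skip
  | n + 1 => .seq (clear 0) ((clearAll n).shift 1)

theorem runLe_clearAll (l : List (List A)) :
    RunLe (clearAll l.length) (st l) (st []) (2 * total l + l.length + 1) := by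
  induction l with
  | nil => exact RunLe.skip
  | cons x l ih =>
    have h := runLe_clear 0 (st (x :: l))
    rw [update_st] at h
    refine (h.seq (ih.shift [[]] rfl)).congr ?_ (by simp; omega)
    exact st_append_nil [] 1

/-- Remove the first of `n + 1` stacks. -/
def dropOne : ℕ → Prog A
  | 0 => clear 0
  | n + 1 => .seq (clear 0) (.seq (move 1 (n + 2)) (.seq (move (n + 2) 0) ((dropOne n).shift 1)))

/-- Once stack `0` is empty, stack `1` is brought down to it via a scratch stack above all others,
two moves preserving its order. This leaves an empty stack `1`, which is removed recursively. -/
theorem runLe_dropOne (x : List A) (l : List (List A)) :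
    RunLe (dropOne l.length) (st (x :: l)) (st l)
      (2 * x.length + 4 * total l + 3 * l.length + 1) := by
  induction l generalizing x with
  | nil =>
    refine (runLe_clear 0 _).congr ?_ (by simp)
    rw [update_st]
    exact st_append_nil [] 1
  | cons y l ih =>
    have h1 : RunLe (clear 0) (st (x :: y :: l)) (st ([] :: y :: l)) (2 * x.length + 1) := by
      refine (runLe_clear 0 _).congr ?_ (by simp)
      rw [update_st]
      rfl
    have h2 : RunLe (.seq (move 1 (l.length + 2)) (move (l.length + 2) 0)) (st ([] :: y :: l))
        (st (y :: [] :: l)) (4 * y.length + 2) := by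
      refine ((runLe_move (by omega) _).seq (runLe_move (by omega) _)).congr ?_ (by simp; omega)
      funext i
      rcases i with _ | _ | i
      · simp
      · simp
      · by_cases hi : i = l.length
        · subst hi; simp
        · simp [hi]
    have h3 : RunLe ((dropOne l.length).shift 1) (st (y :: [] :: l)) (st (y :: l)) _ :=
      (ih []).shift [y] rfl
    obtain ⟨t1, ht1, r1⟩ := h1
    obtain ⟨t2, ht2, r2⟩ := h2
    obtain ⟨t3, ht3, r3⟩ := h3
    -- The two moves were treated as one block, but in the program they are separate links of a
    -- right-nested sequence.
    cases r2 with
    | seq r2 r2' =>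
      refine ⟨_, ?_, .seq r1 (.seq r2 (.seq r2' r3))⟩
      simp at *
      omega

/-- Remove the first `m` of `m + n` stacks. -/
def dropAll (n : ℕ) : ℕ → Prog A
  | 0 => .skip
  | m + 1 => .seq (dropOne (m + n)) (dropAll n m)

theorem runLe_dropAll (g l : List (List A)) {m n : ℕ} (hm : g.length = m) (hn : l.length = n) :
    RunLe (dropAll n m) (st (g ++ l)) (st l)
      (m * (4 * (total g + total l) + 3 * (m + n) + 1) + 1) := by
  subst hm hn
  induction g with
  | nil => exact RunLe.skip.mono (by simp)
  | cons x g ih =>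
    have h := runLe_dropOne x (g ++ l)
    rw [List.length_append] at h
    refine (h.seq ih).mono ?_
    simp only [total_append, total_cons, List.length_cons]
    nlinarith [Nat.zero_le (g.length * x.length)]

end StackProg

/-! ### The class `PT` and its closure under composition, pairing and branching -/

namespace UCQNeg

open StackProg Function

/-! ## Polynomial-time functions -/

/-- The alphabet has two bits and five punctuation letters. -/
def Letter.equiv : Letter ≃ Bool ⊕ Fin 5 where
  toFun
    | .bit b => .inl b
    | .endName => .inr 0
    | .endAtom => .inr 1
    | .endAtoms => .inr 2
    | .endCQ => .inr 3
    | .endUCQ => .inr 4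
  invFun
    | .inl b => .bit b
    | .inr 0 => .endName
    | .inr 1 => .endAtom
    | .inr 2 => .endAtoms
    | .inr 3 => .endCQ
    | .inr 4 => .endUCQ
  left_inv x := by cases x <;> rfl
  right_inv x := by
    rcases x with b | i
    · rfl
    · fin_cases i <;> rfl

instance : DecidableEq Letter := Letter.equiv.injective.decidableEq

instance : Fintype Letter := Fintype.ofEquiv _ Letter.equiv.symm

/-- The symbols on the stacks. -/
abbrev Sym := Option (Letter ⊕ Bool)

abbrev Str := List Sym

/-- Types whose elements are represented by a fixed number of strings. -/
class Ctx (Γ : Type) where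
  arity : ℕ
  rep : Γ → List Str
  length_rep : ∀ g, (rep g).length = arity

open Ctx (rep)

instance : Ctx Str := ⟨1, fun s => [s], fun _ => rfl⟩

/-- This agrees with the convention of the machines, which test whether stack `0` is nonempty, for
`a₀ = none`. -/
instance : Ctx Bool := ⟨1, fun b => [if b then [none] else []], fun _ => rfl⟩

instance {Γ Γ' : Type} [Ctx Γ] [Ctx Γ'] : Ctx (Γ × Γ') :=
  ⟨Ctx.arity Γ + Ctx.arity Γ', fun p => rep p.1 ++ rep p.2, fun p => by
    simp [Ctx.length_rep]⟩

variable {Γ Γ' Γ'' : Type} [Ctx Γ] [Ctx Γ'] [Ctx Γ'']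

/-- The length of the representation. -/
def size (g : Γ) : ℕ := total (rep g)

@[simp] theorem size_str (s : Str) : size s = s.length := by simp [size, rep]

@[simp] theorem size_prod (p : Γ × Γ') : size p = size p.1 + size p.2 := by
  simp [size, rep]

theorem size_bool_le (b : Bool) : size b ≤ 1 := by cases b <;> simp [size, rep]

theorem eval_mono (p : Polynomial ℕ) : Monotone fun n => p.eval n := by
  intro m n h
  dsimp only
  induction p using Polynomial.induction_on' with
  | add p q hp hq => simpa using Nat.add_le_add hp hq
  | monomial k c =>
    simpa [Polynomial.eval_monomial] using Nat.mul_le_mul_left c (Nat.pow_le_pow_left h k)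

/-- Functions computed by stack programs in polynomial time. -/
def PT (f : Γ → Γ') : Prop :=
  ∃ (P : Prog Sym) (p : Polynomial ℕ), ∀ g, ∃ b,
    RunLe P (st (rep g)) (st (rep (f g))) b ∧ b + size (f g) ≤ p.eval (size g)

namespace PT

theorem id : PT (fun g : Γ => g) :=
  ⟨.skip, 1 + Polynomial.X, fun g => ⟨1, RunLe.skip, by simp⟩⟩

/-- The polynomial in `PT` bounds the size of the result along with the time. Hence the second
program runs in time `q.comp p`. -/
theorem comp {h : Γ' → Γ''} {f : Γ → Γ'} (hh : PT h) (hf : PT f) : PT fun g => h (f g) := by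
  obtain ⟨P, p, hP⟩ := hf
  obtain ⟨Q, q, hQ⟩ := hh
  refine ⟨.seq P Q, p + q.comp p, fun g => ?_⟩
  obtain ⟨b, hb, hle⟩ := hP g
  obtain ⟨b', hb', hle'⟩ := hQ (f g)
  refine ⟨_, hb.seq hb', ?_⟩
  have := eval_mono q (show size (f g) ≤ p.eval (size g) by omega)
  dsimp only at this
  simp only [Polynomial.eval_add, Polynomial.eval_comp]
  omega

/-- The stacks develop as `g`, then `g, g`, then `g, f g`, then `g, f g, g`, then `g, f g, h g`;
finally the original `g` is dropped. -/
theorem pair {f : Γ → Γ'} {h : Γ → Γ''} (hf : PT f) (hh : PT h) : PT fun g => (f g, h g) := by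
  obtain ⟨P, p, hP⟩ := hf
  obtain ⟨Q, q, hQ⟩ := hh
  let m := Ctx.arity Γ
  let m' := Ctx.arity Γ'
  let m'' := Ctx.arity Γ''
  refine ⟨.seq (copyAll m m) (.seq (P.shift m) (.seq (copyAll (m + m') m)
    (.seq (Q.shift (m + m')) (dropAll (m' + m'') m)))),
    Polynomial.C (5 * m + 12) * (Polynomial.X + p + q) +
      Polynomial.C (m * (3 * (m + m' + m'') + 1) + 4 * m + 10), fun g => ?_⟩
  obtain ⟨b, hb, hle⟩ := hP g
  obtain ⟨b', hb', hle'⟩ := hQ g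
  have hm : (rep g).length = m := Ctx.length_rep g
  have hm' : (rep (f g)).length = m' := Ctx.length_rep _
  have hm'' : (rep (h g)).length = m'' := Ctx.length_rep _
  have h1 := runLe_copyAll (rep g) [] hm (by simpa using hm)
  rw [List.append_nil] at h1
  have h2 := hb.shift (rep g) hm
  have h3 := runLe_copyAll (rep g) (rep (f g)) (n := m + m') hm (by simp [hm, hm'])
  have h4 := hb'.shift (rep g ++ rep (f g)) (n := m + m') (by simp [hm, hm'])
  have h5 := runLe_dropAll (rep g) (rep (f g) ++ rep (h g)) (n := m' + m'') hm
    (by simp [hm', hm''])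
  rw [← List.append_assoc] at h5
  refine ⟨_, h1.seq (h2.seq (h3.seq (h4.seq h5))), ?_⟩
  simp only [size_prod, Polynomial.eval_add, Polynomial.eval_mul, Polynomial.eval_C,
    Polynomial.eval_X, total_append]
  change _ ≤ (5 * m + 12) * (total (rep g) + _ + _) + _
  simp only [size] at *
  have e1 : total (rep (f g)) ≤ p.eval (total (rep g)) := by omega
  have e2 : total (rep (h g)) ≤ q.eval (total (rep g)) := by omega
  generalize p.eval (total (rep g)) = x at *
  generalize q.eval (total (rep g)) = y at *
  generalize total (rep g) = z at *
  have e3 : m * (4 * (z + (total (rep (f g)) + total (rep (h g)))) + 3 * (m + (m' + m'')) + 1) ≤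
      m * (4 * (z + (x + y)) + 3 * (m + (m' + m'')) + 1) :=
    Nat.mul_le_mul_left _ (by omega)
  nlinarith [Nat.zero_le (m * (x + y + z))]

theorem fst : PT (fun p : Γ × Γ' => p.1) := by
  refine ⟨(clearAll (Ctx.arity Γ')).shift (Ctx.arity Γ),
    Polynomial.C 3 * Polynomial.X + Polynomial.C (Ctx.arity Γ' + 1), fun p => ?_⟩
  have h := (runLe_clearAll (rep p.2)).shift (rep p.1) (Ctx.length_rep p.1)
  rw [Ctx.length_rep, List.append_nil] at h
  refine ⟨_, h, ?_⟩
  have hs := size_prod p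
  simp only [Polynomial.eval_add, Polynomial.eval_mul, Polynomial.eval_C,
    Polynomial.eval_X, size] at *
  omega

theorem snd : PT (fun p : Γ × Γ' => p.2) := by
  let m := Ctx.arity Γ
  let m' := Ctx.arity Γ'
  refine ⟨dropAll m' m, Polynomial.C (4 * m + 1) * Polynomial.X +
    Polynomial.C (m * (3 * (m + m') + 1) + 1), fun p => ?_⟩
  refine ⟨_, runLe_dropAll (rep p.1) (rep p.2) (Ctx.length_rep _) (Ctx.length_rep _), ?_⟩
  have hs := size_prod p
  simp only [Polynomial.eval_add, Polynomial.eval_mul, Polynomial.eval_C,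
    Polynomial.eval_X, size] at *
  rw [hs]
  generalize total (rep p.1) = x
  generalize total (rep p.2) = y
  change m * (4 * (x + y) + 3 * (m + m') + 1) + 1 + y ≤ _
  nlinarith

/-- Write a string onto the empty stack `0`. -/
def writeStr : Str → Prog Sym
  | [] => .skip
  | a :: s => .seq (writeStr s) (.push 0 a)

theorem runLe_writeStr (s : Str) : RunLe (writeStr s) (st []) (st [s]) (s.length + 1) := by
  induction s with
  | nil => exact RunLe.skip.congr (st_append_nil [] 1).symm (by simp)
  | cons a s ih =>
    refine (ih.seq (.push ?_)).mono (by simp)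
    rw [update_st]
    simp [setAt]

/-- Write strings onto empty stacks. -/
def writeAll : List Str → Prog Sym
  | [] => .skip
  | s :: l => .seq (writeStr s) ((writeAll l).shift 1)

theorem runLe_writeAll (l : List Str) :
    RunLe (writeAll l) (st []) (st l) (total l + l.length + 1) := by
  induction l with
  | nil => exact RunLe.skip
  | cons s l ih => exact ((runLe_writeStr s).seq (ih.shift [s] rfl)).mono (by simp; omega)

theorem const (c : Γ') : PT (fun _ : Γ => c) := by
  refine ⟨.seq (clearAll (Ctx.arity Γ)) (writeAll (rep c)), Polynomial.C 2 * Polynomial.X +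
    Polynomial.C (Ctx.arity Γ + 1 + (total (rep c) + Ctx.arity Γ' + 1 + size c)), fun g => ?_⟩
  have h := runLe_clearAll (rep g)
  rw [Ctx.length_rep] at h
  refine ⟨_, h.seq (runLe_writeAll (rep c)), ?_⟩
  simp only [Polynomial.eval_add, Polynomial.eval_mul, Polynomial.eval_C,
    Polynomial.eval_X, size, Ctx.length_rep]
  omega

theorem ite {b : Γ → Bool} {f h : Γ → Γ'} (hb : PT b) (hf : PT f) (hh : PT h) :
    PT fun g => if b g then f g else h g := by
  -- With the Boolean stored in stack `0` in front of the argument, a pop selects the branch and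
  -- leaves an empty stack to be dropped.
  suffices H : PT fun p : Bool × Γ => if p.1 then f p.2 else h p.2 from H.comp (hb.pair id)
  obtain ⟨P, p, hP⟩ := hf
  obtain ⟨Q, q, hQ⟩ := hh
  let m := Ctx.arity Γ'
  refine ⟨.seq (.case 0 fun o => if o.isSome then P.shift 1 else Q.shift 1) (dropAll m 1),
    Polynomial.C 5 * (p + q) + Polynomial.C (3 * m + 12), fun x => ?_⟩
  obtain ⟨b, g⟩ := x
  have key : ∃ b', RunLe (.case 0 fun o => if o.isSome then P.shift 1 else Q.shift 1)
      (st (rep (b, g))) (st ([[]] ++ rep (if b then f g else h g))) b' ∧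
      b' + size (if b then f g else h g) ≤ p.eval (size g) + q.eval (size g) + 1 := by
    have e : update (st (rep (b, g))) 0 (st (rep (b, g)) 0).tail = st ([[]] ++ rep g) := by
      rw [update_st]
      cases b <;> simp [rep, setAt]
    cases b
    · obtain ⟨b', hb', hle⟩ := hQ g
      refine ⟨b' + 1, RunLe.case ?_, by simp; omega⟩
      rw [e]
      exact hb'.shift [[]] rfl
    · obtain ⟨b', hb', hle⟩ := hP g
      refine ⟨b' + 1, RunLe.case ?_, by simp; omega⟩
      rw [e]
      exact hb'.shift [[]] rfl
  obtain ⟨b', hb', hle⟩ := key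
  have h2 := runLe_dropAll [[]] (rep (if b then f g else h g)) (m := 1) rfl (Ctx.length_rep _)
  refine ⟨_, hb'.seq h2, ?_⟩
  have h3 := eval_mono p (show size g ≤ size (b, g) by simp)
  have h4 := eval_mono q (show size g ≤ size (b, g) by simp)
  simp only [Polynomial.eval_add, Polynomial.eval_mul, Polynomial.eval_C, total_cons,
    total_nil, List.length_nil] at *
  change _ + (1 * (4 * (0 + 0 + size _) + 3 * (1 + m) + 1) + 1) + _ ≤ _
  omega

end PT

end UCQNeg

/-! ### String operations: comparison, transducers, iteration over segments -/

namespace UCQNeg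

open StackProg Function
open Ctx (rep)

variable {Γ Γ' Γ'' : Type} [Ctx Γ] [Ctx Γ'] [Ctx Γ'']

/-! ### Operations on strings -/

namespace PT

theorem append : PT fun p : Str × Str => p.1 ++ p.2 := by
  refine ⟨.seq (move 0 2) (.seq (move 1 3) (.seq (move 3 0) (move 2 0))),
    Polynomial.C 5 * Polynomial.X + Polynomial.C 4, fun p => ?_⟩
  obtain ⟨s, t⟩ := p
  refine ⟨_, ((runLe_move (by omega) _).seq ((runLe_move (by omega) _).seq
    ((runLe_move (by omega) _).seq (runLe_move (by omega) _)))).congr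
    (b' := 4 * s.length + 4 * t.length + 4) ?_ ?_, ?_⟩
  · simp only [update_st, rep, st_apply, setAt, List.cons_append, List.nil_append,
      List.getD_cons_zero, List.getD_cons_succ, List.getD_nil, List.append_nil,
      List.reverse_reverse]
    exact st_append_nil [s ++ t] 3
  · simp [update_st, rep, setAt]
    omega
  · simp
    omega

theorem reverse : PT fun s : Str => s.reverse := by
  refine ⟨.seq (move 0 1) (.seq (move 1 2) (move 2 0)),
    Polynomial.C 7 * Polynomial.X + Polynomial.C 3, fun s => ?_⟩
  refine ⟨_, ((runLe_move (by omega) _).seq ((runLe_move (by omega) _).seq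
    (runLe_move (by omega) _))).congr (b' := 6 * s.length + 3) ?_ ?_, ?_⟩
  · simp only [update_st, rep, st_apply, setAt, List.getD_cons_zero, List.getD_cons_succ,
      List.getD_nil, List.append_nil, List.reverse_reverse]
    exact st_append_nil [s.reverse] 2
  · simp [update_st, rep, setAt]
    omega
  · simp
    omega

theorem isNonempty : PT fun s : Str => !s.isEmpty := by
  refine ⟨.case 0 fun o => if o.isSome then .seq (clear 0) (.push 0 none) else .skip,
    Polynomial.C 2 * Polynomial.X + Polynomial.C 4, fun s => ?_⟩
  cases s with
  | nil =>
    refine ⟨_, RunLe.case (b := 1) ?_, by simp [size, rep]⟩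
    refine RunLe.skip.congr ?_ le_rfl
    rw [update_st]
    rfl
  | cons a s =>
    refine ⟨_, RunLe.case (b := 2 * s.length + 2) ?_, by simp [size, rep]; omega⟩
    refine ((runLe_clear 0 _).seq (.push rfl)).congr ?_ ?_
    · simp [update_st, rep, setAt]
    · simp [rep]

/-- Stack `2` receives a mark for each mismatch, including a premature end of `t`, and stack `1`
keeps what `t` has beyond the length of `s`. Starting without marks, the strings are equal exactly
if both stacks end up empty. -/
theorem runLe_compare (s t f : Str) : ∃ f', RunLe (.loop 0 fun a => .case 1 fun o =>
      if o = some a then .skip else .push 2 none) (st [s, t, f]) (st [[], t.drop s.length, f'])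
      (4 * s.length + 1) ∧ f'.length ≤ f.length + s.length ∧
      (f' = [] ∧ t.drop s.length = [] ↔ f = [] ∧ s = t) := by
  induction s generalizing t f with
  | nil => exact ⟨f, RunLe.loop_nil rfl, by simp, by simp [eq_comm]⟩
  | cons a s ih =>
    by_cases h : t.head? = some a
    · obtain ⟨f', h1, h2, h3⟩ := ih t.tail f
      obtain ⟨t', rfl⟩ : ∃ t', t = a :: t' := by
        cases t with
        | nil => simp at h
        | cons b t => exact ⟨t, by simpa using h⟩
      refine ⟨f', (RunLe.loop_cons (a := a) (l := s) rfl (.case (b := 1) ?_) h1).mono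
        (by simp; omega), by simp; omega, ?_⟩
      · rw [if_pos (by simp)]
        refine RunLe.skip.congr ?_ le_rfl
        simp [update_st, setAt]
      · simpa using h3
    · obtain ⟨f', h1, h2, h3⟩ := ih t.tail (none :: f)
      have hd : t.tail.drop s.length = t.drop (s.length + 1) := by
        rw [← List.drop_one, List.drop_drop, add_comm]
      rw [hd] at h1 h3
      refine ⟨f', (RunLe.loop_cons (a := a) (l := s) rfl (.case (b := 1) ?_) h1).mono
        (by simp; omega), by simp at *; omega, ?_⟩
      · rw [if_neg (by simpa [update_st, setAt] using h)]
        refine RunLe.push ?_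
        simp [update_st, setAt]
      · rw [List.length_cons, h3]
        simp only [List.cons_ne_nil, false_and, false_iff, not_and]
        rintro - rfl
        simp at h

theorem eqStr : PT fun p : Str × Str => decide (p.1 = p.2) := by
  refine ⟨.seq (.loop 0 fun a => .case 1 fun o => if o = some a then .skip else .push 2 none)
    (.seq (move 1 2) (.case 2 fun o => if o.isSome then clear 2 else .push 0 none)),
    Polynomial.C 10 * Polynomial.X + Polynomial.C 10, fun p => ?_⟩
  obtain ⟨s, t⟩ := p
  obtain ⟨f, h1, h2, h3⟩ := runLe_compare s t []
  have h0 : st (rep (s, t)) = st [s, t, []] := (st_append_nil [s, t] 1).symm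
  -- The leftover of `t` joins the marks, so that equality amounts to stack `2` being empty.
  have h4 : RunLe (move 1 2) (st [[], t.drop s.length, f])
      (st [[], [], (t.drop s.length).reverse ++ f]) (2 * t.length + 1) := by
    refine (runLe_move (by omega) _).congr ?_ ?_
    · simp [update_st, setAt]
    · simp
  have h5 : RunLe (.case 2 fun o => if o.isSome then clear 2 else .push 0 none)
      (st [[], [], (t.drop s.length).reverse ++ f]) (st (rep (decide (s = t))))
      (2 * (t.length + s.length) + 2) := by
    refine RunLe.case (b := 2 * (t.length + s.length) + 1) ?_
    by_cases hst : s = t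
    · obtain ⟨rfl, h6⟩ := h3.2 ⟨rfl, hst⟩
      rw [h6]
      refine RunLe.congr (S' := st (rep (decide (s = t)))) (RunLe.push ?_) rfl (by omega)
      simp only [update_st, setAt, rep, hst]
      exact st_append_nil [[none]] 2
    · have h6 : (t.drop s.length).reverse ++ f ≠ [] := by
        intro h
        rw [List.append_eq_nil_iff, List.reverse_eq_nil_iff] at h
        exact hst (h3.1 h.symm).2
      have hlen : ((t.drop s.length).reverse ++ f).length ≤ t.length + s.length := by
        simp at *; omega
      generalize (t.drop s.length).reverse ++ f = u at *
      obtain ⟨a, u, rfl⟩ := List.exists_cons_of_ne_nil h6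
      refine (runLe_clear 2 _).congr ?_ ?_
      · simp only [update_st, setAt, rep, hst]
        exact st_append_nil [[]] 2
      · simp at *; omega
  rw [h0]
  refine ⟨_, h1.seq (h4.seq h5), ?_⟩
  have := size_bool_le (decide (s = t))
  simp
  omega

end PT

/-- The output of a transducer with states `Option Sym`. -/
def transduce (δ : Option Sym → Sym → Option Sym × Str) : Option Sym → Str → Str
  | _, [] => []
  | q, a :: s => (δ q a).2 ++ transduce δ (δ q a).1 s

namespace PT

/-- Push the symbols of a string, one after the other, onto stack `k`. -/
def pushAll (k : ℕ) : Str → Prog Sym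
  | [] => .skip
  | a :: s => .seq (.push k a) (pushAll k s)

theorem runLe_pushAll (k : ℕ) (s : Str) (S : Store Sym) :
    RunLe (pushAll k s) S (update S k (s.reverse ++ S k)) (s.length + 1) := by
  induction s generalizing S with
  | nil =>
    simp only [List.reverse_nil, List.nil_append, update_eq_self]
    exact RunLe.skip
  | cons a s ih =>
    refine ((RunLe.push rfl).seq (ih _)).congr ?_ (by simp; omega)
    simp

/-- The state lives on stack `1`, empty for `none` and with one symbol otherwise, so that what
`case` pops is the state itself. Output accumulates in reverse on stack `2`. -/
theorem runLe_transduce (δ : Option Sym → Sym → Option Sym × Str) {c : ℕ}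
    (hc : ∀ q a, (δ q a).2.length ≤ c) (s o : Str) (q : Option Sym) :
    ∃ q' : Option Sym, RunLe (.loop 0 fun a => .case 1 fun q =>
        .seq (pushAll 1 (δ q a).1.toList) (pushAll 2 (δ q a).2))
      (st [s, q.toList, o]) (st [[], q'.toList, (transduce δ q s).reverse ++ o])
      (s.length * (c + 5) + 1) ∧ (transduce δ q s).length ≤ s.length * c := by
  induction s generalizing q o with
  | nil => exact ⟨q, by simpa [transduce] using RunLe.loop_nil rfl, by simp [transduce]⟩
  | cons a s ih =>
    obtain ⟨q', h1, h2⟩ := ih ((δ q a).2.reverse ++ o) (δ q a).1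
    have hh : (Option.toList q).head? = q := by cases q <;> rfl
    refine ⟨q', (RunLe.loop_cons (a := a) (l := s) rfl (.case (b := c + 3) ?_) h1).congr ?_ ?_, ?_⟩
    · simp only [update_st, setAt, st_apply, List.getD_cons_zero, List.getD_cons_succ, hh]
      refine ((runLe_pushAll 1 _ _).seq (runLe_pushAll 2 _ _)).congr ?_ ?_
      · cases q <;> cases h : (δ _ a).1 <;> simp [update_st, setAt]
      · have := hc q a
        have h' : (Option.toList (δ q a).1).length ≤ 1 := by cases (δ q a).1 <;> simp
        omega
    · simp [transduce]
    · simp; ring_nf; omega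
    · have := hc q a
      simp only [transduce, List.length_append, List.length_cons]
      nlinarith

theorem transduce (δ : Option Sym → Sym → Option Sym × Str) : PT (UCQNeg.transduce δ none) := by
  let c := Finset.univ.sup fun x : Option Sym × Sym => (δ x.1 x.2).2.length
  have hc : ∀ q a, (δ q a).2.length ≤ c := fun q a =>
    Finset.le_sup (f := fun x : Option Sym × Sym => (δ x.1 x.2).2.length) (Finset.mem_univ (q, a))
  refine ⟨.seq (.loop 0 fun a => .case 1 fun q =>
        .seq (pushAll 1 (δ q a).1.toList) (pushAll 2 (δ q a).2)) (.seq (clear 1) (move 2 0)),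
    Polynomial.C (4 * c + 5) * Polynomial.X + Polynomial.C 5, fun s => ?_⟩
  obtain ⟨q', h1, h2⟩ := runLe_transduce δ hc s [] none
  rw [show st [s, Option.toList none, []] = st (rep s) from st_append_nil [s] 2] at h1
  refine ⟨_, h1.seq (((runLe_clear 1 _).seq (runLe_move (by omega) _)).congr
    (b' := 3 + (2 * (s.length * c) + 1)) ?_ ?_), ?_⟩
  · simp only [update_st, rep, st_apply, setAt, List.getD_cons_zero, List.getD_cons_succ,
      List.append_nil, List.reverse_reverse]
    exact st_append_nil [_] 2
  · have h' : (Option.toList q').length ≤ 1 := by cases q' <;> simp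
    simp
    omega
  · simp only [size_str, Polynomial.eval_add, Polynomial.eval_mul, Polynomial.eval_C,
      Polynomial.eval_X]
    nlinarith

end PT

/-- The segments of `s` that end with `c`, where `u` is the reverse of the current segment. -/
def segsFrom (c : Sym) : Str → Str → List Str
  | _, [] => []
  | u, a :: s => if a = c then u.reverse :: segsFrom c [] s else segsFrom c (a :: u) s

/-- The segments of `s` that end with `c`. -/
def segs (c : Sym) (s : Str) : List Str := segsFrom c [] s

theorem update_st_append {A : Type} (e l : List (List A)) {n : ℕ} (hn : e.length = n) (k : ℕ)
    (x : List A) : update (st (e ++ l)) (n + k) x = st (e ++ setAt l k x) := by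
  subst hn
  rw [← frame_st, ← frame_st, ← update_st, update_frame]

theorem st_append_apply {A : Type} (e l : List (List A)) {n : ℕ} (hn : e.length = n) (k : ℕ) :
    st (e ++ l) (n + k) = l.getD k [] := by
  subst hn
  rw [← frame_st, frame_add]
  rfl

namespace PT

/-- The body of the loop over the segments of stack `m`. -/
def segsBody (c : Sym) (m : ℕ) (P : Prog Sym) (a : Sym) : Prog Sym :=
  if a = c then
    .seq (copyAll (m + 3) m) (.seq (move (m + 2) (m + 3 + m)) (.seq (P.shift (m + 3))
      (move (m + 3) (m + 1))))
  else .push (m + 2) a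

/-- Above the context `g` lie the unread input, the reversed output `o` and the reversed current
segment `u`. At a terminator, `g` is copied to the top, the segment is moved there, which restores
its order, `P` runs on this copy, and its result is moved onto the output. The sum of the lengths of
`u` and `s` never grows, so one `B` bounds every round. -/
theorem runLe_segs (c : Sym) {F : Γ × Str → Str} {P : Prog Sym} {p : Polynomial ℕ}
    (hP : ∀ x, ∃ b, RunLe P (st (rep x)) (st (rep (F x))) b ∧ b + size (F x) ≤ p.eval (size x))
    (g : Γ) (B : ℕ) (s u o : Str) (hB : u.length + s.length ≤ B) :
    ∃ u' : Str, u'.length ≤ u.length + s.length ∧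
      RunLe (.loop (Ctx.arity Γ) (segsBody c (Ctx.arity Γ) P)) (st (rep g ++ [s, o, u]))
        (st (rep g ++ [[], ((segsFrom c u s).flatMap fun v => F (g, v)).reverse ++ o, u']))
        (s.length * (5 * size g + 2 * Ctx.arity Γ + 2 * B + 3 * p.eval (size g + B) + 5) + 1) ∧
      ((segsFrom c u s).flatMap fun v => F (g, v)).length ≤ s.length * p.eval (size g + B) := by
  set m := Ctx.arity Γ
  have hm : (rep g).length = m := Ctx.length_rep g
  induction s generalizing u o with
  | nil =>
    refine ⟨u, by simp, ?_, by simp [segsFrom]⟩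
    simpa [segsFrom] using RunLe.loop_nil (st_append_apply _ _ hm 0)
  | cons a s ih =>
    have e0 : update (st (rep g ++ [a :: s, o, u])) m s = st (rep g ++ [s, o, u]) :=
      update_st_append _ _ hm 0 _
    by_cases hac : a = c
    · obtain ⟨b, hb, hle⟩ := hP (g, u.reverse)
      have hle' := eval_mono p (show size (g, u.reverse) ≤ size g + B by simp at *; omega)
      dsimp only at hle'
      have hF : size (F (g, u.reverse)) = (F (g, u.reverse)).length := size_str _
      obtain ⟨u', hu', h1, h2⟩ := ih [] ((F (g, u.reverse)).reverse ++ o) (by simp at *; omega)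
      have r1 : RunLe (copyAll (m + 3) m) (st (rep g ++ [s, o, u]))
          (st (rep g ++ [s, o, u] ++ rep g)) (5 * size g + 2 * m + 1) :=
        runLe_copyAll (rep g) [s, o, u] hm (by simp [hm])
      have r2 : RunLe (move (m + 2) (m + 3 + m)) (st (rep g ++ [s, o, u] ++ rep g))
          (st (rep g ++ [s, o, []] ++ rep (g, u.reverse))) (2 * u.length + 1) := by
        have e1 : st (rep g ++ [s, o, u] ++ rep g) (m + 2) = u := by
          rw [List.append_assoc]; exact st_append_apply _ _ hm 2
        have e2 : st (rep g ++ [s, o, u] ++ rep g) (m + 3 + m) = [] :=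
          List.getD_eq_default _ _ (by simp [hm]; omega)
        have e3 : update (st (rep g ++ [s, o, u] ++ rep g)) (m + 2) [] =
            st (rep g ++ [s, o, []] ++ rep g ++ []) := by
          rw [List.append_assoc, update_st_append _ _ hm]; simp [setAt]
        have e4 (x : Str) : update (st (rep g ++ [s, o, []] ++ rep g ++ [])) (m + 3 + m) x =
            st (rep g ++ [s, o, []] ++ rep g ++ [x]) :=
          update_st_append _ _ (n := m + 3 + m) (by simp [hm]; omega) 0 x
        refine (runLe_move (by omega) _).congr ?_ ?_
        · rw [e1, e2, e3, e4]
          simp [rep]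
        · rw [e1]
      have r3 : RunLe (P.shift (m + 3)) (st (rep g ++ [s, o, []] ++ rep (g, u.reverse)))
          (st (rep g ++ [s, o, []] ++ [F (g, u.reverse)])) b :=
        hb.shift _ (by simp [hm])
      have r4 : RunLe (move (m + 3) (m + 1)) (st (rep g ++ [s, o, []] ++ [F (g, u.reverse)]))
          (st (rep g ++ [s, (F (g, u.reverse)).reverse ++ o, []]))
          (2 * (F (g, u.reverse)).length + 1) := by
        rw [List.append_assoc]
        have e1 : st (rep g ++ ([s, o, []] ++ [F (g, u.reverse)])) (m + 3) = F (g, u.reverse) :=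
          st_append_apply _ _ hm 3
        have e2 : st (rep g ++ ([s, o, []] ++ [F (g, u.reverse)])) (m + 1) = o :=
          st_append_apply _ _ hm 1
        refine (runLe_move (by omega) _).congr ?_ ?_
        · rw [e1, e2, update_st_append _ _ hm, update_st_append _ _ hm]
          have := st_append_nil (rep g ++ [s, (F (g, u.reverse)).reverse ++ o, []]) 1
          simpa [setAt] using this
        · rw [e1]
      have rb : RunLe (segsBody c m P a) (st (rep g ++ [s, o, u]))
          (st (rep g ++ [s, (F (g, u.reverse)).reverse ++ o, []]))
          (5 * size g + 2 * m + 1 + (2 * u.length + 1 + (b + (2 * (F (g, u.reverse)).length + 1)))) := by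
        rw [segsBody, if_pos hac]
        exact r1.seq (r2.seq (r3.seq r4))
      refine ⟨u', by simp at *; omega,
        (RunLe.loop_cons (st_append_apply _ _ hm 0) (e0 ▸ rb) h1).congr ?_ ?_, ?_⟩
      · simp [segsFrom, hac]
      · simp only [List.length_cons, add_mul, one_mul] at *
        omega
      · simp only [segsFrom, hac, if_true, List.flatMap_cons, List.length_append,
          List.length_cons, add_mul, one_mul] at *
        omega
    · obtain ⟨u', hu', h1, h2⟩ := ih (a :: u) o (by simp at *; omega)
      have rb : RunLe (segsBody c m P a) (st (rep g ++ [s, o, u]))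
          (st (rep g ++ [s, o, a :: u])) 1 := by
        rw [segsBody, if_neg hac]
        refine .push ?_
        rw [st_append_apply _ _ hm, update_st_append _ _ hm]
        rfl
      refine ⟨u', by simp at *; omega,
        (RunLe.loop_cons (st_append_apply _ _ hm 0) (e0 ▸ rb) h1).congr ?_ ?_, ?_⟩
      · simp [segsFrom, hac]
      · simp only [List.length_cons, add_mul, one_mul] at *
        omega
      · simp only [segsFrom, hac, if_false, List.length_cons, add_mul, one_mul] at *
        omega

/-- Every round starts from the same context `g` and none uses the result of another. So sizes do
not compound, and the total cost is at most the number of symbols times the cost of one round. -/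
theorem flatMap_segs (c : Sym) {F : Γ × Str → Str} (hF : PT F) :
    PT fun p : Γ × Str => (segs c p.2).flatMap fun v => F (p.1, v) := by
  obtain ⟨P, p, hP⟩ := hF
  set m := Ctx.arity Γ with hmdef
  refine ⟨.seq (.loop m (segsBody c m P)) (.seq (clear (m + 2)) (.seq (move (m + 1) m)
    (dropAll 1 m))), Polynomial.X * (Polynomial.C (7 + 4 * m) * Polynomial.X +
      Polynomial.C (2 * m + 5) + Polynomial.C (6 + 4 * m) * p) +
      Polynomial.C (2 + 4 * m) * Polynomial.X + Polynomial.C (m * (3 * (m + 1) + 1) + 4),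
      fun x => ?_⟩
  obtain ⟨g, s⟩ := x
  have hm : (rep g).length = m := Ctx.length_rep g
  obtain ⟨u, hu, h1, h2⟩ := runLe_segs c hP g s.length s [] [] (by simp)
  rw [show st (rep g ++ [s, [], []]) = st (rep (g, s)) by
    simpa [rep] using st_append_nil (rep g ++ [s]) 2] at h1
  set r := (segs c s).flatMap fun v => F (g, v) with hr
  change r.length ≤ _ at h2
  have h3 : RunLe (clear (m + 2)) (st (rep g ++ [[], r.reverse ++ [], u]))
      (st (rep g ++ [[], r.reverse, []])) (2 * s.length + 1) := by
    refine (runLe_clear _ _).congr ?_ ?_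
    · rw [update_st_append _ _ hm]; simp [setAt]
    · rw [st_append_apply _ _ hm]; simpa using hu
  have h4 : RunLe (move (m + 1) m) (st (rep g ++ [[], r.reverse, []])) (st (rep g ++ [r]))
      (2 * r.length + 1) := by
    have e1 : st (rep g ++ [[], r.reverse, []]) (m + 1) = r.reverse := st_append_apply _ _ hm 1
    have e2 : st (rep g ++ [[], r.reverse, []]) m = [] := st_append_apply _ _ hm 0
    refine (runLe_move (by omega) _).congr ?_ ?_
    · rw [e1, e2, update_st_append _ _ hm]
      have := update_st_append (rep g) (setAt [[], r.reverse, []] 1 []) hm 0 r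
      rw [add_zero] at this
      simp only [List.reverse_reverse, List.append_nil]
      rw [this]
      simpa [setAt] using st_append_nil (rep g ++ [r]) 2
    · rw [e1]; simp
  have h5 := runLe_dropAll (rep g) [r] (n := 1) hm rfl
  refine ⟨_, h1.seq (h3.seq (h4.seq h5)), ?_⟩
  have hx : size (g, s) = size g + s.length := by simp
  simp only [Polynomial.eval_add, Polynomial.eval_mul, Polynomial.eval_C,
      Polynomial.eval_X, size_str, hx, total_cons, total_nil, ← hmdef]
  change _ * (5 * size g + 2 * m + 2 * s.length + _ + 5) + 1 +
    (_ + (_ + (m * (4 * (size g + _) + _ + 1) + 1))) + _ ≤ _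
  generalize p.eval (size g + s.length) = y at *
  generalize size g = n at *
  generalize s.length = k at *
  generalize r.length = l at *
  have h6 : m * l ≤ m * (k * y) := Nat.mul_le_mul_left m h2
  have h7 : k * y ≤ (n + k) * y := Nat.mul_le_mul_right _ (by omega)
  nlinarith [Nat.zero_le (n * n), Nat.zero_le (n * k), Nat.zero_le (n * m), Nat.zero_le (n * y),
    Nat.zero_le (m * (n * y)), Nat.zero_le (k * k), Nat.zero_le (m * (n * n)),
    Nat.zero_le (m * (n * k)), Nat.zero_le (m * (k * k))]

end PT

end UCQNeg

/-! ### Booleans, splitting of strings, and lists -/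

namespace UCQNeg

open StackProg Function
open Ctx (rep)

variable {Γ Γ' Γ'' : Type} [Ctx Γ] [Ctx Γ'] [Ctx Γ'']

/-! ### Booleans and conditionals -/

namespace PT

/-- Programs see only representations, so functions into different types are interchangeable if
their values are represented alike. This passes between a type and the string or tuple that codes
it. -/
theorem of_rep_eq {f : Γ → Γ'} {h : Γ → Γ''} (hh : PT h) (e : ∀ g, rep (f g) = rep (h g)) :
    PT f := by
  obtain ⟨P, p, hP⟩ := hh
  refine ⟨P, p, fun g => ?_⟩
  obtain ⟨b, hb, hle⟩ := hP g
  exact ⟨b, by rwa [e], by unfold size at *; rwa [e]⟩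

theorem congr {f h : Γ → Γ'} (hh : PT h) (e : ∀ g, f g = h g) : PT f :=
  hh.of_rep_eq fun g => by rw [e]

theorem not {b : Γ → Bool} (hb : PT b) : PT fun g => !b g :=
  (hb.ite (const false) (const true)).congr fun g => by cases b g <;> rfl

theorem and {b c : Γ → Bool} (hb : PT b) (hc : PT c) : PT fun g => b g && c g :=
  (hb.ite hc (const false)).congr fun g => by cases b g <;> rfl

theorem or {b c : Γ → Bool} (hb : PT b) (hc : PT c) : PT fun g => b g || c g :=
  (hb.ite (const true) hc).congr fun g => by cases b g <;> rfl

theorem appendStr {f h : Γ → Str} (hf : PT f) (hh : PT h) : PT fun g => f g ++ h g :=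
  append.comp (hf.pair hh)

theorem eq_of_injective {α : Type} [Ctx α] [DecidableEq α] {e : α → Str} (he : PT e)
    (hinj : Injective e) {f h : Γ → α} (hf : PT f) (hh : PT h) :
    PT fun g => decide (f g = h g) :=
  (eqStr.comp ((he.comp hf).pair (he.comp hh))).congr fun g => by simp [hinj.eq_iff]

end PT

/-! ### Splitting strings -/

/-- The part of a string before the first `c`. -/
def before (c : Sym) (s : Str) : Str := s.takeWhile (· ≠ c)

/-- The part of a string after the first `c`. -/
def after (c : Sym) (s : Str) : Str := (s.dropWhile (· ≠ c)).tail

theorem before_append {c : Sym} {u : Str} (h : c ∉ u) (r : Str) : before c (u ++ c :: r) = u := by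
  induction u with
  | nil => simp [before]
  | cons a u ih =>
    simp only [List.mem_cons, not_or] at h
    simpa [before, Ne.symm h.1] using ih h.2

theorem after_append {c : Sym} {u : Str} (h : c ∉ u) (r : Str) : after c (u ++ c :: r) = r := by
  induction u with
  | nil => simp [after]
  | cons a u ih =>
    simp only [List.mem_cons, not_or] at h
    simpa [after, Ne.symm h.1] using ih h.2

theorem segsFrom_append {c : Sym} {s : Str} (h : c ∉ s) (u r : Str) :
    segsFrom c u (s ++ c :: r) = (u.reverse ++ s) :: segsFrom c [] r := by
  induction s generalizing u with
  | nil => simp [segsFrom]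
  | cons a s ih =>
    simp only [List.mem_cons, not_or] at h
    simp [segsFrom, Ne.symm h.1, ih h.2]

namespace PT

theorem before (c : Sym) : PT (before c) := by
  -- State `none` means that `c` has not been read yet.
  let δ : Option Sym → Sym → Option Sym × Str := fun q a =>
    if q = none ∧ a ≠ c then (none, [a]) else (some c, [])
  refine (transduce δ).congr fun s => ?_
  have h (s : Str) : UCQNeg.transduce δ (some c) s = [] := by
    induction s with
    | nil => rfl
    | cons a s ih => simpa [UCQNeg.transduce, δ] using ih
  induction s with
  | nil => rfl
  | cons a s ih =>
    by_cases hac : a = c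
    · simp [UCQNeg.before, UCQNeg.transduce, δ, hac, h]
    · simpa [UCQNeg.before, UCQNeg.transduce, δ, hac] using ih

theorem after (c : Sym) : PT (after c) := by
  let δ : Option Sym → Sym → Option Sym × Str := fun q a =>
    if q = none then (if a = c then (some c, []) else (none, [])) else (some c, [a])
  refine (transduce δ).congr fun s => ?_
  have h (s : Str) : UCQNeg.transduce δ (some c) s = s := by
    induction s with
    | nil => rfl
    | cons a s ih => simpa [UCQNeg.transduce, δ] using ih
  induction s with
  | nil => rfl
  | cons a s ih =>
    by_cases hac : a = c
    · simp [UCQNeg.after, UCQNeg.transduce, δ, hac, h]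
    · simpa [UCQNeg.after, UCQNeg.transduce, δ, hac] using ih

end PT

/-! ### Lists of items -/

/-- Types whose elements can be the items of lists: they are coded by strings, and a list is
written with the symbol `term` after each item. -/
class Item (α : Type) [Ctx α] where
  term : Sym
  enc : α → Str
  dec : Str → α
  dec_enc : ∀ a, dec (enc a) = a
  term_notMem : ∀ a, term ∉ enc a
  pt_enc : PT enc
  pt_dec : PT dec

section

variable {α β : Type} [Ctx α] [Item α] [Ctx β] [Item β]

/-- The string that represents a list of items. -/
def encList (l : List α) : Str := l.flatMap fun a => Item.enc a ++ [Item.term α]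

variable (α) in
/-- The list of the items in a string. -/
def decList (s : Str) : List α := (segs (Item.term α) s).map Item.dec

instance : Ctx (List α) := ⟨1, fun l => [encList l], fun _ => rfl⟩

theorem segs_encList (l : List α) : segs (Item.term α) (encList l) = l.map Item.enc := by
  induction l with
  | nil => rfl
  | cons a l ih =>
    have := segsFrom_append (Item.term_notMem a) [] (encList l)
    simp only [segs] at *
    rw [ih] at this
    simpa [encList] using this

@[simp] theorem decList_encList (l : List α) : decList α (encList l) = l := by
  simp [decList, segs_encList, comp_def, Item.dec_enc]

theorem encList_injective : Injective (encList (α := α)) :=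
  LeftInverse.injective decList_encList

@[simp] theorem encList_append (l l' : List α) : encList (l ++ l') = encList l ++ encList l' := by
  simp [encList]

namespace PT

variable (α) in
theorem encList : PT (encList (α := α)) := id.of_rep_eq fun _ => rfl

theorem eq [DecidableEq α] {f h : Γ → α} (hf : PT f) (hh : PT h) :
    PT fun g => decide (f g = h g) :=
  eq_of_injective Item.pt_enc (LeftInverse.injective Item.dec_enc) hf hh

theorem eqList [DecidableEq α] {f h : Γ → List α} (hf : PT f) (hh : PT h) :
    PT fun g => decide (f g = h g) :=
  eq_of_injective (encList α) encList_injective hf hh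

theorem flatMapStr {l : Γ → List α} {F : Γ → α → Str} (hl : PT l)
    (hF : PT fun x : Γ × α => F x.1 x.2) : PT fun g => (l g).flatMap (F g) := by
  have h1 : PT fun x : Γ × Str => F x.1 (Item.dec x.2) :=
    hF.comp (fst.pair (Item.pt_dec.comp snd))
  refine ((flatMap_segs (Item.term α) h1).comp (id.pair ((encList α).comp hl))).congr fun g => ?_
  simp [segs_encList, List.flatMap_map, Item.dec_enc]

theorem flatMap {l : Γ → List α} {F : Γ → α → List β} (hl : PT l)
    (hF : PT fun x : Γ × α => F x.1 x.2) : PT fun g => (l g).flatMap (F g) := by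
  refine (flatMapStr (F := fun g a => UCQNeg.encList (F g a)) hl
    ((encList β).comp hF)).of_rep_eq fun g => ?_
  simp only [rep, UCQNeg.encList, List.flatMap_assoc]

theorem singleton {f : Γ → α} (hf : PT f) : PT fun g => [f g] :=
  (appendStr (Item.pt_enc.comp hf) (const [Item.term α])).of_rep_eq fun g => by
    simp [rep, UCQNeg.encList]

theorem map {l : Γ → List α} {F : Γ → α → β} (hl : PT l)
    (hF : PT fun x : Γ × α => F x.1 x.2) : PT fun g => (l g).map (F g) :=
  (flatMap (F := fun g a => [F g a]) hl (singleton hF)).congr fun g => by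
    rw [← List.flatMap_pure_eq_map]; rfl

theorem appendList {f h : Γ → List α} (hf : PT f) (hh : PT h) : PT fun g => f g ++ h g :=
  (appendStr ((encList α).comp hf) ((encList α).comp hh)).of_rep_eq fun g => by
    simp [rep]

/-- One mark is written for each item that passes the test; the answer is whether any mark was
written. -/
theorem any {l : Γ → List α} {F : Γ → α → Bool} (hl : PT l)
    (hF : PT fun x : Γ × α => F x.1 x.2) : PT fun g => (l g).any (F g) := by
  refine (isNonempty.comp (flatMapStr (F := fun g a => if F g a then [none] else []) hl
    (hF.ite (const [none]) (const [])))).congr fun g => ?_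
  rw [Bool.eq_iff_iff]
  simp [List.flatMap_eq_nil_iff]

theorem all {l : Γ → List α} {F : Γ → α → Bool} (hl : PT l)
    (hF : PT fun x : Γ × α => F x.1 x.2) : PT fun g => (l g).all (F g) :=
  (any (F := fun g a => !F g a) hl hF.not).not.congr fun g => by simp [List.all_eq_not_any_not]

-- Segments need not be codes of items. Decoding and encoding them again produces the canonical
-- representation of the decoded list.
variable (α) in
theorem decList : PT (decList α) := by
  have h1 : PT fun x : Str × Str => Item.enc (Item.dec x.2 : α) ++ [Item.term α] :=
    appendStr (Item.pt_enc.comp (Item.pt_dec.comp snd)) (const _)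
  refine ((flatMap_segs (Item.term α) h1).comp (id.pair id)).of_rep_eq fun s => ?_
  simp [rep, UCQNeg.encList, UCQNeg.decList, List.flatMap_map]

end PT

end

end UCQNeg

/-! ### Representation of names, atoms and queries by strings -/

namespace UCQNeg

open StackProg Function
open Ctx (rep)

variable {Γ Γ' Γ'' : Type} [Ctx Γ] [Ctx Γ'] [Ctx Γ'']

/-! ### Names -/

/-- A letter as a symbol. -/
abbrev sym (l : Letter) : Sym := some (Sum.inl l)

/-- The string that represents a name. -/
def nameStr (n : Name) : Str := n.map fun b => sym (.bit b)

instance : Ctx Name := ⟨1, fun n => [nameStr n], fun _ => rfl⟩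

/-- The bit written as a symbol. -/
def symBit : Sym → Option Bool
  | some (Sum.inl (.bit b)) => some b
  | _ => none

/-- The name formed by the bits in a string. -/
def decName (s : Str) : Name := s.filterMap symBit

theorem mem_nameStr {a : Sym} {n : Name} (h : a ∈ nameStr n) : ∃ b, a = sym (.bit b) := by
  simp only [nameStr, List.mem_map] at h
  obtain ⟨b, -, rfl⟩ := h
  exact ⟨b, rfl⟩

theorem pt_nameStr : PT nameStr := PT.id.of_rep_eq fun _ => rfl

theorem pt_decName : PT decName := by
  let δ : Option Sym → Sym → Option Sym × Str := fun _ a =>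
    (none, if (symBit a).isSome then [a] else [])
  refine (PT.transduce δ).of_rep_eq fun s => ?_
  simp only [rep, List.cons.injEq, and_true]
  induction s with
  | nil => rfl
  | cons a s ih =>
    cases h : symBit a with
    | none =>
      have e : decName (a :: s) = decName s := List.filterMap_cons_none h
      rw [e, transduce]
      simpa [δ, h] using ih
    | some b =>
      have ha : sym (.bit b) = a := by
        unfold symBit at h
        split at h <;> simp_all
      have e : decName (a :: s) = b :: decName s := List.filterMap_cons_some h
      have e' : nameStr (b :: decName s) = a :: nameStr (decName s) := by simp [nameStr, ha]
      rw [e, e', transduce, ih]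
      simp [δ, h]

instance : Item Name where
  term := sym .endName
  enc := nameStr
  dec := decName
  dec_enc n := by
    simp only [decName, nameStr, List.filterMap_map]
    exact (List.filterMap_congr fun _ _ => rfl).trans (List.filterMap_some)
  term_notMem n h := by
    obtain ⟨b, hb⟩ := mem_nameStr h
    simp [sym] at hb
  pt_enc := pt_nameStr
  pt_dec := pt_decName

theorem PT.flatMapName {α : Type} [Ctx α] [Item α] {l : Γ → List α} {F : Γ → α → Name} (hl : PT l)
    (hF : PT fun x : Γ × α => F x.1 x.2) : PT fun g => ((l g).flatMap (F g) : Name) := by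
  refine (PT.flatMapStr (F := fun g a => nameStr (F g a)) hl
    (pt_nameStr.comp hF)).of_rep_eq fun g => ?_
  simp only [rep, nameStr, List.map_flatMap]

theorem mem_encList {α : Type} [Ctx α] [Item α] {l : List α} {a : Sym} (h : a ∈ encList l) :
    a = Item.term α ∨ ∃ x ∈ l, a ∈ Item.enc x := by
  simp only [encList, List.mem_flatMap, List.mem_append, List.mem_singleton] at h
  obtain ⟨x, hx, h | h⟩ := h
  · exact Or.inr ⟨x, hx, h⟩
  · exact Or.inl h

/-! ### Atoms -/

instance : Ctx (Atom Name) :=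
  ⟨Ctx.arity (Name × List Name), fun A => rep (A.rel, A.args), fun _ => Ctx.length_rep _⟩

theorem pt_rel : PT (fun A : Atom Name => A.rel) :=
  PT.fst.comp (Γ' := Name × List Name) (f := fun A : Atom Name => (A.rel, A.args))
    (PT.id.of_rep_eq fun _ => rfl)

theorem pt_args : PT (fun A : Atom Name => A.args) :=
  PT.snd.comp (Γ' := Name × List Name) (f := fun A : Atom Name => (A.rel, A.args))
    (PT.id.of_rep_eq fun _ => rfl)

theorem PT.mkAtom {r : Γ → Name} {l : Γ → List Name} (hr : PT r) (hl : PT l) :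
    PT fun g => (⟨r g, l g⟩ : Atom Name) :=
  (hr.pair hl).of_rep_eq fun _ => rfl

/-- An atom as a string. -/
def atomStr (A : Atom Name) : Str := nameStr A.rel ++ sym .endName :: encList A.args

theorem mem_atomStr {a : Sym} {A : Atom Name} (h : a ∈ atomStr A) :
    (∃ b, a = sym (.bit b)) ∨ a = sym .endName := by
  simp only [atomStr, List.mem_append, List.mem_cons] at h
  rcases h with h | h | h
  · exact Or.inl (mem_nameStr h)
  · exact Or.inr h
  · rcases mem_encList h with h | ⟨x, -, h⟩
    · exact Or.inr h
    · exact Or.inl (mem_nameStr h)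

theorem endName_notMem_nameStr (n : Name) : sym .endName ∉ nameStr n := Item.term_notMem n

/-- The atom described by a string. -/
def decAtom (s : Str) : Atom Name :=
  ⟨decName (before (sym .endName) s), decList Name (after (sym .endName) s)⟩

instance : Item (Atom Name) where
  term := sym .endAtom
  enc := atomStr
  dec := decAtom
  dec_enc A := by
    simp only [decAtom, atomStr, before_append (endName_notMem_nameStr _),
      after_append (endName_notMem_nameStr _), decList_encList]
    rw [show decName (nameStr A.rel) = A.rel from Item.dec_enc A.rel]
  term_notMem A h := by
    rcases mem_atomStr h with ⟨b, h⟩ | h <;> simp [sym] at h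
  pt_enc := PT.appendStr (pt_nameStr.comp pt_rel)
    (PT.appendStr (PT.const [sym .endName]) ((PT.encList Name).comp pt_args))
  pt_dec := PT.mkAtom (pt_decName.comp (PT.before _)) ((PT.decList Name).comp (PT.after _))

/-! ### Queries -/

/-- An inequality as an atom. -/
def ineqAtom (b : Name × Name) : Atom Name := ⟨b.1, [b.2]⟩

namespace CQ

/-- The inequalities of a query as atoms. -/
def ineqAtoms (q : CQ) : List (Atom Name) := q.ineqs.map ineqAtom

/-- The components of a query. -/
def parts (q : CQ) : Atom Name × List (Atom Name) × List (Atom Name) × List (Atom Name) :=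
  (q.head, q.pos, q.neg, q.ineqAtoms)

end CQ

/-- Inequalities are carried as unary atoms, so that lists of atoms are the only lists needed inside
a query. -/
instance : Ctx CQ := ⟨Ctx.arity (Atom Name × List (Atom Name) × List (Atom Name) × List (Atom Name)),
  fun q => rep q.parts, fun _ => Ctx.length_rep _⟩

theorem pt_parts : PT CQ.parts := PT.id.of_rep_eq fun _ => rfl

theorem pt_head : PT CQ.head := PT.fst.comp pt_parts

theorem pt_pos : PT CQ.pos := PT.fst.comp (PT.snd.comp pt_parts)

theorem pt_neg : PT CQ.neg := PT.fst.comp (PT.snd.comp (PT.snd.comp pt_parts))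

theorem pt_ineqAtoms : PT CQ.ineqAtoms := PT.snd.comp (PT.snd.comp (PT.snd.comp pt_parts))

/-- Group a list into pairs. -/
def pairs : List Name → List (Name × Name)
  | a :: b :: l => (a, b) :: pairs l
  | _ => []

theorem pairs_flatMap (l : List (Name × Name)) : pairs (l.flatMap fun b => [b.1, b.2]) = l := by
  induction l with
  | nil => rfl
  | cons b l ih => simp [pairs, ih]

/-- The transducer that ends every second name with `endAtom`. -/
def pairUp (q : Option Sym) (a : Sym) : Option Sym × Str :=
  if a = sym .endName then
    if q = none then (some a, [a]) else (none, [a, sym .endAtom])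
  else (q, [a])

theorem transduce_pairUp_name (q : Option Sym) (n : Name) (r : Str) :
    transduce pairUp q (nameStr n ++ r) = nameStr n ++ transduce pairUp q r := by
  induction n with
  | nil => rfl
  | cons b n ih =>
    simp only [nameStr, List.map_cons, List.cons_append, transduce] at *
    simpa [pairUp, sym] using ih

/-- With a terminator after every second name, a code of names becomes a code of atoms `x(y)`. An
unpaired last name forms an unterminated segment, which decoding ignores just as `pairs` does. -/
theorem pt_pairs : PT fun l : List Name => (pairs l).map ineqAtom := by
  refine ((PT.decList (Atom Name)).comp ((PT.transduce pairUp).comp (PT.encList Name))).congr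
    fun l => ?_
  have h : ∀ l : List Name, ∃ r : Str, sym .endAtom ∉ r ∧ transduce pairUp none (encList l) =
      encList ((pairs l).map ineqAtom) ++ r := by
    intro l
    induction l using pairs.induct with
    | case1 a b l ih =>
      obtain ⟨r, hr, h⟩ := ih
      refine ⟨r, hr, ?_⟩
      have e : encList (a :: b :: l) = nameStr a ++ (sym .endName :: (nameStr b ++
          (sym .endName :: encList l))) := by
        simp [encList, Item.enc, Item.term]
      rw [e, transduce_pairUp_name, transduce]
      simp only [pairUp, if_true]
      rw [transduce_pairUp_name, transduce]
      simp only [pairUp, if_true, if_neg (Option.some_ne_none _), h]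
      simp [pairs, encList, ineqAtom, Item.enc, Item.term, atomStr]
    | case2 l hl =>
      rcases l with _ | ⟨a, _ | ⟨b, l⟩⟩
      · exact ⟨[], by simp, rfl⟩
      · refine ⟨nameStr a ++ [sym .endName], ?_, ?_⟩
        · intro h
          simp only [List.mem_append, List.mem_singleton] at h
          rcases h with h | h
          · obtain ⟨b, hb⟩ := mem_nameStr h
            simp [sym] at hb
          · simp [sym] at h
        · have e : encList [a] = nameStr a ++ [sym .endName] := by
            simp [encList, Item.enc, Item.term]
          rw [e, transduce_pairUp_name]
          simp [transduce, pairUp, pairs, encList]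
      · exact absurd rfl (hl a b l)
  obtain ⟨r, hr, h⟩ := h l
  have hs : ∀ (r u : Str), sym .endAtom ∉ r → segsFrom (sym .endAtom) u r = [] := by
    intro r
    induction r with
    | nil => intros; rfl
    | cons a r ih =>
      intro u h
      simp only [List.mem_cons, not_or] at h
      rw [segsFrom, if_neg (Ne.symm h.1)]
      exact ih _ h.2
  have hs' : ∀ l : List (Atom Name), segs (sym .endAtom) (encList l ++ r) = l.map atomStr := by
    intro l
    induction l with
    | nil => exact hs r [] hr
    | cons A l ih =>
      have := segsFrom_append (Item.term_notMem A) [] (encList l ++ r)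
      simp only [segs] at *
      simp only [Item.term] at this
      rw [ih] at this
      simpa [encList, Item.term, Item.enc] using this
  rw [h]
  have := Item.dec_enc (α := Atom Name)
  simp only [Item.dec, Item.enc] at this
  simp only [decList, Item.term, hs', List.map_map, Item.dec, comp_def, this]

/-- The code of the inequalities of a query. -/
def ineqStr (l : List (Name × Name)) : Str := encList (l.flatMap fun b => [b.1, b.2])

theorem ineqStr_eq (l : List (Name × Name)) : ineqStr l = (l.map ineqAtom).flatMap atomStr := by
  induction l with
  | nil => rfl
  | cons b l ih =>
    simp only [ineqStr, List.flatMap_cons, encList_append, List.map_cons] at *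
    rw [ih]
    simp [encList, ineqAtom, atomStr, Item.enc, Item.term]

/-- A query as a string. -/
def cqStr (q : CQ) : Str :=
  atomStr q.head ++ sym .endAtom :: (encList q.pos ++ sym .endAtoms :: (encList q.neg ++
    sym .endAtoms :: ineqStr q.ineqs))

/-- The query described by a string. -/
def decCQ (s : Str) : CQ :=
  let s' := after (sym .endAtom) s
  let s'' := after (sym .endAtoms) s'
  ⟨decAtom (before (sym .endAtom) s), decList _ (before (sym .endAtoms) s'),
    decList _ (before (sym .endAtoms) s''), pairs (decList _ (after (sym .endAtoms) s''))⟩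

theorem endAtom_notMem_atomStr (A : Atom Name) : sym .endAtom ∉ atomStr A := Item.term_notMem A

theorem mem_encList_atom {a : Sym} {l : List (Atom Name)} (h : a ∈ encList l) :
    (∃ b, a = sym (.bit b)) ∨ a = sym .endName ∨ a = sym .endAtom := by
  rcases mem_encList h with h | ⟨A, -, h⟩
  · exact Or.inr (Or.inr h)
  · exact (mem_atomStr h).imp_right Or.inl

theorem endAtoms_notMem_encList (l : List (Atom Name)) : sym .endAtoms ∉ encList l := fun h => by
  rcases mem_encList_atom h with ⟨b, h⟩ | h | h <;> simp [sym] at h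

instance : Item CQ where
  term := sym .endCQ
  enc := cqStr
  dec := decCQ
  dec_enc q := by
    have h : decAtom (atomStr q.head) = q.head := Item.dec_enc q.head
    simp only [cqStr, decCQ, before_append (endAtom_notMem_atomStr _),
      after_append (endAtom_notMem_atomStr _), before_append (endAtoms_notMem_encList _),
      after_append (endAtoms_notMem_encList _), decList_encList, ineqStr, pairs_flatMap, h]
  term_notMem q h := by
    simp only [cqStr, ineqStr, List.mem_append, List.mem_cons] at h
    rcases h with h | h | h | h | h | h | h
    · rcases mem_atomStr h with ⟨b, h⟩ | h <;> simp [sym] at h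
    · simp [sym] at h
    · rcases mem_encList_atom h with ⟨b, h⟩ | h | h <;> simp [sym] at h
    · simp [sym] at h
    · rcases mem_encList_atom h with ⟨b, h⟩ | h | h <;> simp [sym] at h
    · simp [sym] at h
    · rcases mem_encList h with h | ⟨n, -, h⟩
      · simp [sym, Item.term] at h
      · obtain ⟨b, h⟩ := mem_nameStr h
        simp [sym] at h
  pt_enc := by
    refine PT.appendStr (Item.pt_enc.comp pt_head) (PT.appendStr (PT.const [_])
      (PT.appendStr ((PT.encList _).comp pt_pos) (PT.appendStr (PT.const [_])
      (PT.appendStr ((PT.encList _).comp pt_neg) (PT.appendStr (PT.const [_]) ?_)))))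
    refine (PT.flatMapStr (F := fun _ A => atomStr A) pt_ineqAtoms
      ((Item.pt_enc (α := Atom Name)).comp PT.snd)).congr fun q => ?_
    exact ineqStr_eq _
  pt_dec := by
    have h1 := PT.after (sym .endAtom)
    have h2 := (PT.after (sym .endAtoms)).comp h1
    exact (((Item.pt_dec (α := Atom Name)).comp (PT.before _)).pair
      (((PT.decList (Atom Name)).comp ((PT.before (sym .endAtoms)).comp h1)).pair
      (((PT.decList (Atom Name)).comp ((PT.before (sym .endAtoms)).comp h2)).pair
      (pt_pairs.comp ((PT.decList Name).comp
        ((PT.after (sym .endAtoms)).comp h2)))))).of_rep_eq fun _ => rfl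

/-! ### Encodings of queries -/

theorem map_encodeName (n : Name) : (encodeName n).map sym = nameStr n ++ [sym .endName] := by
  simp [encodeName, nameStr]

theorem map_encodeAtom (A : Atom Name) :
    (encodeAtom A).map sym = atomStr A ++ [sym .endAtom] := by
  simp [encodeAtom, List.map_flatMap, map_encodeName, atomStr, encList, Item.enc, Item.term]

theorem map_encodeCQ (q : CQ) : (encodeCQ q).map sym = cqStr q ++ [sym .endCQ] := by
  simp [encodeCQ, List.map_flatMap, map_encodeName, map_encodeAtom, cqStr, encList, Item.enc,
    Item.term, ineqStr, List.flatMap_assoc]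

theorem map_encodeUCQ (Q : UCQ) : (encodeUCQ Q).map sym = encList Q ++ [sym .endUCQ] := by
  simp [encodeUCQ, List.map_flatMap, map_encodeCQ, encList, Item.enc, Item.term]

end UCQNeg

/-! ### The polynomial-time checks -/

namespace UCQNeg

open StackProg Function

variable {Γ : Type} [Ctx Γ]

/-! ## Checking queries in polynomial time -/

noncomputable instance : DecidableEq (Atom Name) := Classical.decEq _

attribute [local irreducible] PT

/-- The name assigned to `a` by an association list of atoms `x(V(x))`. -/
def look (V : List (Atom Name)) (a : Name) : Name :=
  V.flatMap fun A => if A.rel = a then A.args.flatten else []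

/-- Whether the assignment `V` satisfies `q` on `I`. -/
noncomputable def satB (I V : List (Atom Name)) (q : CQ) : Bool :=
  (q.pos.all fun A => I.any fun F => decide (F = A.map (look V))) &&
    ((q.neg.all fun A => !I.any fun F => decide (F = A.map (look V))) &&
      q.ineqAtoms.all fun A => !decide (look V A.rel = look V A.args.flatten))

/-- Whether `q` yields the fact `f` on `I` by the assignment `V`. -/
noncomputable def yieldsB (I V : List (Atom Name)) (f : Atom Name) (q : CQ) : Bool :=
  satB I V q && decide (q.head.map (look V) = f)

namespace PT

theorem flatten {l : Γ → List Name} (hl : PT l) : PT fun g => ((l g).flatten : Name) :=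
  (flatMapName (F := fun _ n => n) hl snd).congr fun g => by simp [List.flatMap_def]

theorem look {V : Γ → List (Atom Name)} {a : Γ → Name} (hV : PT V) (ha : PT a) :
    PT fun g => look (V g) (a g) := by
  unfold UCQNeg.look
  refine flatMapName (F := fun g A => if A.rel = a g then A.args.flatten else []) hV ?_
  refine (ite (PT.eq (pt_rel.comp snd) (ha.comp fst)) (flatten (pt_args.comp snd))
    (const [])).congr fun x => ?_
  simp

theorem mapAtom {V : Γ → List (Atom Name)} {A : Γ → Atom Name} (hV : PT V) (hA : PT A) :
    PT fun g => (A g).map (UCQNeg.look (V g)) :=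
  mkAtom (pt_rel.comp hA) (map (F := fun g a => UCQNeg.look (V g) a) (pt_args.comp hA)
    (look (hV.comp fst) snd))

theorem mem {α : Type} [Ctx α] [Item α] [DecidableEq α] {l : Γ → List α} {a : Γ → α} (hl : PT l)
    (ha : PT a) : PT fun g => (l g).any fun b => decide (b = a g) :=
  any (F := fun g b => decide (b = a g)) hl (PT.eq snd (ha.comp fst))

theorem satB {I V : Γ → List (Atom Name)} {q : Γ → CQ} (hI : PT I) (hV : PT V) (hq : PT q) :
    PT fun g => satB (I g) (V g) (q g) := by
  have h : PT fun x : Γ × Atom Name =>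
      (I x.1).any fun F => decide (F = x.2.map (UCQNeg.look (V x.1))) :=
    mem (hI.comp fst) (mapAtom (hV.comp fst) snd)
  unfold UCQNeg.satB
  refine and (all (F := fun g A => (I g).any fun F => decide (F = A.map (UCQNeg.look (V g))))
      (pt_pos.comp hq) h) (and (all (F := fun g A => !(I g).any fun F =>
      decide (F = A.map (UCQNeg.look (V g)))) (pt_neg.comp hq) h.not)
      (all (F := fun g A => !decide (UCQNeg.look (V g) A.rel = UCQNeg.look (V g) A.args.flatten))
        (pt_ineqAtoms.comp hq) ?_))
  exact (PT.eq (look (hV.comp fst) (pt_rel.comp snd))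
    (look (hV.comp fst) (flatten (pt_args.comp snd)))).not

theorem yieldsB {I V : Γ → List (Atom Name)} {f : Γ → Atom Name} {q : Γ → CQ} (hI : PT I)
    (hV : PT V) (hf : PT f) (hq : PT q) : PT fun g => yieldsB (I g) (V g) (f g) (q g) :=
  and (satB hI hV hq) (PT.eq (mapAtom hV (pt_head.comp hq)) hf)

end PT

/-! ### Well-formedness -/

/-- The variables in positive atoms. -/
def CQ.vars (q : CQ) : List Name := q.pos.flatMap Atom.args

/-- The positive and negated atoms of the disjuncts. -/
def body (Q : UCQ) : List (Atom Name) := Q.flatMap fun q => q.pos ++ q.neg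

/-- The heads of the disjuncts. -/
def heads (Q : UCQ) : List (Atom Name) := Q.map CQ.head

/-- The variables in positive atoms of the disjuncts. -/
def vars (Q : UCQ) : List Name := Q.flatMap CQ.vars

/-- The arity of an atom, in unary. -/
def arityList (A : Atom Name) : List Name := A.args.map fun _ => []

/-- The local conditions on a well-formed query. -/
def cqWF (q : CQ) : Bool :=
  (q.ineqAtoms.all fun A => !decide (A.rel = A.args.flatten) &&
      ((q.vars.any fun x => decide (x = A.rel)) &&
        q.vars.any fun x => decide (x = A.args.flatten))) &&
    ((q.head.args.all fun a => q.vars.any fun x => decide (x = a)) &&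
      (q.neg.flatMap Atom.args).all fun a => q.vars.any fun x => decide (x = a))

/-- Atoms in `l` with the same relation name have the same arity. -/
def sameArity (l : List (Atom Name)) : Bool :=
  l.all fun A => l.all fun A' => !decide (A.rel = A'.rel) || decide (arityList A = arityList A')

/-- Two queries are over a common schema. -/
def wfB (Q₁ Q₂ : UCQ) : Bool :=
  ((Q₁.any fun _ => true) && Q₂.any fun _ => true) &&
    ((Q₁.all cqWF && Q₂.all cqWF) &&
      ((((heads Q₁).all fun H => (heads Q₁).all fun H' => decide (H.rel = H'.rel)) &&
          (heads Q₂).all fun H => (heads Q₂).all fun H' => decide (H.rel = H'.rel)) &&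
        (((body Q₁ ++ body Q₂).all fun A => (heads Q₁ ++ heads Q₂).all fun H =>
            !decide (A.rel = H.rel)) &&
          sameArity ((body Q₁ ++ body Q₂) ++ (heads Q₁ ++ heads Q₂)))))

/-- All arities are at most `k`. -/
def arityLe (k : ℕ) (l : List (Atom Name)) : Bool :=
  l.all fun A => (List.range (k + 1)).any fun j => decide (arityList A = List.replicate j [])

theorem pt_cqVars : PT CQ.vars :=
  PT.flatMap (F := fun (_ : CQ) (A : Atom Name) => A.args) pt_pos (pt_args.comp PT.snd)

theorem pt_body : PT body :=
  PT.flatMap (F := fun (_ : UCQ) (q : CQ) => q.pos ++ q.neg) PT.id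
    (PT.appendList (pt_pos.comp PT.snd) (pt_neg.comp PT.snd))

theorem pt_heads : PT heads :=
  PT.map (F := fun (_ : UCQ) (q : CQ) => q.head) PT.id (pt_head.comp PT.snd)

theorem pt_vars : PT vars :=
  PT.flatMap (F := fun (_ : UCQ) (q : CQ) => q.vars) PT.id (pt_cqVars.comp PT.snd)

theorem pt_arityList : PT arityList :=
  PT.map (F := fun (_ : Atom Name) (_ : Name) => ([] : Name)) pt_args (PT.const [])

theorem pt_cqWF : PT cqWF := by
  unfold cqWF
  have h {f : CQ × Atom Name → Name} (hf : PT f) :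
      PT fun x : CQ × Atom Name => x.1.vars.any fun y => decide (y = f x) :=
    PT.mem (pt_cqVars.comp PT.fst) hf
  have h' : PT fun x : CQ × Name => x.1.vars.any fun y => decide (y = x.2) :=
    PT.mem (pt_cqVars.comp PT.fst) PT.snd
  have hr : PT fun x : CQ × Atom Name => x.2.rel := pt_rel.comp PT.snd
  have ha : PT fun x : CQ × Atom Name => (x.2.args.flatten : Name) :=
    PT.flatten (pt_args.comp PT.snd)
  refine PT.and (PT.all (F := fun (q : CQ) (A : Atom Name) => !decide (A.rel = A.args.flatten) &&
    ((q.vars.any fun x => decide (x = A.rel)) && q.vars.any fun x => decide (x = A.args.flatten)))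
    pt_ineqAtoms ((PT.eq hr ha).not.and ((h hr).and (h ha))))
    (PT.and (PT.all (F := fun (q : CQ) (a : Name) => q.vars.any fun x => decide (x = a))
      (pt_args.comp pt_head) h') (PT.all (F := fun (q : CQ) (a : Name) => q.vars.any fun x => decide (x = a))
      (PT.flatMap (F := fun (_ : CQ) (A : Atom Name) => A.args) pt_neg (pt_args.comp PT.snd)) h'))

theorem PT.allPairs {l l' : Γ → List (Atom Name)} {F : Atom Name → Atom Name → Bool} (hl : PT l)
    (hl' : PT l') (hF : PT fun x : Atom Name × Atom Name => F x.1 x.2) :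
    PT fun g => (l g).all fun A => (l' g).all fun A' => F A A' :=
  PT.all (F := fun g A => (l' g).all fun A' => F A A') hl
    (PT.all (F := fun (x : Γ × Atom Name) A' => F x.2 A') (hl'.comp PT.fst)
      (hF.comp ((PT.snd.comp PT.fst).pair PT.snd)))

theorem pt_sameArity : PT sameArity :=
  PT.allPairs (F := fun A A' => !decide (A.rel = A'.rel) || decide (arityList A = arityList A'))
    PT.id PT.id
    ((PT.eq (pt_rel.comp PT.fst) (pt_rel.comp PT.snd)).not.or
      (PT.eqList (pt_arityList.comp PT.fst) (pt_arityList.comp PT.snd)))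

theorem PT.wfB {Q₁ Q₂ : Γ → UCQ} (h₁ : PT Q₁) (h₂ : PT Q₂) : PT fun g => wfB (Q₁ g) (Q₂ g) := by
  unfold UCQNeg.wfB
  have hne {Q : Γ → UCQ} (h : PT Q) : PT fun g => (Q g).any fun _ => true :=
    PT.any (F := fun _ _ => true) h (PT.const true)
  have hcq {Q : Γ → UCQ} (h : PT Q) : PT fun g => (Q g).all cqWF :=
    PT.all (F := fun _ => cqWF) h (pt_cqWF.comp PT.snd)
  have hrel : PT fun x : Atom Name × Atom Name => decide (x.1.rel = x.2.rel) :=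
    PT.eq (pt_rel.comp PT.fst) (pt_rel.comp PT.snd)
  have hhd {Q : Γ → UCQ} (h : PT Q) : PT fun g => (heads (Q g)).all fun H =>
      (heads (Q g)).all fun H' => decide (H.rel = H'.rel) :=
    PT.allPairs (pt_heads.comp h) (pt_heads.comp h) hrel
  have hb := PT.appendList (pt_body.comp h₁) (pt_body.comp h₂)
  have hh := PT.appendList (pt_heads.comp h₁) (pt_heads.comp h₂)
  exact ((hne h₁).and (hne h₂)).and (((hcq h₁).and (hcq h₂)).and (((hhd h₁).and (hhd h₂)).and
    ((PT.allPairs (F := fun A H => !decide (A.rel = H.rel)) hb hh hrel.not).and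
      (pt_sameArity.comp (PT.appendList hb hh)))))

/-- As `k` is a constant, the disjunction over the possible arities is hard-wired into the program.
-/
theorem pt_arityLe (k : ℕ) : PT (arityLe k) := by
  refine PT.all (F := fun _ A => (List.range (k + 1)).any fun j =>
    decide (arityList A = List.replicate j [])) PT.id ?_
  have h (l : List ℕ) : PT fun x : List (Atom Name) × Atom Name =>
      l.any fun j => decide (arityList x.2 = List.replicate j []) := by
    induction l with
    | nil => exact PT.const false
    | cons j l ih => exact (PT.eqList (pt_arityList.comp PT.snd) (PT.const _)).or ih
  exact h _

/-! ### Decoding -/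

/-- The first of the two queries described by a string. -/
def fstQ (s : Str) : UCQ := decList CQ (before (sym .endUCQ) s)

/-- The second of the two queries described by a string. -/
def sndQ (s : Str) : UCQ := decList CQ (before (sym .endUCQ) (after (sym .endUCQ) s))

/-- Whether a string is the code of two queries. -/
def validB (s : Str) : Bool :=
  decide (encList (fstQ s) ++ ([sym .endUCQ] ++ (encList (sndQ s) ++ [sym .endUCQ])) = s)

theorem pt_fstQ : PT fstQ := (PT.decList CQ).comp (PT.before _)

theorem pt_sndQ : PT sndQ := (PT.decList CQ).comp ((PT.before _).comp (PT.after _))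

theorem pt_validB : PT validB :=
  PT.eqStr.comp ((PT.appendStr ((PT.encList CQ).comp pt_fstQ) (PT.appendStr (PT.const _)
    (PT.appendStr ((PT.encList CQ).comp pt_sndQ) (PT.const _)))).pair PT.id)

/-- The letter after the given one, in the order used to write letters in unary. -/
def nextLetter : Option Sym → Option Sym
  | none => some (sym (.bit true))
  | some (some (Sum.inl (.bit _))) => some (sym .endName)
  | some (some (Sum.inl .endName)) => some (sym .endAtom)
  | some (some (Sum.inl .endAtom)) => some (sym .endAtoms)
  | some (some (Sum.inl .endAtoms)) => some (sym .endCQ)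
  | some (some (Sum.inl .endCQ)) => some (sym .endUCQ)
  | _ => none

/-- The transducer that reads letters written in unary. -/
def unary (q : Option Sym) (a : Sym) : Option Sym × Str :=
  if a = some (Sum.inr true) then (nextLetter q, []) else (none, [q.getD (sym (.bit false))])

/-- A letter in unary. -/
def letterBits : Letter → List Bool
  | .bit false => [false]
  | .bit true => [true, false]
  | .endName => [true, true, false]
  | .endAtom => [true, true, true, false]
  | .endAtoms => [true, true, true, true, false]
  | .endCQ => [true, true, true, true, true, false]
  | .endUCQ => [true, true, true, true, true, true, false]

/-- A bit as a symbol. -/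
abbrev bitSym (b : Bool) : Sym := some (Sum.inr b)

theorem length_letterBits (l : Letter) : (letterBits l).length ≤ 7 := by
  rcases l with (_ | _) | _ | _ | _ | _ | _ <;> simp [letterBits]

/-- The state counts the `true` bits read, `none` standing for zero; a `false` emits the letter
reached and resets the count. -/
theorem transduce_unary (s : List Letter) :
    transduce unary none ((s.flatMap letterBits).map bitSym) = s.map sym := by
  induction s with
  | nil => rfl
  | cons l s ih =>
    rw [List.flatMap_cons, List.map_append, List.map_cons, ← ih]
    rcases l with (_ | _) | _ | _ | _ | _ | _ <;>
      simp [letterBits, transduce, unary, nextLetter]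

/-- The string described by bits. -/
def decBits (u : List Bool) : Str := transduce unary none (u.map bitSym)

/-! ### The two checks -/

/-- The check for bounded arity: `a` describes an assignment and an instance, and `b` an
assignment. -/
noncomputable def checkBounded (k : ℕ) (s a b : Str) : Bool :=
  (validB s && (wfB (fstQ s) (sndQ s) && arityLe k (body (fstQ s) ++ body (sndQ s)))) &&
    -- Certificates are decoded as queries: the head is the fact, the positive atoms are the
    -- instance, and the negated atoms are the assignment as an association list.
    (!((((decCQ a).pos.flatMap Atom.args).all fun x => (vars (fstQ s)).any fun y => decide (y = x)) &&
        (fstQ s).any fun q => yieldsB (decCQ a).pos (decCQ a).neg (decCQ a).head q) ||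
      (sndQ s).any fun q => yieldsB (decCQ a).pos (decCQ b).neg (decCQ a).head q)

/-- The list `L` of assignments is closed under giving a variable in `Z` a value in `E`. -/
def closedB (Z E : List Name) (L : List CQ) : Bool :=
  L.all fun w => Z.all fun z => E.all fun d => L.any fun w' => decide (look w'.neg z = d) &&
    Z.all fun z' => decide (z' = z) || decide (look w'.neg z' = look w.neg z')

/-- The check for non-containment: `a` describes an assignment and an instance, and `b` a list of
assignments. -/
noncomputable def checkExp (s a b : Str) : Bool :=
  !(validB s && wfB (fstQ s) (sndQ s)) ||
    (((fstQ s).any fun q => yieldsB (decCQ a).pos (decCQ a).neg (decCQ a).head q) &&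
      (((decList CQ b).any fun _ => true) &&
      (closedB (vars (sndQ s)) ((decCQ a).pos.flatMap Atom.args) (decList CQ b) &&
        (decList CQ b).all fun w => (sndQ s).all fun q =>
          !yieldsB (decCQ a).pos w.neg (decCQ a).head q)))

theorem pt_decCQ : PT decCQ := Item.pt_dec (α := CQ)

theorem PT.checkBounded (k : ℕ) {s a b : Γ → Str} (hs : PT s) (ha : PT a) (hb : PT b) :
    PT fun g => checkBounded k (s g) (a g) (b g) := by
  unfold UCQNeg.checkBounded
  have h₁ := pt_fstQ.comp hs
  have h₂ := pt_sndQ.comp hs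
  have hI := pt_pos.comp (pt_decCQ.comp ha)
  have hV := pt_neg.comp (pt_decCQ.comp ha)
  have hf := pt_head.comp (pt_decCQ.comp ha)
  have hW := pt_neg.comp (pt_decCQ.comp hb)
  refine ((pt_validB.comp hs).and ((PT.wfB h₁ h₂).and ((pt_arityLe k).comp
    (PT.appendList (pt_body.comp h₁) (pt_body.comp h₂))))).and
    ((PT.not ((PT.all (F := fun g x => (vars (fstQ (s g))).any fun y => decide (y = x))
      (PT.flatMap (F := fun _ A => A.args) hI (pt_args.comp PT.snd)) ?_).and
      (PT.any (F := fun g q => UCQNeg.yieldsB (decCQ (a g)).pos (decCQ (a g)).neg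
        (decCQ (a g)).head q) h₁ ?_))).or
      (PT.any (F := fun g q => UCQNeg.yieldsB (decCQ (a g)).pos (decCQ (b g)).neg
        (decCQ (a g)).head q) h₂ ?_))
  · exact PT.mem ((pt_vars.comp h₁).comp PT.fst) PT.snd
  · exact PT.yieldsB (hI.comp PT.fst) (hV.comp PT.fst) (hf.comp PT.fst) PT.snd
  · exact PT.yieldsB (hI.comp PT.fst) (hW.comp PT.fst) (hf.comp PT.fst) PT.snd

theorem PT.closedB {Z E : Γ → List Name} {L : Γ → List CQ} (hZ : PT Z) (hE : PT E) (hL : PT L) :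
    PT fun g => closedB (Z g) (E g) (L g) := by
  unfold UCQNeg.closedB
  refine PT.all (F := fun g w => (Z g).all fun z => (E g).all fun d => (L g).any fun w' =>
    decide (UCQNeg.look w'.neg z = d) && (Z g).all fun z' => decide (z' = z) ||
      decide (UCQNeg.look w'.neg z' = UCQNeg.look w.neg z')) hL ?_
  refine PT.all (F := fun (x : Γ × CQ) z => (E x.1).all fun d => (L x.1).any fun w' =>
    decide (UCQNeg.look w'.neg z = d) && (Z x.1).all fun z' => decide (z' = z) ||
      decide (UCQNeg.look w'.neg z' = UCQNeg.look x.2.neg z')) (hZ.comp PT.fst) ?_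
  refine PT.all (F := fun (x : (Γ × CQ) × Name) d => (L x.1.1).any fun w' =>
    decide (UCQNeg.look w'.neg x.2 = d) && (Z x.1.1).all fun z' => decide (z' = x.2) ||
      decide (UCQNeg.look w'.neg z' = UCQNeg.look x.1.2.neg z'))
    (hE.comp (PT.fst.comp PT.fst)) ?_
  refine PT.any (F := fun (x : ((Γ × CQ) × Name) × Name) w' =>
    decide (UCQNeg.look w'.neg x.1.2 = x.2) && (Z x.1.1.1).all fun z' => decide (z' = x.1.2) ||
      decide (UCQNeg.look w'.neg z' = UCQNeg.look x.1.1.2.neg z'))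
    (hL.comp (PT.fst.comp (PT.fst.comp PT.fst))) ?_
  refine PT.and (PT.eq (PT.look (pt_neg.comp PT.snd) (PT.snd.comp (PT.fst.comp PT.fst)))
    (PT.snd.comp PT.fst)) ?_
  refine PT.all (F := fun (x : (((Γ × CQ) × Name) × Name) × CQ) z' => decide (z' = x.1.1.2) ||
      decide (UCQNeg.look x.2.neg z' = UCQNeg.look x.1.1.1.2.neg z'))
    (hZ.comp (PT.fst.comp (PT.fst.comp (PT.fst.comp PT.fst)))) ?_
  exact (PT.eq PT.snd (PT.snd.comp (PT.fst.comp (PT.fst.comp PT.fst)))).or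
    (PT.eq (PT.look (pt_neg.comp (PT.snd.comp PT.fst)) PT.snd)
      (PT.look (pt_neg.comp (PT.snd.comp (PT.fst.comp (PT.fst.comp (PT.fst.comp PT.fst)))))
        PT.snd))

theorem PT.checkExp {s a b : Γ → Str} (hs : PT s) (ha : PT a) (hb : PT b) :
    PT fun g => checkExp (s g) (a g) (b g) := by
  unfold UCQNeg.checkExp
  have h₁ := pt_fstQ.comp hs
  have h₂ := pt_sndQ.comp hs
  have hI := pt_pos.comp (pt_decCQ.comp ha)
  have hV := pt_neg.comp (pt_decCQ.comp ha)
  have hf := pt_head.comp (pt_decCQ.comp ha)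
  have hL := (PT.decList CQ).comp hb
  refine (PT.not ((pt_validB.comp hs).and (PT.wfB h₁ h₂))).or
    ((PT.any (F := fun g q => UCQNeg.yieldsB (decCQ (a g)).pos (decCQ (a g)).neg
        (decCQ (a g)).head q) h₁ ?_).and
      ((PT.any (F := fun _ _ => true) hL (PT.const true)).and
      ((PT.closedB (pt_vars.comp h₂)
        (PT.flatMap (F := fun _ A => A.args) hI (pt_args.comp PT.snd)) hL).and
      (PT.all (F := fun g w => (sndQ (s g)).all fun q =>
          !UCQNeg.yieldsB (decCQ (a g)).pos w.neg (decCQ (a g)).head q) hL ?_))))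
  · exact PT.yieldsB (hI.comp PT.fst) (hV.comp PT.fst) (hf.comp PT.fst) PT.snd
  · refine PT.all (F := fun (x : Γ × CQ) q =>
      !UCQNeg.yieldsB (decCQ (a x.1)).pos x.2.neg (decCQ (a x.1)).head q) (h₂.comp PT.fst) ?_
    exact (PT.yieldsB (hI.comp (PT.fst.comp PT.fst)) (pt_neg.comp (PT.snd.comp PT.fst))
      (hf.comp (PT.fst.comp PT.fst)) PT.snd).not

end UCQNeg

/-! ### Transfer of containment to names, and small counterexamples -/

namespace UCQNeg

open Function

/-! ## Semantics over names -/

section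

variable {X Y : Type*}

theorem Atom.map_map (f : X → Y) {Z : Type*} (h : Y → Z) (A : Atom X) :
    (A.map f).map h = A.map (h ∘ f) := by
  simp [Atom.map]

theorem Atom.map_congr {f h : X → Y} {A : Atom X} (e : ∀ x ∈ A.args, f x = h x) :
    A.map f = A.map h := by
  simpa [Atom.map] using e

theorem Atom.map_injective {f : X → Y} (hf : Injective f) : Injective (Atom.map f) := by
  rintro ⟨r, l⟩ ⟨r', l'⟩ h
  simpa [Atom.map, hf.list_map.eq_iff] using h

theorem Atom.Over.map {S : Schema} {A : Atom X} (hA : A.Over S) (V : X → Y) : (A.map V).Over S :=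
  ⟨hA.1, by simpa [Atom.map] using hA.2⟩

/-- The valuation `V` satisfies the body of `q` on the set `I` of facts. -/
structure Sat (q : CQ) (I : Set (Atom X)) (V : Name → X) : Prop where
  pos : ∀ A ∈ q.pos, A.map V ∈ I
  neg : ∀ A ∈ q.neg, A.map V ∉ I
  ineqs : ∀ b ∈ q.ineqs, V b.1 ≠ V b.2

/-- The clause of `Consistent` on atoms is automatic: images of positive atoms lie in `I`, those of
negated atoms do not. -/
theorem satisfies_iff {q : CQ} {I : Finset (Atom X)} {V : Name → X} :
    q.Satisfies I V ↔ Sat q (I : Set (Atom X)) V := by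
  constructor
  · rintro ⟨⟨-, h⟩, h', h''⟩
    exact ⟨fun A hA => Finset.mem_coe.2 (h' A hA), fun A hA hI => h'' A hA (Finset.mem_coe.1 hI), h⟩
  · rintro ⟨h, h', h''⟩
    exact ⟨⟨fun A hA B hB e => h' B hB (e ▸ h A hA), h''⟩, h, h'⟩

/-- All variables of `q` occur in positive atoms. -/
structure Safe (q : CQ) : Prop where
  head : ∀ x ∈ q.head.args, x ∈ q.vars
  neg : ∀ A ∈ q.neg, ∀ x ∈ A.args, x ∈ q.vars
  ineqs : ∀ b ∈ q.ineqs, b.1 ∈ q.vars ∧ b.2 ∈ q.vars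

theorem mem_vars {q : CQ} {x : Name} : x ∈ q.vars ↔ q.PosVar x := by
  simp [CQ.vars, CQ.PosVar]

theorem mem_vars_of_pos {q : CQ} {A : Atom Name} (hA : A ∈ q.pos) {x : Name} (hx : x ∈ A.args) :
    x ∈ q.vars :=
  mem_vars.2 ⟨A, hA, hx⟩

theorem CQ.WF.safe {S : Schema} {q : CQ} (h : CQ.WF S q) : Safe q where
  head x hx := mem_vars.2 (h.head_safe x hx)
  neg A hA x hx := mem_vars.2 (h.neg_safe x ⟨A, hA, hx⟩)
  ineqs b hb := by
    simp only [mem_vars]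
    exact (h.ineqs_vars b hb).imp (fun o => o.elim _root_.id (h.neg_safe _))
      (fun o => o.elim _root_.id (h.neg_safe _))

theorem Sat.congr {q : CQ} (hq : Safe q) {I : Set (Atom X)} {V W : Name → X} (h : Sat q I V)
    (e : ∀ x ∈ q.vars, V x = W x) : Sat q I W where
  pos A hA := by
    rw [← Atom.map_congr fun x hx => e x (mem_vars_of_pos hA hx)]
    exact h.pos A hA
  neg A hA := by
    rw [← Atom.map_congr fun x hx => e x (hq.neg A hA x hx)]
    exact h.neg A hA
  ineqs b hb := by
    rw [← e _ (hq.ineqs b hb).1, ← e _ (hq.ineqs b hb).2]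
    exact h.ineqs b hb

/-- This confines satisfying valuations to the values that occur in the instance. -/
theorem Sat.mem_args {q : CQ} {I : Set (Atom X)} {V : Name → X} (h : Sat q I V) {x : Name}
    (hx : x ∈ q.vars) : ∃ A ∈ I, V x ∈ A.args := by
  obtain ⟨A, hA, hx⟩ := mem_vars.1 hx
  exact ⟨_, h.pos A hA, List.mem_map_of_mem hx⟩

end

/-- `look V` is a total function for any list `V`: it gives `[]` for unlisted names and concatenates
repeated entries. So every decoded certificate describes some assignment, and no validity test on it
is needed. -/
theorem satB_iff {I V : List (Atom Name)} {q : CQ} :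
    satB I V q = true ↔ Sat q {A | A ∈ I} (look V) := by
  simp only [satB, Bool.and_eq_true, List.all_eq_true, List.any_eq_true, decide_eq_true_eq,
    Bool.not_eq_true', List.any_eq_false, decide_eq_false_iff_not, CQ.ineqAtoms, List.mem_map,
    forall_exists_index, and_imp, forall_apply_eq_imp_iff₂, ineqAtom]
  constructor
  · rintro ⟨h, h', h''⟩
    refine ⟨fun A hA => ?_, fun A hA hI => h' A hA _ hI rfl, fun b hb => ?_⟩
    · obtain ⟨F, hF, rfl⟩ := h A hA
      exact hF
    · simpa using h'' b hb
  · rintro ⟨h, h', h''⟩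
    exact ⟨fun A hA => ⟨_, h A hA, rfl⟩, fun A hA F hF e => h' A hA (e ▸ hF),
      fun b hb => by simpa using h'' b hb⟩

theorem yieldsB_iff {I V : List (Atom Name)} {f : Atom Name} {q : CQ} :
    yieldsB I V f q = true ↔ Sat q {A | A ∈ I} (look V) ∧ q.head.map (look V) = f := by
  simp [yieldsB, satB_iff]

/-- The association list of `V` on the names in `l`. -/
def assoc (l : List Name) (V : Name → Name) : List (Atom Name) :=
  l.dedup.map fun x => ⟨x, [V x]⟩

/-- Because `look` concatenates all entries for a name, `assoc` must list each name only once. -/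
theorem look_assoc {l : List Name} (V : Name → Name) {a : Name} (ha : a ∈ l) :
    look (assoc l V) a = V a := by
  have h (m : List Name) (hm : m.Nodup) :
      look (m.map fun x => ⟨x, [V x]⟩) a = if a ∈ m then V a else [] := by
    induction m with
    | nil => rfl
    | cons x m ih =>
      obtain ⟨hx, hm⟩ := List.nodup_cons.1 hm
      have e : look ((x :: m).map fun x => ⟨x, [V x]⟩) a =
          (if x = a then V x else []) ++ look (m.map fun x => ⟨x, [V x]⟩) a := by
        simp [look]
      rw [e, ih hm]
      by_cases hxa : x = a
      · subst hxa
        simp [hx]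
      · simp [hxa, Ne.symm hxa]
  rw [assoc, h _ (List.nodup_dedup l), if_pos (List.mem_dedup.2 ha)]

theorem yieldsB_assoc {I : List (Atom Name)} {V : Name → Name} {q : CQ} (hq : Safe q)
    (h : Sat q {A | A ∈ I} V) {l : List Name} (hl : ∀ x ∈ q.vars, x ∈ l) :
    yieldsB I (assoc l V) (q.head.map V) q = true := by
  rw [yieldsB_iff]
  exact ⟨h.congr hq fun x hx => (look_assoc V (hl x hx)).symm,
    Atom.map_congr fun x hx => look_assoc V (hl x (hq.head x hx))⟩

/-! ### Well-formed queries -/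

/-- An inequality `x ≠ y` is stored as the atom `x(y)`, so flattening its arguments recovers `y`. -/
theorem cqWF_iff {q : CQ} : cqWF q = true ↔ Safe q ∧ ∀ b ∈ q.ineqs, b.1 ≠ b.2 := by
  simp only [cqWF, Bool.and_eq_true, List.all_eq_true, List.any_eq_true, decide_eq_true_eq,
    Bool.not_eq_true', decide_eq_false_iff_not, CQ.ineqAtoms, List.mem_map, exists_eq_right,
    forall_exists_index, and_imp, forall_apply_eq_imp_iff₂, ineqAtom, List.mem_flatMap,
    List.flatten_singleton]
  constructor
  · rintro ⟨h, h', h''⟩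
    exact ⟨⟨h', fun A hA x hx => h'' x A hA hx, fun b hb => (h b hb).2⟩, fun b hb => (h b hb).1⟩
  · rintro ⟨⟨h, h', h''⟩, h'''⟩
    exact ⟨fun b hb => ⟨h''' b hb, h'' b hb⟩, h, fun x A hA hx => h' A hA x hx⟩

theorem arityList_eq_iff {A A' : Atom Name} :
    arityList A = arityList A' ↔ A.args.length = A'.args.length := by
  simp [arityList, List.map_const']

theorem sameArity_iff {l : List (Atom Name)} : sameArity l = true ↔
    ∀ A ∈ l, ∀ A' ∈ l, A.rel = A'.rel → A.args.length = A'.args.length := by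
  simp only [sameArity, List.all_eq_true, Bool.or_eq_true, Bool.not_eq_true',
    decide_eq_false_iff_not, decide_eq_true_eq, arityList_eq_iff, imp_iff_not_or]

theorem arityLe_iff {k : ℕ} {l : List (Atom Name)} :
    arityLe k l = true ↔ ∀ A ∈ l, A.args.length ≤ k := by
  simp [arityLe, arityList, List.map_const']

theorem mem_body {Q : UCQ} {A : Atom Name} : A ∈ body Q ↔ ∃ q ∈ Q, A ∈ q.pos ∨ A ∈ q.neg := by
  simp [body]

theorem mem_heads {Q : UCQ} {A : Atom Name} : A ∈ heads Q ↔ ∃ q ∈ Q, q.head = A := by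
  simp [heads]

theorem wfB_eq_true_iff {Q₁ Q₂ : UCQ} : wfB Q₁ Q₂ = true ↔ (Q₁ ≠ [] ∧ Q₂ ≠ []) ∧
    ((∀ q ∈ Q₁, cqWF q = true) ∧ ∀ q ∈ Q₂, cqWF q = true) ∧
    ((∀ q ∈ Q₁, ∀ q' ∈ Q₁, q.head.rel = q'.head.rel) ∧
      ∀ q ∈ Q₂, ∀ q' ∈ Q₂, q.head.rel = q'.head.rel) ∧
    (∀ A ∈ body Q₁ ++ body Q₂, ∀ H ∈ heads Q₁ ++ heads Q₂, A.rel ≠ H.rel) ∧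
    sameArity ((body Q₁ ++ body Q₂) ++ (heads Q₁ ++ heads Q₂)) = true := by
  have hne (Q : UCQ) : (Q.any fun _ => true) = true ↔ Q ≠ [] := by cases Q <;> simp
  simp only [wfB, Bool.and_eq_true, hne, List.all_eq_true, heads, List.mem_map,
    forall_exists_index, and_imp, forall_apply_eq_imp_iff₂, decide_eq_true_eq, Bool.not_eq_true',
    decide_eq_false_iff_not, ne_eq]

theorem over_of_mem_body {S : Schema} {Q : UCQ} (h : UCQ.WF S Q) {A : Atom Name}
    (hA : A ∈ body Q) : A.Over S := by
  obtain ⟨q, hq, hA | hA⟩ := mem_body.1 hA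
  exacts [(h.disjuncts q hq).pos_over A hA, (h.disjuncts q hq).neg_over A hA]

theorem wfB_of_wf {S : Schema} {Q₁ Q₂ : UCQ} (h₁ : UCQ.WF S Q₁) (h₂ : UCQ.WF S Q₂) :
    wfB Q₁ Q₂ = true := by
  have hB : ∀ A ∈ body Q₁ ++ body Q₂, A.Over S := fun A hA =>
    (List.mem_append.1 hA).elim (over_of_mem_body h₁) (over_of_mem_body h₂)
  have hH : ∀ A ∈ heads Q₁ ++ heads Q₂, A.rel ∉ S.rels ∧ A.args.length = S.ar A.rel := by
    have key {Q : UCQ} (h : UCQ.WF S Q) {A : Atom Name} (hA : A ∈ heads Q) :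
        A.rel ∉ S.rels ∧ A.args.length = S.ar A.rel := by
      obtain ⟨q, hq, rfl⟩ := mem_heads.1 hA
      exact ⟨(h.disjuncts q hq).head_rel, (h.disjuncts q hq).head_ar⟩
    exact fun A hA => (List.mem_append.1 hA).elim (key h₁) (key h₂)
  have hcq {Q : UCQ} (h : UCQ.WF S Q) : ∀ q ∈ Q, cqWF q = true := fun q hq =>
    cqWF_iff.2 ⟨(h.disjuncts q hq).safe, (h.disjuncts q hq).ineqs_ne⟩
  refine wfB_eq_true_iff.2 ⟨⟨h₁.ne_nil, h₂.ne_nil⟩, ⟨hcq h₁, hcq h₂⟩, ⟨h₁.head_rel, h₂.head_rel⟩,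
    fun A hA H hH' e => (hH H hH').1 (e ▸ (hB A hA).1), sameArity_iff.2 ?_⟩
  have har : ∀ A ∈ (body Q₁ ++ body Q₂) ++ (heads Q₁ ++ heads Q₂),
      A.args.length = S.ar A.rel := fun A hA =>
    (List.mem_append.1 hA).elim (fun h => (hB A h).2) (fun h => (hH A h).2)
  intro A hA A' hA' e
  rw [har A hA, har A' hA', e]

-- The schema is rebuilt from the queries: its relations are those of the body atoms, and an arity
-- is read off any body or head atom with the given name, the choice being irrelevant by
-- `sameArity`. Names that occur nowhere get arity `0`. The last clause turns a bound on the atoms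
-- into one on the schema.
open scoped Classical in
theorem exists_schema {Q₁ Q₂ : UCQ} (h : wfB Q₁ Q₂ = true) :
    ∃ S : Schema, UCQ.WF S Q₁ ∧ UCQ.WF S Q₂ ∧
      ∀ R ∈ S.rels, ∃ A ∈ body Q₁ ++ body Q₂, A.args.length = S.ar R := by
  obtain ⟨⟨hn₁, hn₂⟩, ⟨hc₁, hc₂⟩, ⟨hr₁, hr₂⟩, hBH, hs⟩ := wfB_eq_true_iff.1 h
  rw [sameArity_iff] at hs
  set B := body Q₁ ++ body Q₂ with hB
  set H := heads Q₁ ++ heads Q₂ with hH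
  let S : Schema := ⟨(B.map Atom.rel).toFinset, fun R =>
    if h : ∃ A ∈ B ++ H, A.rel = R then h.choose.args.length else 0⟩
  have har : ∀ A ∈ B ++ H, A.args.length = S.ar A.rel := by
    intro A hA
    have hex : ∃ A' ∈ B ++ H, A'.rel = A.rel := ⟨A, hA, rfl⟩
    simp only [S, dif_pos hex]
    exact hs A hA _ hex.choose_spec.1 hex.choose_spec.2.symm
  have hmem {R : Name} : R ∈ S.rels ↔ ∃ A ∈ B, A.rel = R := by simp [S]
  have hover : ∀ A ∈ B, A.Over S := fun A hA =>
    ⟨hmem.2 ⟨A, hA, rfl⟩, har A (List.mem_append_left _ hA)⟩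
  have hhead : ∀ A ∈ H, A.rel ∉ S.rels := fun A hA hR => by
    obtain ⟨A', hA', e⟩ := hmem.1 hR
    exact hBH A' hA' A hA e
  have key {Q : UCQ} (hQ : ∀ q ∈ Q, cqWF q = true) (hb : ∀ A ∈ body Q, A ∈ B)
      (hh : ∀ A ∈ heads Q, A ∈ H) : ∀ q ∈ Q, CQ.WF S q := by
    intro q hq
    obtain ⟨hsafe, hne⟩ := cqWF_iff.1 (hQ q hq)
    have hqh := hh _ (mem_heads.2 ⟨q, hq, rfl⟩)
    exact
      { pos_over := fun A hA => hover A (hb A (mem_body.2 ⟨q, hq, Or.inl hA⟩))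
        neg_over := fun A hA => hover A (hb A (mem_body.2 ⟨q, hq, Or.inr hA⟩))
        ineqs_ne := hne
        ineqs_vars := fun b hb => ⟨Or.inl (mem_vars.1 (hsafe.ineqs b hb).1),
          Or.inl (mem_vars.1 (hsafe.ineqs b hb).2)⟩
        head_rel := hhead _ hqh
        head_ar := har _ (List.mem_append_right _ hqh)
        head_safe := fun x hx => mem_vars.1 (hsafe.head x hx)
        neg_safe := fun x ⟨A, hA, hx⟩ => mem_vars.1 (hsafe.neg A hA x hx) }
  refine ⟨S, ⟨hn₁, key hc₁ (fun A hA => List.mem_append_left _ hA)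
    (fun A hA => List.mem_append_left _ hA), hr₁⟩, ⟨hn₂, key hc₂
    (fun A hA => List.mem_append_right _ hA) (fun A hA => List.mem_append_right _ hA), hr₂⟩,
    fun R hR => ?_⟩
  obtain ⟨A, hA, rfl⟩ := hmem.1 hR
  exact ⟨A, hA, (hover A hA).2⟩

/-! ### Containment over names -/

/-- Positive atoms survive homomorphisms; negated atoms need facts to be reflected, and inequalities
need injectivity on the values taken. -/
theorem Sat.of_map {X Y : Type*} {q : CQ} (hq : Safe q) {I : Set (Atom X)} {J : Set (Atom Y)}
    {W : Name → X} {r : X → Y} (h : Sat q I W)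
    (hpos : ∀ A : Atom X, A ∈ I → A.map r ∈ J)
    (hneg : ∀ A ∈ q.neg, (A.map W).map r ∈ J → A.map W ∈ I)
    (hr : ∀ x ∈ q.vars, ∀ y ∈ q.vars, r (W x) = r (W y) → W x = W y) : Sat q J (r ∘ W) where
  pos A hA := by
    rw [← Atom.map_map]
    exact hpos _ (h.pos A hA)
  neg A hA hJ := by
    rw [← Atom.map_map] at hJ
    exact h.neg A hA (hneg A hA hJ)
  ineqs b hb e := h.ineqs b hb (hr _ (hq.ineqs b hb).1 _ (hq.ineqs b hb).2 e)

open scoped Classical in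
/-- Containment over an infinite domain implies containment over names. -/
theorem exists_sat_of_contained {D : Type*} [Infinite D] {S : Schema} {Q₁ Q₂ : UCQ}
    (h₁ : UCQ.WF S Q₁) (h₂ : UCQ.WF S Q₂) (h : UCQ.Contained D S Q₁ Q₂) {I : List (Atom Name)}
    {q : CQ} (hq : q ∈ Q₁) {V : Name → Name} (hV : Sat q {A | A ∈ I} V) :
    ∃ q' ∈ Q₂, ∃ W : Name → Name, Sat q' {A | A ∈ I} W ∧ q'.head.map W = q.head.map V := by
  obtain ⟨ι, hι⟩ : ∃ ι : Name → D, Injective ι :=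
    ⟨Infinite.natEmbedding D ∘ Encodable.encode,
      (Infinite.natEmbedding D).injective.comp Encodable.encode_injective⟩
  have hmap := Atom.map_injective hι
  -- Facts of `I` that are not over `S` are dropped; no atom of the queries can be mapped to them.
  let J : Finset (Atom D) := ((I.filter fun A => A.Over S).map (Atom.map ι)).toFinset
  have hJ {A : Atom Name} : A.map ι ∈ J ↔ A ∈ I ∧ A.Over S := by
    simp [J, hmap.eq_iff]
  have hJ' {A : Atom D} (hA : A ∈ J) : ∃ B, B.map ι = A ∧ B ∈ I ∧ B.Over S := by
    simp only [J, List.mem_toFinset, List.mem_map, List.mem_filter, decide_eq_true_eq] at hA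
    obtain ⟨B, hB, rfl⟩ := hA
    exact ⟨B, rfl, hB⟩
  have hWF := h₁.disjuncts q hq
  have hVD : Sat q (J : Set (Atom D)) (ι ∘ V) :=
    { pos := fun A hA => by
        rw [← Atom.map_map]
        exact Finset.mem_coe.2 (hJ.2 ⟨hV.pos A hA, (hWF.pos_over A hA).map V⟩)
      neg := fun A hA hI => by
        rw [← Atom.map_map] at hI
        exact hV.neg A hA (hJ.1 (Finset.mem_coe.1 hI)).1
      ineqs := fun b hb e => hV.ineqs b hb (hι e) }
  have hres : q.head.map (ι ∘ V) ∈ UCQ.result Q₁ J := ⟨q, hq, _, satisfies_iff.2 hVD, rfl⟩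
  have hoverJ : ∀ f ∈ J, f.Over S := fun f hf => by
    obtain ⟨B, rfl, -, hB⟩ := hJ' hf
    exact hB.map ι
  obtain ⟨q', hq', W, hW, e⟩ := h J hoverJ hres
  rw [satisfies_iff] at hW
  have hWF' := h₂.disjuncts q' hq'
  -- The values of `W` on variables of `q'` occur in `J`, hence lie in the range of `ι`, and `W` can
  -- be pulled back to names.
  have hinv : ∀ x ∈ q'.vars, ι (invFun ι (W x)) = W x := by
    intro x hx
    obtain ⟨A, hA, hxA⟩ := hW.mem_args hx
    obtain ⟨B, rfl, -⟩ := hJ' (Finset.mem_coe.1 hA)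
    obtain ⟨y, -, hy⟩ := List.mem_map.1 hxA
    exact invFun_eq ⟨y, hy⟩
  have hback {A : Atom Name} (hA : ∀ x ∈ A.args, x ∈ q'.vars) :
      (A.map (invFun ι ∘ W)).map ι = A.map W := by
    rw [Atom.map_map]
    exact Atom.map_congr fun x hx => hinv x (hA x hx)
  refine ⟨q', hq', invFun ι ∘ W, ⟨fun A hA => ?_, fun A hA hI => ?_, fun b hb e' => ?_⟩, ?_⟩
  · have := Finset.mem_coe.1 (hW.pos A hA)
    rw [← hback fun x hx => mem_vars_of_pos hA hx] at this
    exact (hJ.1 this).1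
  · refine hW.neg A hA (Finset.mem_coe.2 ?_)
    rw [← hback fun x hx => hWF'.safe.neg A hA x hx]
    exact hJ.2 ⟨hI, (hWF'.neg_over A hA).map _⟩
  · refine hW.ineqs b hb ?_
    rw [← hinv _ (hWF'.safe.ineqs b hb).1, ← hinv _ (hWF'.safe.ineqs b hb).2]
    exact congrArg ι e'
  · apply hmap
    rw [hback hWF'.safe.head, ← e, Atom.map_map]

/-- The lists of length `n` with entries in `E`. -/
def tuples (E : List Name) : ℕ → List (List Name)
  | 0 => [[]]
  | n + 1 => E.flatMap fun a => (tuples E n).map (a :: ·)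

theorem mem_tuples {E : List Name} {n : ℕ} {l : List Name} :
    l ∈ tuples E n ↔ l.length = n ∧ ∀ x ∈ l, x ∈ E := by
  induction n generalizing l with
  | zero =>
    cases l <;> simp [tuples]
  | succ n ih =>
    cases l with
    | nil => simp [tuples]
    | cons a l =>
      simp only [tuples, List.mem_flatMap, List.mem_map, ih, List.length_cons, List.mem_cons,
        forall_eq_or_imp, Nat.add_right_cancel_iff, List.cons.injEq]
      constructor
      · rintro ⟨b, hb, m, hm, rfl, rfl⟩
        exact ⟨hm.1, hb, hm.2⟩
      · rintro ⟨h, ha, hl⟩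
        exact ⟨a, ha, l, ⟨h, hl⟩, rfl, rfl⟩

theorem length_tuples (E : List Name) (n : ℕ) : (tuples E n).length = E.length ^ n := by
  induction n with
  | zero => rfl
  | succ n ih =>
    simp [tuples, List.length_flatMap, ih, pow_succ, Nat.mul_comm]

/-- The atoms with entries in `E` over the relations of the atoms in `B`. -/
def atomsOver (B : List (Atom Name)) (E : List Name) : List (Atom Name) :=
  B.flatMap fun A => (tuples E A.args.length).map (Atom.mk A.rel)

theorem mem_atomsOver {B : List (Atom Name)} {E : List Name} {T : Atom Name} :
    T ∈ atomsOver B E ↔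
      (∃ A ∈ B, A.rel = T.rel ∧ T.args.length = A.args.length) ∧ ∀ x ∈ T.args, x ∈ E := by
  simp only [atomsOver, List.mem_flatMap, List.mem_map, mem_tuples]
  constructor
  · rintro ⟨A, hA, l, ⟨hl, hE⟩, rfl⟩
    exact ⟨⟨A, hA, rfl, hl⟩, hE⟩
  · rintro ⟨⟨A, hA, e, hl⟩, hE⟩
    exact ⟨A, hA, T.args, ⟨hl, hE⟩, by rw [e]⟩

/-- The base `E.length + 1` is positive even for empty `E`, so the exponent may be raised to `k`. -/
theorem length_atomsOver_le {B : List (Atom Name)} {E : List Name} {k : ℕ}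
    (hB : ∀ A ∈ B, A.args.length ≤ k) :
    (atomsOver B E).length ≤ B.length * (E.length + 1) ^ k := by
  rw [atomsOver, List.length_flatMap]
  have : ∀ m ∈ B.map (fun A => ((tuples E A.args.length).map (Atom.mk A.rel)).length),
      m ≤ (E.length + 1) ^ k := by
    simp only [List.mem_map, List.length_map, length_tuples]
    rintro _ ⟨A, hA, rfl⟩
    exact (Nat.pow_le_pow_left (Nat.le_succ _) _).trans
      (Nat.pow_le_pow_right (Nat.succ_pos _) (hB A hA))
  simpa using List.sum_le_card_nsmul _ _ this

open scoped Classical in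
/-- If containment fails, then it fails on a small instance over the variables of a disjunct. -/
theorem exists_counterexample {D : Type*} {S : Schema} {Q₁ Q₂ : UCQ} (h₁ : UCQ.WF S Q₁)
    (h₂ : UCQ.WF S Q₂) (h : ¬ UCQ.Contained D S Q₁ Q₂) :
    ∃ q ∈ Q₁, ∃ (V : Name → Name) (I : List (Atom Name)), (∀ x ∈ q.vars, V x ∈ q.vars) ∧
      I.Sublist (atomsOver (body Q₁ ++ body Q₂) (q.vars.map V)) ∧ Sat q {A | A ∈ I} V ∧
      ∀ q' ∈ Q₂, ∀ W : Name → Name, Sat q' {A | A ∈ I} W → q'.head.map W ≠ q.head.map V := by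
  simp only [UCQ.Contained, not_forall, Set.not_subset] at h
  obtain ⟨J, -, f, ⟨q, hq, V, hV, rfl⟩, hf⟩ := h
  rw [satisfies_iff] at hV
  have hsafe := (h₁.disjuncts q hq).safe
  -- `r` picks a variable with the given value. Variables thus become the data values of the new
  -- instance, and `V` leads back to `D`.
  let r : D → Name := fun d => if h : ∃ y ∈ q.vars, V y = d then h.choose else []
  have hr {x : Name} (hx : x ∈ q.vars) : r (V x) ∈ q.vars ∧ V (r (V x)) = V x := by
    have hex : ∃ y ∈ q.vars, V y = V x := ⟨x, hx, rfl⟩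
    simp only [r, dif_pos hex]
    exact hex.choose_spec
  let E := q.vars.map (r ∘ V)
  -- All candidate facts with image in `J` are taken, so that negated atoms are reflected.
  let I := (atomsOver (body Q₁ ++ body Q₂) E).filter fun T => T.map V ∈ J
  have hI {T : Atom Name} : T ∈ I ↔ T ∈ atomsOver (body Q₁ ++ body Q₂) E ∧ T.map V ∈ J := by
    simp [I]
  have hback {A : Atom Name} (hA : ∀ x ∈ A.args, x ∈ q.vars) :
      (A.map (r ∘ V)).map V = A.map V := by
    rw [Atom.map_map]
    exact Atom.map_congr fun x hx => (hr (hA x hx)).2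
  have hatoms {A : Atom Name} (hA : A ∈ body Q₁ ++ body Q₂) {W : Name → Name}
      (hW : ∀ x ∈ A.args, W x ∈ E) : A.map W ∈ atomsOver (body Q₁ ++ body Q₂) E :=
    mem_atomsOver.2 ⟨⟨A, hA, rfl, by simp [Atom.map]⟩, by simpa [Atom.map] using hW⟩
  have hEinj : ∀ x ∈ E, ∀ y ∈ E, V x = V y → x = y := by
    intro x' hx' y' hy' e
    obtain ⟨x, hx, rfl⟩ := List.mem_map.1 hx'
    obtain ⟨y, hy, rfl⟩ := List.mem_map.1 hy'
    simp only [comp_apply, (hr hx).2, (hr hy).2] at e ⊢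
    rw [e]
  refine ⟨q, hq, r ∘ V, I, fun x hx => (hr hx).1, List.filter_sublist,
    ⟨fun A hA => ?_, fun A hA hAI => ?_, fun b hb e => ?_⟩, fun q' hq' W hW e => hf ?_⟩
  · have hvars := fun x hx => mem_vars_of_pos hA (x := x) hx
    refine hI.2 ⟨hatoms (List.mem_append_left _ (mem_body.2 ⟨q, hq, Or.inl hA⟩))
      fun x hx => List.mem_map_of_mem (hvars x hx), ?_⟩
    rw [hback hvars]
    exact Finset.mem_coe.1 (hV.pos A hA)
  · have := (hI.1 hAI).2
    rw [hback (hsafe.neg A hA)] at this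
    exact hV.neg A hA (Finset.mem_coe.2 this)
  · refine hV.ineqs b hb ?_
    rw [← (hr (hsafe.ineqs b hb).1).2, ← (hr (hsafe.ineqs b hb).2).2]
    exact congrArg V e
  -- If `W` yielded the fact on `I`, then `V ∘ W` would yield the original fact on `J`.
  · have hsafe' := (h₂.disjuncts q' hq').safe
    have hWE : ∀ x ∈ q'.vars, W x ∈ E := fun x hx => by
      obtain ⟨A, hA, hxA⟩ := hW.mem_args hx
      exact (mem_atomsOver.1 (hI.1 hA).1).2 _ hxA
    refine ⟨q', hq', V ∘ W, satisfies_iff.2 (hW.of_map hsafe' (fun A hA => ?_)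
      (fun A hA hJ => ?_) fun x hx y hy => hEinj _ (hWE x hx) _ (hWE y hy)), ?_⟩
    · exact Finset.mem_coe.2 (hI.1 hA).2
    · exact hI.2 ⟨hatoms (List.mem_append_right _ (mem_body.2 ⟨q', hq', Or.inr hA⟩))
        fun x hx => hWE x (hsafe'.neg A hA x hx), Finset.mem_coe.1 hJ⟩
    · rw [← Atom.map_map, e, hback hsafe.head]

end UCQNeg

/-! ### Size of certificates and decoding of inputs -/

namespace UCQNeg

open Function

/-! ## Lengths of codes -/

section

variable {α β : Type*} {l : List α} {f : α → List β}

theorem length_le_flatMap_of_mem {a : α} (ha : a ∈ l) :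
    (f a).length ≤ (l.flatMap f).length := by
  rw [List.length_flatMap]
  exact List.le_sum_of_mem (List.mem_map_of_mem (f := fun a => (f a).length) ha)

theorem length_flatMap_le {c : ℕ} (h : ∀ a ∈ l, (f a).length ≤ c) :
    (l.flatMap f).length ≤ l.length * c := by
  rw [List.length_flatMap]
  simpa using List.sum_le_card_nsmul (l.map fun a => (f a).length) c (by simpa using h)

theorem length_flatMap_le_flatMap {γ : Type*} {g : α → List γ}
    (h : ∀ a ∈ l, (f a).length ≤ (g a).length) :
    (l.flatMap f).length ≤ (l.flatMap g).length := by
  rw [List.length_flatMap, List.length_flatMap]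
  exact List.sum_le_sum h

theorem length_le_flatMap (h : ∀ a ∈ l, 1 ≤ (f a).length) : l.length ≤ (l.flatMap f).length := by
  have := length_flatMap_le_flatMap (l := l) (f := fun a => [a]) (g := f) (by simpa using h)
  simpa using this

end

/-- The relation name, the number of entries, and the entries of `A` have length at most `n`. -/
structure Small (n : ℕ) (A : Atom Name) : Prop where
  rel : A.rel.length ≤ n
  args : A.args.length ≤ n
  arg : ∀ x ∈ A.args, x.length ≤ n

theorem length_encodeName (x : Name) : (encodeName x).length = x.length + 1 := by
  simp [encodeName]

theorem length_encodeAtom (A : Atom Name) :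
    (encodeAtom A).length = A.rel.length + 1 + (A.args.flatMap encodeName).length + 1 := by
  simp only [encodeAtom, List.length_append, length_encodeName, List.length_singleton]

theorem length_args_le (A : Atom Name) : A.args.length ≤ (A.args.flatMap encodeName).length :=
  length_le_flatMap fun x _ => by simp [length_encodeName]

theorem small_of_length_le {A : Atom Name} {n : ℕ} (h : (encodeAtom A).length ≤ n) :
    Small n A := by
  rw [length_encodeAtom] at h
  refine ⟨by omega, (length_args_le A).trans (by omega), fun x hx => ?_⟩
  have := length_le_flatMap_of_mem (f := encodeName) hx
  rw [length_encodeName] at this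
  omega

theorem Small.length_encodeAtom_le {A : Atom Name} {n : ℕ} (h : Small n A) :
    (encodeAtom A).length ≤ (n + 1) * (n + 1) + 1 := by
  have h1 : (A.args.flatMap encodeName).length ≤ n * (n + 1) :=
    (length_flatMap_le (c := n + 1) fun x hx => by
      rw [length_encodeName]
      exact Nat.succ_le_succ (h.arg x hx)).trans (Nat.mul_le_mul_right _ h.args)
  rw [length_encodeAtom]
  have := h.rel
  nlinarith

theorem length_encodeCQ (q : CQ) : (encodeCQ q).length = (encodeAtom q.head).length +
    (q.pos.flatMap encodeAtom).length + 1 + (q.neg.flatMap encodeAtom).length + 1 +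
    (q.ineqs.flatMap fun b => encodeName b.1 ++ encodeName b.2).length + 1 := by
  simp only [encodeCQ, List.length_append, List.length_singleton]
  omega

theorem length_encodeCQ_le {n : ℕ} {f : Atom Name} {I N : List (Atom Name)} (hf : Small n f)
    (hI : ∀ A ∈ I, Small n A) (hN : ∀ A ∈ N, Small n A) {i m : ℕ} (hi : I.length ≤ i)
    (hm : N.length ≤ m) : (encodeCQ ⟨f, I, N, []⟩).length ≤
      ((n + 1) * (n + 1) + 1) * (1 + i + m) + 3 := by
  have h1 := hf.length_encodeAtom_le
  have h2 := (length_flatMap_le (f := encodeAtom) fun A hA =>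
    (hI A hA).length_encodeAtom_le).trans (Nat.mul_le_mul_right _ hi)
  have h3 := (length_flatMap_le (f := encodeAtom) fun A hA =>
    (hN A hA).length_encodeAtom_le).trans (Nat.mul_le_mul_right _ hm)
  rw [length_encodeCQ]
  simp only [List.flatMap_nil, List.length_nil]
  nlinarith

theorem one_le_length_encodeAtom (A : Atom Name) : 1 ≤ (encodeAtom A).length := by
  rw [length_encodeAtom]
  omega

theorem length_encodeUCQ (Q : UCQ) :
    (encodeUCQ Q).length = (Q.flatMap encodeCQ).length + 1 := by
  simp [encodeUCQ]

section

variable {Q : UCQ} {q : CQ}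

theorem length_encodeCQ_le_of_mem (hq : q ∈ Q) : (encodeCQ q).length ≤ (encodeUCQ Q).length := by
  rw [length_encodeUCQ]
  exact (length_le_flatMap_of_mem hq).trans (Nat.le_succ _)

theorem length_cqVars_le (q : CQ) : q.vars.length ≤ (encodeCQ q).length := by
  have : q.vars.length ≤ (q.pos.flatMap encodeAtom).length :=
    length_flatMap_le_flatMap fun A _ => (length_args_le A).trans (by
      rw [length_encodeAtom]
      omega)
  rw [length_encodeCQ]
  omega

theorem length_vars_le (Q : UCQ) : (vars Q).length ≤ (encodeUCQ Q).length := by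
  rw [length_encodeUCQ]
  exact (length_flatMap_le_flatMap fun q _ => length_cqVars_le q).trans (Nat.le_succ _)

theorem length_body_le (Q : UCQ) : (body Q).length ≤ (encodeUCQ Q).length := by
  rw [length_encodeUCQ]
  refine (length_flatMap_le_flatMap fun q _ => ?_).trans (Nat.le_succ _)
  have h1 := length_le_flatMap (l := q.pos) fun A _ => one_le_length_encodeAtom A
  have h2 := length_le_flatMap (l := q.neg) fun A _ => one_le_length_encodeAtom A
  rw [List.length_append, length_encodeCQ]
  omega

theorem small_head (hq : q ∈ Q) {n : ℕ} (hn : (encodeUCQ Q).length ≤ n) : Small n q.head := by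
  have := length_encodeCQ_le_of_mem hq
  rw [length_encodeCQ] at this
  exact small_of_length_le (by omega)

theorem small_body {A : Atom Name} (hA : A ∈ body Q) {n : ℕ} (hn : (encodeUCQ Q).length ≤ n) :
    Small n A := by
  obtain ⟨q, hq, hA⟩ := mem_body.1 hA
  have := length_encodeCQ_le_of_mem hq
  rw [length_encodeCQ] at this
  refine small_of_length_le ?_
  rcases hA with hA | hA
  all_goals
    have := length_le_flatMap_of_mem (f := encodeAtom) hA
    omega

theorem mem_vars_of_mem (hq : q ∈ Q) {x : Name} (hx : x ∈ q.vars) : x ∈ vars Q :=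
  List.mem_flatMap.2 ⟨q, hq, hx⟩

theorem length_le_of_mem_vars {x : Name} (hx : x ∈ vars Q) {n : ℕ}
    (hn : (encodeUCQ Q).length ≤ n) : x.length ≤ n := by
  obtain ⟨q, hq, hx⟩ := List.mem_flatMap.1 hx
  obtain ⟨A, hA, hx⟩ := mem_vars.1 hx
  exact (small_body (mem_body.2 ⟨q, hq, Or.inl hA⟩) hn).arg x hx

end

theorem small_assoc {n : ℕ} (hn : 1 ≤ n) {l : List Name} {V : Name → Name}
    (hl : ∀ x ∈ l, x.length ≤ n) (hV : ∀ x ∈ l, (V x).length ≤ n) : ∀ A ∈ assoc l V, Small n A := by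
  intro A hA
  obtain ⟨x, hx, rfl⟩ := List.mem_map.1 hA
  have hx := List.mem_dedup.1 hx
  exact ⟨hl x hx, by simpa using hn, by simpa using hV x hx⟩

theorem length_assoc_le (l : List Name) (V : Name → Name) : (assoc l V).length ≤ l.length := by
  rw [assoc, List.length_map]
  exact (List.dedup_sublist l).length_le

theorem Small.map {n : ℕ} {A : Atom Name} (h : Small n A) {V : Name → Name}
    (hV : ∀ x ∈ A.args, (V x).length ≤ n) : Small n (A.map V) :=
  ⟨h.rel, by simpa [Atom.map] using h.args, by simpa [Atom.map] using hV⟩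

/-! ## Certificates -/

/-- If containment fails, then a query describes a counterexample: its head is the fact, its
positive atoms are the instance, and its negated atoms the assignment. -/
theorem exists_certificate {D : Type*} {S : Schema} {Q₁ Q₂ : UCQ} (h₁ : UCQ.WF S Q₁)
    (h₂ : UCQ.WF S Q₂) (h : ¬ UCQ.Contained D S Q₁ Q₂) {n k : ℕ}
    (hn : (encodeUCQ Q₁).length + (encodeUCQ Q₂).length ≤ n)
    (hk : ∀ A ∈ body Q₁ ++ body Q₂, A.args.length ≤ k) :
    ∃ c : CQ, (∃ q ∈ Q₁, yieldsB c.pos c.neg c.head q = true) ∧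
      (∀ q ∈ Q₂, ∀ W, yieldsB c.pos W c.head q = false) ∧
      (∀ x ∈ c.pos.flatMap Atom.args, x ∈ vars Q₁) ∧
      (c.pos.flatMap Atom.args).length ≤ n * (n + 1) ^ k * n ∧
      (encodeCQ c).length ≤ ((n + 1) * (n + 1) + 1) * (1 + n * (n + 1) ^ k + n) + 3 := by
  obtain ⟨q, hq, V, I, hV, hI, hsat, hno⟩ := exists_counterexample h₁ h₂ h
  have hn₁ : (encodeUCQ Q₁).length ≤ n := by omega
  have hn₂ : (encodeUCQ Q₂).length ≤ n := by omega
  have hpos : 1 ≤ n := by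
    rw [length_encodeUCQ] at hn₁
    omega
  have hsafe := (h₁.disjuncts q hq).safe
  have hlen : ∀ x ∈ q.vars, x.length ≤ n := fun x hx =>
    length_le_of_mem_vars (mem_vars_of_mem hq hx) hn₁
  have hvars : q.vars.length ≤ n :=
    (length_cqVars_le q).trans ((length_encodeCQ_le_of_mem hq).trans hn₁)
  have hmem : ∀ A ∈ I, ∀ x ∈ A.args, x ∈ q.vars := fun A hA x hx => by
    obtain ⟨y, hy, rfl⟩ := List.mem_map.1 ((mem_atomsOver.1 (hI.subset hA)).2 x hx)
    exact hV y hy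
  have hsmall : ∀ A ∈ I, Small n A := fun A hA => by
    obtain ⟨⟨B, hB, hr, hl⟩, -⟩ := mem_atomsOver.1 (hI.subset hA)
    have hB' : Small n B := (List.mem_append.1 hB).elim (fun h => small_body h hn₁)
      fun h => small_body h hn₂
    exact ⟨hr ▸ hB'.rel, hl ▸ hB'.args, fun x hx => hlen x (hmem A hA x hx)⟩
  -- There are at most `n` body atoms, and for each at most `(n + 1) ^ k` tuples over at most `n`
  -- values.
  have hcard : I.length ≤ n * (n + 1) ^ k := by
    refine hI.length_le.trans ((length_atomsOver_le hk).trans (Nat.mul_le_mul ?_ ?_))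
    · have := length_body_le Q₁
      have := length_body_le Q₂
      rw [List.length_append]
      omega
    · exact Nat.pow_le_pow_left (by simpa using hvars) _
  refine ⟨⟨q.head.map V, I, assoc q.vars V, []⟩,
    ⟨q, hq, yieldsB_assoc hsafe hsat fun _ => _root_.id⟩, fun q' hq' W => ?_, fun x hx => ?_, ?_,
    length_encodeCQ_le ((small_head hq hn₁).map fun x hx => hlen _ (hV x (hsafe.head x hx))) hsmall
      (small_assoc hpos hlen fun x hx => hlen _ (hV x hx)) hcard
      ((length_assoc_le _ _).trans hvars)⟩
  · rw [Bool.eq_false_iff, Ne, yieldsB_iff]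
    rintro ⟨hW, e⟩
    exact hno q' hq' _ hW e
  · obtain ⟨A, hA, hx⟩ := List.mem_flatMap.1 hx
    exact mem_vars_of_mem hq (hmem A hA x hx)
  · exact (length_flatMap_le fun A hA => (hsmall A hA).args).trans (Nat.mul_le_mul_right _ hcard)

/-- Letters as bits. -/
def lettersBits (t : List Letter) : List Bool := t.flatMap letterBits

theorem decBits_lettersBits (t : List Letter) : decBits (lettersBits t) = t.map sym :=
  transduce_unary t

theorem length_lettersBits_le (t : List Letter) : (lettersBits t).length ≤ 7 * t.length :=
  (length_flatMap_le fun a _ => length_letterBits a).trans (Nat.mul_comm _ _).le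

theorem map_dropLast_encodeCQ (c : CQ) : (encodeCQ c).dropLast.map sym = cqStr c := by
  rw [List.map_dropLast, map_encodeCQ, List.dropLast_concat]

theorem decCQ_cqStr (c : CQ) : decCQ (cqStr c) = c := Item.dec_enc c

theorem endUCQ_notMem_cqStr (c : CQ) : sym .endUCQ ∉ cqStr c := by
  intro h
  simp only [cqStr, ineqStr, List.mem_append, List.mem_cons] at h
  rcases h with h | h | h | h | h | h | h
  · rcases mem_atomStr h with ⟨b, h⟩ | h <;> simp [sym] at h
  · simp [sym] at h
  · rcases mem_encList_atom h with ⟨b, h⟩ | h | h <;> simp [sym] at h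
  · simp [sym] at h
  · rcases mem_encList_atom h with ⟨b, h⟩ | h | h <;> simp [sym] at h
  · simp [sym] at h
  · rcases mem_encList h with h | ⟨n, -, h⟩
    · simp [sym, Item.term] at h
    · obtain ⟨b, h⟩ := mem_nameStr h
      simp [sym] at h

theorem endUCQ_notMem_encList (Q : List CQ) : sym .endUCQ ∉ encList Q := by
  intro h
  rcases mem_encList h with h | ⟨q, -, h⟩
  · simp [sym, Item.term] at h
  · exact endUCQ_notMem_cqStr q h

theorem sym_injective : Injective sym := fun a b h => by simpa [sym] using h

theorem map_encode (Q₁ Q₂ : UCQ) : (encodeUCQ Q₁ ++ encodeUCQ Q₂).map sym =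
    encList Q₁ ++ sym .endUCQ :: (encList Q₂ ++ sym .endUCQ :: []) := by
  simp [map_encodeUCQ]

theorem fstQ_encode (Q₁ Q₂ : UCQ) : fstQ ((encodeUCQ Q₁ ++ encodeUCQ Q₂).map sym) = Q₁ := by
  rw [map_encode, fstQ, before_append (endUCQ_notMem_encList _), decList_encList]

theorem sndQ_encode (Q₁ Q₂ : UCQ) : sndQ ((encodeUCQ Q₁ ++ encodeUCQ Q₂).map sym) = Q₂ := by
  rw [map_encode, sndQ, after_append (endUCQ_notMem_encList _),
    before_append (endUCQ_notMem_encList _), decList_encList]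

/-- The decoders are total, so a word is a code of two queries exactly if encoding what it decodes
to gives it back. -/
theorem validB_iff {x : List Letter} : validB (x.map sym) = true ↔
    ∃ Q₁ Q₂ : UCQ, x = encodeUCQ Q₁ ++ encodeUCQ Q₂ := by
  constructor
  · intro h
    rw [validB, decide_eq_true_eq] at h
    refine ⟨fstQ (x.map sym), sndQ (x.map sym), sym_injective.list_map (Eq.trans h.symm ?_)⟩
    rw [map_encode]
    simp
  · rintro ⟨Q₁, Q₂, rfl⟩
    rw [validB, decide_eq_true_eq, fstQ_encode, sndQ_encode, map_encode]
    simp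

end UCQNeg

/-! ### The two upper bounds -/

namespace UCQNeg

open Function StackProg Complexity
open Ctx (rep)

/-! ## Bounded arity -/

/-- The bound on the lengths of certificates for bounded arity. -/
noncomputable def boundedPoly (k : ℕ) : Polynomial ℕ :=
  7 * ((((.X + 1) * (.X + 1) + 1) * (1 + .X * (.X + 1) ^ k + .X)) + 3)

theorem eval_boundedPoly (k n : ℕ) : (boundedPoly k).eval n =
    7 * (((n + 1) * (n + 1) + 1) * (1 + n * (n + 1) ^ k + n) + 3) := by
  simp [boundedPoly]

theorem decCQ_decBits (c : CQ) : decCQ (decBits (lettersBits (encodeCQ c).dropLast)) = c := by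
  rw [decBits_lettersBits, map_dropLast_encodeCQ, decCQ_cqStr]

theorem length_lettersBits_dropLast_le (c : CQ) :
    (lettersBits (encodeCQ c).dropLast).length ≤ 7 * (encodeCQ c).length :=
  (length_lettersBits_le _).trans (by simp)

theorem checkBounded_encode {k : ℕ} {Q₁ Q₂ : UCQ} {a b : Str} :
    checkBounded k ((encodeUCQ Q₁ ++ encodeUCQ Q₂).map sym) a b = true ↔
      (wfB Q₁ Q₂ = true ∧ ∀ A ∈ body Q₁ ++ body Q₂, A.args.length ≤ k) ∧
      ((∀ x ∈ (decCQ a).pos.flatMap Atom.args, x ∈ vars Q₁) →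
        (∃ q ∈ Q₁, yieldsB (decCQ a).pos (decCQ a).neg (decCQ a).head q = true) →
        ∃ q ∈ Q₂, yieldsB (decCQ a).pos (decCQ b).neg (decCQ a).head q = true) := by
  simp only [checkBounded, fstQ_encode, sndQ_encode, validB_iff.2 ⟨Q₁, Q₂, rfl⟩, Bool.true_and,
    Bool.and_eq_true, arityLe_iff, Bool.or_eq_true, Bool.not_eq_true', ← Bool.not_eq_true,
    List.all_eq_true, List.any_eq_true, decide_eq_true_eq, exists_eq_right, ← imp_iff_not_or,
    and_imp]

/-- The word `u` proposes a counterexample and `v` refutes it by a valuation for `Q₂`. Under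
containment a refutation exists by `exists_sat_of_contained`; without it, `exists_certificate`
supplies a short `u` that has none. -/
theorem mem_boundedContainment_iff {D : Type*} [Infinite D] {k : ℕ} {x : List Letter} :
    x ∈ BoundedContainment D k ↔
      ∀ u : List Bool, u.length ≤ (boundedPoly k).eval x.length →
        ∃ v : List Bool, v.length ≤ (boundedPoly k).eval x.length ∧
          checkBounded k (x.map sym) (decBits u) (decBits v) = true := by
  constructor
  · rintro ⟨S, Q₁, Q₂, hS, h₁, h₂, rfl, hc⟩ u -
    set n := (encodeUCQ Q₁ ++ encodeUCQ Q₂).length with hn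
    rw [List.length_append] at hn
    have hwf : wfB Q₁ Q₂ = true ∧ ∀ A ∈ body Q₁ ++ body Q₂, A.args.length ≤ k := by
      refine ⟨wfB_of_wf h₁ h₂, fun A hA => ?_⟩
      have := (List.mem_append.1 hA).elim (over_of_mem_body h₁) (over_of_mem_body h₂)
      exact this.2 ▸ hS _ this.1
    set c := decCQ (decBits u) with hcu
    by_cases hu : (∀ x ∈ c.pos.flatMap Atom.args, x ∈ vars Q₁) ∧
        ∃ q ∈ Q₁, yieldsB c.pos c.neg c.head q = true
    · obtain ⟨hvars, q, hq, hy⟩ := hu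
      rw [yieldsB_iff] at hy
      obtain ⟨q', hq', W, hW, e⟩ := exists_sat_of_contained h₁ h₂ hc hq hy.1
      have hsafe := (h₂.disjuncts q' hq').safe
      refine ⟨lettersBits (encodeCQ ⟨⟨[], []⟩, [], assoc q'.vars W, []⟩).dropLast, ?_,
        checkBounded_encode.2 ⟨hwf, fun _ _ => ⟨q', hq', ?_⟩⟩⟩
      · have hpos : 1 ≤ n := by
          have := length_encodeUCQ Q₁
          omega
        have hlen : (encodeCQ ⟨⟨[], []⟩, [], assoc q'.vars W, []⟩).length ≤
            ((n + 1) * (n + 1) + 1) * (1 + n * (n + 1) ^ k + n) + 3 := by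
          refine length_encodeCQ_le ⟨by simp, by simp, by simp⟩ (by simp)
            (small_assoc hpos (fun x hx => ?_) fun x hx => ?_) (by simp)
            ((length_assoc_le _ _).trans ?_)
          · exact length_le_of_mem_vars (mem_vars_of_mem hq' hx) (by omega)
          -- The values of `W` occur in the instance, which the check restricts to variables of
          -- `Q₁`; this keeps them, and so the answer, short.
          · obtain ⟨A, hA, hx⟩ := hW.mem_args hx
            exact length_le_of_mem_vars (hvars _ (List.mem_flatMap.2 ⟨A, hA, hx⟩)) (by omega)
          · have := (length_cqVars_le q').trans (length_encodeCQ_le_of_mem hq')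
            omega
        rw [eval_boundedPoly]
        exact (length_lettersBits_dropLast_le _).trans (Nat.mul_le_mul_left _ hlen)
      · rw [decCQ_decBits, ← hcu, ← hy.2, ← e]
        exact yieldsB_assoc hsafe hW fun _ => _root_.id
    · exact ⟨[], Nat.zero_le _, checkBounded_encode.2 ⟨hwf, fun h h' => absurd ⟨h, h'⟩ hu⟩⟩
  · intro h
    -- Already `u = []` forces the input to be a well-formed pair of queries with arities at most
    -- `k`, since the check demands this for every `u`.
    obtain ⟨v, -, hv⟩ := h [] (Nat.zero_le _)
    obtain ⟨Q₁, Q₂, rfl⟩ : ∃ Q₁ Q₂ : UCQ, x = encodeUCQ Q₁ ++ encodeUCQ Q₂ := by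
      simp only [checkBounded, Bool.and_eq_true] at hv
      exact validB_iff.1 hv.1.1
    obtain ⟨⟨hwf, har⟩, -⟩ := checkBounded_encode.1 hv
    obtain ⟨S, h₁, h₂, hS⟩ := exists_schema hwf
    refine ⟨S, Q₁, Q₂, fun R hR => ?_, h₁, h₂, rfl, ?_⟩
    · obtain ⟨A, hA, e⟩ := hS R hR
      exact e ▸ har A hA
    · by_contra hc
      obtain ⟨c, hc₁, hc₂, hvars, -, hlen⟩ :=
        exists_certificate h₁ h₂ hc (List.length_append (as := encodeUCQ Q₁)).ge har
      obtain ⟨v, -, hv⟩ := h (lettersBits (encodeCQ c).dropLast) (by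
        rw [eval_boundedPoly]
        exact (length_lettersBits_dropLast_le _).trans (Nat.mul_le_mul_left _ hlen))
      have := (checkBounded_encode.1 hv).2
      rw [decCQ_decBits] at this
      obtain ⟨q, hq, hy⟩ := this hvars hc₁
      rw [hc₂ q hq] at hy
      exact Bool.false_ne_true hy

theorem PT.run {Γ : Type} [Ctx Γ] {f : Γ → Bool} (hf : PT f) :
    ∃ (P : Prog Sym) (p : Polynomial ℕ), ∀ g, ∃ t ≤ p.eval (size g),
      Run P (st (rep g)) (st [if f g then [none] else []]) t := by
  obtain ⟨P, p, hP⟩ := hf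
  refine ⟨P, p, fun g => ?_⟩
  obtain ⟨b, ⟨t, ht, hr⟩, hb⟩ := hP g
  exact ⟨t, by omega, hr⟩

theorem pi2P_boundedContainment (D : Type*) [Infinite D] (k : ℕ) :
    Pi2P (BoundedContainment D k) := by
  refine ⟨boundedPoly k, fun w => checkBounded k (w.1.map sym) (decBits w.2.1) (decBits w.2.2), ?_,
    fun x => mem_boundedContainment_iff⟩
  -- The triple arrives reversed; after reversal it is split at its two separators `none`.
  have ha : PT fun s : Str => after none s.reverse := (PT.after none).comp PT.reverse
  have hpt : PT fun s : Str => checkBounded k (before none s.reverse)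
      (transduce unary none (before none (after none s.reverse)))
      (transduce unary none (after none (after none s.reverse))) :=
    PT.checkBounded k ((PT.before none).comp PT.reverse)
      ((PT.transduce unary).comp ((PT.before none).comp ha))
      ((PT.transduce unary).comp ((PT.after none).comp ha))
  obtain ⟨P, p, hP⟩ := hpt.run
  refine computableInPolyTime_of_run (P := P) _root_.id none p fun w => ?_
  obtain ⟨t, ht, hr⟩ := hP (encodeTriple w).reverse
  refine ⟨t, by simpa using ht, ?_⟩
  obtain ⟨x, u, v⟩ := w
  have h1 : (none : Sym) ∉ x.map sym := by simp [sym]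
  have h2 : (none : Sym) ∉ u.map bitSym := by simp
  have e : encodeTriple (x, u, v) = x.map sym ++ none :: (u.map bitSym ++ none :: v.map bitSym) :=
    rfl
  rw [List.reverse_reverse, e, before_append h1, after_append h1, before_append h2,
    after_append h2, ← e] at hr
  rw [List.map_id]
  exact hr

/-! ## Unbounded arity -/

theorem closedB_iff {Z E : List Name} {L : List CQ} : closedB Z E L = true ↔
    ∀ w ∈ L, ∀ z ∈ Z, ∀ d ∈ E, ∃ w' ∈ L, look w'.neg z = d ∧
      ∀ z' ∈ Z, z' = z ∨ look w'.neg z' = look w.neg z' := by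
  simp only [closedB, List.all_eq_true, List.any_eq_true, Bool.and_eq_true, Bool.or_eq_true,
    decide_eq_true_eq]

/-- Start from any listed assignment and give the variables in `l` their intended values one at a
time; closure keeps the result in the list. Thus a test of polynomial cost in the length of the list
guarantees that exponentially many assignments are covered. -/
theorem exists_agree_of_closedB {Z E : List Name} {L : List CQ} (h : closedB Z E L = true)
    (hL : L ≠ []) {W : Name → Name} {l : List Name} (hl : ∀ x ∈ l, x ∈ Z)
    (hW : ∀ x ∈ l, W x ∈ E) : ∃ w ∈ L, ∀ x ∈ l, look w.neg x = W x := by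
  induction l with
  | nil =>
    obtain ⟨w, hw⟩ := List.exists_mem_of_ne_nil L hL
    exact ⟨w, hw, by simp⟩
  | cons x l ih =>
    simp only [List.mem_cons, forall_eq_or_imp] at hl hW
    obtain ⟨w, hw, hwl⟩ := ih hl.2 hW.2
    obtain ⟨w', hw', hx, hrest⟩ := closedB_iff.1 h w hw x hl.1 _ hW.1
    refine ⟨w', hw', List.forall_mem_cons.2 ⟨hx, fun y hy => ?_⟩⟩
    -- `l` may contain `x` again; then the new value is already the intended one.
    rcases hrest y (hl.2 y hy) with rfl | e
    · exact hx
    · rw [e, hwl y hy]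

/-- The assignment that maps the entries of `Z` to those of `l`. -/
def tupleMap (Z l : List Name) (x : Name) : Name := l.getD (Z.idxOf x) []

theorem tupleMap_mem {Z l E : List Name} (hl : l ∈ tuples E Z.length) {x : Name} (hx : x ∈ Z) :
    tupleMap Z l x ∈ E := by
  obtain ⟨hlen, hE⟩ := mem_tuples.1 hl
  have : Z.idxOf x < l.length := hlen ▸ List.idxOf_lt_length_of_mem hx
  rw [tupleMap, List.getD_eq_getElem _ _ this]
  exact hE _ (List.getElem_mem _)

/-- `Z` may repeat a variable; the first occurrence is consulted, where `Z.map W` has the entry `W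
x`. -/
theorem tupleMap_map {Z : List Name} {W : Name → Name} {x : Name} (hx : x ∈ Z) :
    tupleMap Z (Z.map W) x = W x := by
  have : Z.idxOf x < (Z.map W).length := by
    simpa using List.idxOf_lt_length_of_mem hx
  rw [tupleMap, List.getD_eq_getElem _ _ this]
  simp

/-- All assignments of entries of `E` to the entries of `Z`. -/
def assignments (Z E : List Name) : List CQ :=
  (tuples E Z.length).map fun l => ⟨⟨[], []⟩, [], assoc Z (tupleMap Z l), []⟩

theorem closedB_assignments {Z E E' : List Name} (hE : ∀ x ∈ E', x ∈ E) :
    closedB Z E' (assignments Z E) = true := by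
  rw [closedB_iff]
  intro w hw z hz d hd
  obtain ⟨l, hl, rfl⟩ := List.mem_map.1 hw
  let W := update (tupleMap Z l) z d
  have hW : ∀ x ∈ Z, W x ∈ E := fun x hx => by
    by_cases e : x = z
    · simpa [W, e] using hE d hd
    · simpa [W, e] using tupleMap_mem hl hx
  have hmem : Z.map W ∈ tuples E Z.length := mem_tuples.2 ⟨by simp, by simpa using hW⟩
  refine ⟨_, List.mem_map_of_mem hmem, ?_, fun x hx => ?_⟩
  · simp only [look_assoc _ hz, tupleMap_map hz, W, update_self]
  · by_cases e : x = z
    · exact Or.inl e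
    · right
      simp only [look_assoc _ hx, tupleMap_map hx, W, update_of_ne e]

theorem length_assignments (Z E : List Name) : (assignments Z E).length = E.length ^ Z.length := by
  rw [assignments, List.length_map, length_tuples]

theorem checkExp_encode {Q₁ Q₂ : UCQ} {a b : Str} :
    checkExp ((encodeUCQ Q₁ ++ encodeUCQ Q₂).map sym) a b = true ↔ (wfB Q₁ Q₂ = true →
      (∃ q ∈ Q₁, yieldsB (decCQ a).pos (decCQ a).neg (decCQ a).head q = true) ∧
      decList CQ b ≠ [] ∧
      closedB (vars Q₂) ((decCQ a).pos.flatMap Atom.args) (decList CQ b) = true ∧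
      ∀ w ∈ decList CQ b, ∀ q ∈ Q₂, yieldsB (decCQ a).pos w.neg (decCQ a).head q = false) := by
  have hne (L : List CQ) : (∃ x ∈ L, True) ↔ L ≠ [] := by cases L <;> simp
  simp only [checkExp, fstQ_encode, sndQ_encode, validB_iff.2 ⟨Q₁, Q₂, rfl⟩, Bool.true_and,
    Bool.or_eq_true, Bool.not_eq_true', Bool.and_eq_true, List.any_eq_true, List.all_eq_true, hne,
    ← Bool.not_eq_true (wfB Q₁ Q₂), ← imp_iff_not_or]

/-- The check of a certificate for non-containment. -/
noncomputable def checkCert (x : List Letter) (y : List Bool) : Bool :=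
  checkExp (x.map sym) (before (sym .endUCQ) (decBits y)) (after (sym .endUCQ) (decBits y))

/-- Under containment some valuation `W` yields the fact for `Q₂`. By closure a listed assignment
agrees with `W` on the variables of the disjunct, hence yields the fact as well, which the check has
ruled out. -/
theorem notMem_containment_of_checkCert {D : Type*} [Infinite D] {x : List Letter} {y : List Bool}
    (h : checkCert x y = true) : x ∉ Containment D := by
  rintro ⟨S, Q₁, Q₂, h₁, h₂, rfl, hc⟩
  obtain ⟨⟨q, hq, hy⟩, hne, hclosed, hno⟩ := checkExp_encode.1 h (wfB_of_wf h₁ h₂)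
  rw [yieldsB_iff] at hy
  obtain ⟨q', hq', W, hW, e⟩ := exists_sat_of_contained h₁ h₂ hc hq hy.1
  obtain ⟨w, hw, hagree⟩ := exists_agree_of_closedB (W := W) (l := q'.vars) hclosed hne
    (fun x hx => mem_vars_of_mem hq' hx) (fun x hx => by
      obtain ⟨A, hA, hx⟩ := hW.mem_args hx
      exact List.mem_flatMap.2 ⟨A, hA, hx⟩)
  have hsafe := (h₂.disjuncts q' hq').safe
  refine Bool.eq_false_iff.1 (hno w hw q' hq') (yieldsB_iff.2
    ⟨hW.congr hsafe fun x hx => (hagree x hx).symm, ?_⟩)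
  rw [Atom.map_congr fun x hx => hagree x (hsafe.head x hx), e, hy.2]

/-- The bound on the lengths of certificates for non-containment. -/
def expBound (n : ℕ) : ℕ :=
  -- A letter takes at most `7` bits. The first line bounds the counterexample, with arity bound
  -- `n`; the second bounds the separator and the assignments, of which there are at most (number of
  -- values)`^ n`.
  7 * (((n + 1) * (n + 1) + 1) * (1 + n * (n + 1) ^ n + n) + 3 +
    (1 + (n * (n + 1) ^ n * n + 1) ^ n * (((n + 1) * (n + 1) + 1) * (1 + 0 + n) + 3)))

theorem expBounded_expBound : ExpBounded expBound := by
  have h1 : ExpBounded fun n => n + 1 := ExpBounded.id.add (.const 1)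
  have h2 : ExpBounded fun n => (n + 1) ^ n := by simpa using h1.pow .X
  have h3 : ExpBounded fun n => n * (n + 1) ^ n := ExpBounded.id.mul h2
  have h4 : ExpBounded fun n => (n * (n + 1) ^ n * n + 1) ^ n := by
    simpa using ((h3.mul .id).add (.const 1)).pow .X
  have h5 : ExpBounded fun n => (n + 1) * (n + 1) + 1 := (h1.mul h1).add (.const 1)
  exact (ExpBounded.const 7).mul (((h5.mul (((ExpBounded.const 1).add h3).add .id)).add
    (.const 3)).add ((ExpBounded.const 1).add (h4.mul ((h5.mul ((ExpBounded.const (1 + 0)).add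
      .id)).add (.const 3)))))

/-- Words that are not well-formed pairs of queries belong to the complement and pass with any
certificate. Otherwise the certificate is a small counterexample followed by all assignments. -/
theorem exists_checkCert {D : Type*} {x : List Letter} (hx : x ∉ Containment D) :
    ∃ y : List Bool, y.length ≤ expBound x.length ∧ checkCert x y = true := by
  by_cases hv : validB (x.map sym) = true
  swap
  · exact ⟨[], Nat.zero_le _, by simp [checkCert, checkExp, hv]⟩
  obtain ⟨Q₁, Q₂, rfl⟩ := validB_iff.1 hv
  by_cases hwf : wfB Q₁ Q₂ = true
  swap
  · exact ⟨[], Nat.zero_le _, checkExp_encode.2 fun h => absurd h hwf⟩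
  obtain ⟨S, h₁, h₂, -⟩ := exists_schema hwf
  have hc : ¬ UCQ.Contained D S Q₁ Q₂ := fun hc => hx ⟨S, Q₁, Q₂, h₁, h₂, rfl, hc⟩
  set n := (encodeUCQ Q₁ ++ encodeUCQ Q₂).length with hn
  rw [List.length_append] at hn
  have hn₁ : (encodeUCQ Q₁).length ≤ n := by omega
  have hn₂ : (encodeUCQ Q₂).length ≤ n := by omega
  have hpos : 1 ≤ n := by
    have := length_encodeUCQ Q₁
    omega
  obtain ⟨c, hc₁, hc₂, hvars, hdom, hlen⟩ := exists_certificate h₁ h₂ hc hn.ge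
    (k := n) fun A hA => ((List.mem_append.1 hA).elim (fun h => small_body h hn₁)
      fun h => small_body h hn₂).args
  -- The additional value `[]` makes `E` nonempty, so that at least one assignment is listed even
  -- for an empty instance.
  set E := [] :: c.pos.flatMap Atom.args with hE
  have hElen : ∀ x ∈ E, x.length ≤ n := by
    refine List.forall_mem_cons.2 ⟨Nat.zero_le _, fun x hx => ?_⟩
    exact length_le_of_mem_vars (hvars x hx) hn₁
  let L := assignments (vars Q₂) E
  let t := (encodeCQ c).dropLast ++ Letter.endUCQ :: L.flatMap encodeCQ
  have ht : t.map sym = cqStr c ++ sym .endUCQ :: encList L := by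
    simp [t, List.map_flatMap, map_encodeCQ, map_dropLast_encodeCQ, encList, Item.enc, Item.term,
      -List.map_dropLast]
  have hL : L ≠ [] := by
    intro h
    have := length_assignments (vars Q₂) E
    rw [show assignments (vars Q₂) E = [] from h] at this
    exact (pow_pos (Nat.succ_pos _) _).ne this
  refine ⟨lettersBits t, ?_, ?_⟩
  · refine (length_lettersBits_le t).trans (Nat.mul_le_mul_left _ ?_)
    have hvlen : (vars Q₂).length ≤ n := (length_vars_le Q₂).trans hn₂
    have hcount : L.length ≤ (n * (n + 1) ^ n * n + 1) ^ n := by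
      rw [length_assignments]
      refine (Nat.pow_le_pow_left (?_ : E.length ≤ n * (n + 1) ^ n * n + 1) _).trans
        (Nat.pow_le_pow_right (Nat.succ_pos _) hvlen)
      simpa [hE] using hdom
    have hflat : (L.flatMap encodeCQ).length ≤ (n * (n + 1) ^ n * n + 1) ^ n *
        (((n + 1) * (n + 1) + 1) * (1 + 0 + n) + 3) := by
      refine (length_flatMap_le fun w hw => ?_).trans (Nat.mul_le_mul_right _ hcount)
      obtain ⟨l, hl, rfl⟩ := List.mem_map.1 hw
      exact length_encodeCQ_le ⟨by simp, by simp, by simp⟩ (by simp)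
        (small_assoc hpos (fun x hx => length_le_of_mem_vars hx hn₂)
          fun x hx => hElen _ (tupleMap_mem hl hx)) le_rfl ((length_assoc_le _ _).trans hvlen)
    simp only [t, List.length_append, List.length_dropLast, List.length_cons]
    omega
  · rw [checkCert, decBits_lettersBits, ht, before_append (endUCQ_notMem_cqStr c),
      after_append (endUCQ_notMem_cqStr c), checkExp_encode, decCQ_cqStr, decList_encList]
    exact fun _ => ⟨hc₁, hL, closedB_assignments fun x hx => List.mem_cons_of_mem _ hx,
      fun w _ q hq => hc₂ q hq _⟩

theorem coNEXPTIME_containment (D : Type*) [Infinite D] : CoNEXPTIME (Containment D) := by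
  have hb : PT fun p : Str × Str => transduce unary none p.2 := (PT.transduce unary).comp PT.snd
  -- Only the input has to be reversed; the guessed bits lie on their stack in order.
  have hpt : PT fun p : Str × Str => checkExp p.1.reverse
      (before (sym .endUCQ) (transduce unary none p.2))
      (after (sym .endUCQ) (transduce unary none p.2)) :=
    PT.checkExp (PT.reverse.comp PT.fst) ((PT.before _).comp hb) ((PT.after _).comp hb)
  obtain ⟨P, p, hP⟩ := hpt.run
  refine nexptime_of_run (emb := sym) (bit := bitSym) (a₀ := none) (P := P) (f := checkCert)
    expBounded_expBound p (eval_mono p) (fun x y => ?_)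
    (fun x y => notMem_containment_of_checkCert) (fun x => exists_checkCert)
  obtain ⟨t, ht, hr⟩ := hP ((x.map sym).reverse, y.map bitSym)
  refine ⟨t, by simpa using ht, ?_⟩
  simp only [List.reverse_reverse] at hr
  exact hr

end UCQNeg

theorem mainTheorem4 (D : Type*) [Infinite D] :
    Complexity.CoNEXPTIME (UCQNeg.Containment D) ∧
      ∀ k : ℕ, Complexity.Pi2P (UCQNeg.BoundedContainment D k) := by
  exact ⟨UCQNeg.coNEXPTIME_containment D, UCQNeg.pi2P_boundedContainment D⟩
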